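/- Permutations may be empty; $\varepsilon$ denotes the empty permutation. A permutation class is a set of permutations closed under pattern containment (it is immaterial whether $\varepsilon$ is counted as a member). A \emph{specification} is a finite system of equations $\mathcal S_i=f_i(\mathcal S_1,\dots,\mathcal S_r)$ whose right-hand sides are built from the neutral class $\mathcal E$ (one object, of size $0$), the atoms $\mathcal Z,\mathcal Z^{\mathsf L},\mathcal Z^{\mathsf R},\mathcal Z^{\mathsf{LR}}$ (each of size $1$) and the classes $\mathcal S_1,\dots,\mathcal S_r$ by finite (possibly empty) disjoint sums $+$, noncommutative products $\times$ and the sequence construction $\textsc{Seq}$. The $\mathcal S_i$ are its least solution, and they are required to be combinatorial classes: each has finitely many objects of each size, and $\textsc{Seq}$ is only applied to classes without objects of size $0$. The specification is \emph{context-free} if it does not use $\textsc{Seq}$, and \emph{regular} if no class $\mathcal S_i$ occurs in a right-hand side. It is a (bottom-to-top) specification for a set $\mathcal C$ of permutations that \emph{tracks the leftmost and rightmost entries} if there is a bijection from the objects of $\mathcal S_1$ to $\mathcal C$ under which the atoms of an object, read from left to right, correspond to the entries of the permutation, read from bottom to top, where the atom is $\mathcal Z^{\mathsf{LR}}$ for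 an entry that is both leftmost and rightmost, $\mathcal Z^{\mathsf L}$ for any other leftmost entry, $\mathcal Z^{\mathsf R}$ for any other rightmost entry, and $\mathcal Z$ for all other entries. Let $\mathcal C$ be a permutation class, let $1\le j\le k$, let $\mathcal C_j=\mathcal C$ and $\mathcal C_i\in\{\operatorname{Av}(21),\operatorname{Av}(12)\}$ for all $i\ne j$. Let $\mathcal G$ be the $k\times 1$ grid class with cells $\mathcal C_1,\dots,\mathcal C_k$ from left to right, that is, the set of permutations that can be cut by vertical lines into $k$ consecutive (possibly empty) blocks such that the entries of the $i$-th block are order-isomorphic to a member of $\mathcal C_i\cup\{\varepsilon\}$. 1. If $\mathcal C$ has a specification that tracks the leftmost and rightmost entries, then so does $\mathcal G$; and if moreover the generating function of $\mathcal C$ is algebraic over $\mathbb C(z)$, then so is that of $\mathcal G$. 2. If $\mathcal C$ has a context-free specification that tracks the leftmost and rightmost entries, then so does $\mathcal G$; in particular $\mathcal G$ has an algebraic generating function. 3. If $\mathcal C$ has a regular specification that tracks the leftmost and rightmost entries, then so does $\mathcal G$; in particular $\mathcal G$ has a rational generating function. -/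

import Mathlib

namespace SkinnyGrid

/-! ### Permutations, containment, grid classes -/

/-- A permutation of some length `n` (possibly `0`): `π p` is the value of the entry in
position `p`. -/
abbrev Permutation : Type := Σ n : ℕ, Equiv.Perm (Fin n)

/-- The entries of `π` in the positions `f 0 < f 1 < ⋯` are order-isomorphic to `σ`. -/
def IsOccurrence (σ π : Permutation) (f : Fin σ.1 ↪o Fin π.1) : Prop :=
  ∀ a b, σ.2 a < σ.2 b ↔ π.2 (f a) < π.2 (f b)

/-- `σ` is contained in `π`. -/
def Contains (π σ : Permutation) : Prop := ∃ f : Fin σ.1 ↪o Fin π.1, IsOccurrence σ π f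

/-- The empty permutation. -/
def emptyPerm : Permutation := ⟨0, 1⟩

/-- A set of permutations that is closed under containment. Whether the empty permutation is
counted as a member of the class is left open: both conventions are covered. -/
def IsPermClass (C : Set Permutation) : Prop :=
  ∀ π ∈ C, ∀ σ, Contains π σ → σ ≠ emptyPerm → σ ∈ C

/-- The permutations that avoid `β`. -/
def Av (β : Permutation) : Set Permutation := {π | ¬ Contains π β}

/-- The permutation `12`. -/
def perm12 : Permutation := ⟨2, 1⟩

/-- The permutation `21`. -/
def perm21 : Permutation := ⟨2, Equiv.swap 0 1⟩

/-- The `k × 1` grid class (a row of `k` cells) with the given cells: the permutations that can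
be cut by vertical lines into `k` consecutive, possibly empty, blocks of positions such that the
entries in the `i`-th block are order-isomorphic to a permutation in `cell i ∪ {ε}`.
The number `col p` is the block of the position `p`. -/
def gridClass {k : ℕ} (cell : Fin k → Set Permutation) : Set Permutation :=
  {π | ∃ col : Fin π.1 → Fin k, Monotone col ∧
    ∀ i, ∃ σ ∈ cell i ∪ {emptyPerm}, ∃ f : Fin σ.1 ↪o Fin π.1,
      Set.range f = {p | col p = i} ∧ IsOccurrence σ π f}

/-! ### Combinatorial specifications -/

/-- The four atoms: a generic entry, the leftmost entry, the rightmost entry, and an entry that is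
both leftmost and rightmost. -/
inductive Atom : Type
  | Z
  | L
  | R
  | LR

/-- The expressions on the right hand sides of a specification whose classes are indexed by `ι`:
the empty sum `0`, the neutral class `ℰ` (one object, of size zero), atoms, classes, sums,
(noncommutative) products and sequences. -/
inductive Expr (ι : Type) : Type
  | zero : Expr ι
  | eps : Expr ι
  | atom (a : Atom) : Expr ι
  | cls (i : ι) : Expr ι
  | add (e f : Expr ι) : Expr ι
  | mul (e f : Expr ι) : Expr ι
  | seq (e : Expr ι) : Expr ι

/-- The expression does not use the sequence construction. -/
def Expr.SeqFree {ι : Type} : Expr ι → Prop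
  | .add e f => e.SeqFree ∧ f.SeqFree
  | .mul e f => e.SeqFree ∧ f.SeqFree
  | .seq _ => False
  | _ => True

/-- The expression does not refer to any class: it is built from atoms (and `ℰ`) alone. -/
def Expr.ClassFree {ι : Type} : Expr ι → Prop
  | .cls _ => False
  | .add e f => e.ClassFree ∧ f.ClassFree
  | .mul e f => e.ClassFree ∧ f.ClassFree
  | .seq e => e.ClassFree
  | _ => True

/-- A finite system of equations `S_i = eqn i`, with a distinguished class `S_start`. -/
structure Spec where
  Idx : Type
  finite_idx : Finite Idx
  eqn : Idx → Expr Idx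
  start : Idx

/-- The objects of the class denoted by an expression. The classes `S_i` are the least solution of
the system: their objects are the ones built in finitely many steps. Sums are disjoint, products
are ordered pairs, sequences are finite lists. -/
inductive Obj (S : Spec) : Expr S.Idx → Type
  | eps : Obj S .eps
  | atom (a : Atom) : Obj S (.atom a)
  | cls (i : S.Idx) (x : Obj S (S.eqn i)) : Obj S (.cls i)
  | inl {e f : Expr S.Idx} (x : Obj S e) : Obj S (.add e f)
  | inr {e f : Expr S.Idx} (y : Obj S f) : Obj S (.add e f)
  | pair {e f : Expr S.Idx} (x : Obj S e) (y : Obj S f) : Obj S (.mul e f)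
  | nil {e : Expr S.Idx} : Obj S (.seq e)
  | cons {e : Expr S.Idx} (x : Obj S e) (y : Obj S (.seq e)) : Obj S (.seq e)

/-- The atoms of an object, read from left to right. -/
def Obj.word {S : Spec} : {e : Expr S.Idx} → Obj S e → List Atom
  | _, .eps => []
  | _, .atom a => [a]
  | _, .cls _ x => x.word
  | _, .inl x => x.word
  | _, .inr y => y.word
  | _, .pair x y => x.word ++ y.word
  | _, .nil => []
  | _, .cons x y => x.word ++ y.word

/-- The size of an object: every atom has size one. -/
def Obj.size {S : Spec} {e : Expr S.Idx} (x : Obj S e) : ℕ := x.word.length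

/-- The sequence construction is applied only to classes without objects of size zero. -/
def SeqAdmissible (S : Spec) : Expr S.Idx → Prop
  | .add e f => SeqAdmissible S e ∧ SeqAdmissible S f
  | .mul e f => SeqAdmissible S e ∧ SeqAdmissible S f
  | .seq e => (∀ x : Obj S e, x.size ≠ 0) ∧ SeqAdmissible S e
  | _ => True

/-- The system defines combinatorial classes: each `S_i` has finitely many objects of each size,
and the sequence construction is applied only where it is admissible. -/
structure Spec.WellDefined (S : Spec) : Prop where
  finite_size : ∀ (i : S.Idx) (n : ℕ), {x : Obj S (.cls i) | x.size = n}.Finite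
  seq_admissible : ∀ i : S.Idx, SeqAdmissible S (S.eqn i)

/-- Context-free: only sums and products are used. -/
def Spec.ContextFree (S : Spec) : Prop := ∀ i, (S.eqn i).SeqFree

/-- Regular: only atoms, combined by sums, products and sequences, are used. -/
def Spec.Regular (S : Spec) : Prop := ∀ i, (S.eqn i).ClassFree

/-! ### Bottom-to-top specifications that track the leftmost and the rightmost entry -/

/-- The atom that represents the entry in position `p` of a permutation of length `n`. -/
def entryAtom (n : ℕ) (p : Fin n) : Atom :=
  if p.val = 0 then
    if p.val + 1 = n then .LR else .L
  else
    if p.val + 1 = n then .R else .Z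

/-- The entries of `π` from bottom to top (by increasing value), each represented by its atom. -/
def trackedWord (π : Permutation) : List Atom :=
  List.ofFn fun v : Fin π.1 => entryAtom π.1 (π.2.symm v)

/-- `S` is a bottom-to-top specification of `C` that tracks both the leftmost and the rightmost
entries: its objects are in bijection with the permutations in `C`, in such a way that the atoms
of an object, from left to right, are the entries of the permutation, from bottom to top, with the
leftmost and the rightmost entry (and no other entry) represented by their own atoms. -/
def Spec.TracksLR (S : Spec) (C : Set Permutation) : Prop :=
  S.WellDefined ∧
    ∃ φ : Obj S (.cls S.start) ≃ C, ∀ x, x.word = trackedWord (φ x : Permutation)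

/-! ### Generating functions -/

/-- The ordinary generating function of a set of permutations. -/
noncomputable def genFun (C : Set Permutation) : PowerSeries ℂ :=
  PowerSeries.mk fun n => (({σ : Equiv.Perm (Fin n) | (⟨n, σ⟩ : Permutation) ∈ C}.ncard : ℕ) : ℂ)

/-- `f` is a root of a nonzero polynomial `P(z, y)`, with `z` the variable of the series. -/
def AlgebraicSeries (f : PowerSeries ℂ) : Prop := IsAlgebraic (Polynomial ℂ) f

/-- `f` is a quotient of two polynomials. -/
def RationalSeries (f : PowerSeries ℂ) : Prop :=
  ∃ p q : Polynomial ℂ, q ≠ 0 ∧ (q : PowerSeries ℂ) * f = (p : PowerSeries ℂ)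

end SkinnyGrid

/-!
Write a permutation in the grid class as a permutation `σ` from the first cells followed by an
increasing sequence from the last cell. The cut becomes canonical when the increasing sequence is
taken as long as possible, that is, when the cut is made at the last descent: the class of the
permutations in the first cells is closed under containment, so it contains the shorter initial
segment. Then, unless the permutation is increasing, the lowest entry of the sequence lies below the
rightmost entry of `σ`, and the permutation is determined by `σ` and by the way in which the values
of the sequence are interleaved with those of `σ`. In the word of atoms, read from bottom to top,
this means that new atoms are inserted arbitrarily into the word of `σ`, subject to the condition
that one of them precedes the atom of the rightmost entry. That atom is marked in the word of `σ`,
so the condition can be checked while the word is read from left to right. The old rightmost entry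
loses its mark, and the last new atom receives it (`wiso_append`).

The insertion is thus carried out by a transducer with finitely many states, and specifications are
closed under such transducers (`Presented.transduce`). Each class is replaced by the classes of its
objects together with a run of the transducer between two given states. The transitions of the
transducer lead from a state to itself or to a larger state, so the runs over a sequence can be
described by products of sequences: no classes are needed for them, and a regular specification
remains regular. The words of new atoms that are inserted in one transition are described by a
sequence if the specification is regular, and otherwise by an auxiliary recursive class. The
bijections between objects are weight-preserving (`WIso`), where the weight of an object consists of
its word and of the number of equations that are used to build it. A system of classes is isomorphic
to the least solution as soon as it satisfies the equations with these weights, since the second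
component allows an induction.

The other cases reduce to this one by the symmetries. Complementation, which reverses the words,
turns a decreasing cell into an increasing one. Reversal, which exchanges the marks `L` and `R`,
turns cells to the left into cells to the right. Induction on the number of cells concludes
(`trackable_gridClass`).

The generating function of a class without references to classes is rational by induction on the
expression. For all other well-defined specifications, including the ones with sequences, it is
algebraic (`algebraicSeries_of_wellDefined`): over the field `ℂ(z)`, let `L` be the field that is
generated by the generating functions of all classes. The equations of the system express the Kähler
differentials of the generators by themselves, by means of the Jacobian matrix. At `z = 0`, and
without the empty classes, this matrix is nilpotent, because otherwise there would be infinitely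
many objects of the same size. So the differentials vanish, and in characteristic zero the finitely
generated extension `L` is algebraic.
-/

namespace SkinnyGrid

/-! ### Weighted sets -/

/-- Two weighted sets are isomorphic: there is a bijection between them that preserves the
weights. -/
def WIso {X Y W : Type} (f : X → W) (g : Y → W) : Prop := ∃ e : X ≃ Y, ∀ x, g (e x) = f x

namespace WIso

variable {X Y Z X' Y' W V : Type}

lemma refl (f : X → W) : WIso f f := ⟨Equiv.refl _, fun _ => rfl⟩

lemma of_eq {f g : X → W} (h : ∀ x, f x = g x) : WIso f g := ⟨Equiv.refl _, fun x => (h x).symm⟩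

lemma symm {f : X → W} {g : Y → W} (h : WIso f g) : WIso g f := by
  obtain ⟨e, he⟩ := h
  exact ⟨e.symm, fun y => by rw [← he, e.apply_symm_apply]⟩

lemma trans {f : X → W} {g : Y → W} {h : Z → W} (h₁ : WIso f g) (h₂ : WIso g h) : WIso f h := by
  obtain ⟨e, he⟩ := h₁
  obtain ⟨e', he'⟩ := h₂
  exact ⟨e.trans e', fun x => by rw [Equiv.trans_apply, he', he]⟩

lemma of_bijective {f : X → W} {g : Y → W} (e : X → Y) (he : Function.Bijective e)
    (h : ∀ x, g (e x) = f x) : WIso f g := ⟨Equiv.ofBijective e he, h⟩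

lemma comp {f : X → W} {g : Y → W} (h : WIso f g) (k : W → V) :
    WIso (fun x => k (f x)) (fun y => k (g y)) := by
  obtain ⟨e, he⟩ := h
  exact ⟨e, fun x => congrArg k (he x)⟩

lemma of_isEmpty [IsEmpty X] [IsEmpty Y] (f : X → W) (g : Y → W) : WIso f g :=
  ⟨Equiv.equivOfIsEmpty X Y, fun x => isEmptyElim x⟩

lemma sum {f : X → W} {g : Y → W} {f' : X' → W} {g' : Y' → W} (h : WIso f g) (h' : WIso f' g') :
    WIso (Sum.elim f f') (Sum.elim g g') := by
  obtain ⟨e, he⟩ := h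
  obtain ⟨e', he'⟩ := h'
  exact ⟨e.sumCongr e', by rintro (x | x) <;> simp [he, he']⟩

lemma prod [Mul W] {f : X → W} {g : Y → W} {f' : X' → W} {g' : Y' → W} (h : WIso f g)
    (h' : WIso f' g') :
    WIso (fun p : X × X' => f p.1 * f' p.2) (fun p : Y × Y' => g p.1 * g' p.2) := by
  obtain ⟨e, he⟩ := h
  obtain ⟨e', he'⟩ := h'
  exact ⟨e.prodCongr e', by rintro ⟨x, y⟩; simp [he, he']⟩

lemma list [Monoid W] {f : X → W} {g : Y → W} (h : WIso f g) :
    WIso (fun l : List X => (l.map f).prod) (fun l : List Y => (l.map g).prod) := by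
  obtain ⟨e, he⟩ := h
  refine ⟨Equiv.listEquivOfEquiv e, fun l => ?_⟩
  simp only [Equiv.listEquivOfEquiv, Equiv.coe_fn_mk, List.map_map]
  congr 2
  funext x
  exact he x

lemma sigma {A : Type} {P Q : A → Type} {f : ∀ a, P a → W} {g : ∀ a, Q a → W}
    (h : ∀ a, WIso (f a) (g a)) :
    WIso (fun p : Σ a, P a => f p.1 p.2) (fun p : Σ a, Q a => g p.1 p.2) := by
  choose e he using h
  exact ⟨Equiv.sigmaCongrRight e, fun p => he p.1 p.2⟩

end WIso

/-! ### The set functor of an expression -/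

/-- The weight of an object: its word of atoms, and the number of times that an equation of the
system is unfolded in it. The second component makes the objects of the least solution
accessible to induction. -/
abbrev Weight : Type := FreeMonoid Atom × Multiplicative ℕ

/-- The weight of an atom. -/
def atomWeight (a : Atom) : Weight := (FreeMonoid.of a, 1)

/-- The weight of unfolding one equation. -/
def tick : Weight := (1, Multiplicative.ofAdd 1)

/-- The objects denoted by an expression when its classes are interpreted as the types `X i`. -/
def Interp {ι : Type} (X : ι → Type) : Expr ι → Type
  | .zero => Empty
  | .eps => Unit
  | .atom _ => Unit
  | .cls i => X i
  | .add e f => Interp X e ⊕ Interp X f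
  | .mul e f => Interp X e × Interp X f
  | .seq e => List (Interp X e)

/-- The weight on `Interp X e` that is induced by weights on the types `X i`. -/
def Interp.weight {ι : Type} {X : ι → Type} (w : ∀ i, X i → Weight) :
    ∀ e : Expr ι, Interp X e → Weight
  | .zero => fun z => Empty.elim z
  | .eps => fun _ => 1
  | .atom a => fun _ => atomWeight a
  | .cls i => w i
  | .add e f => Sum.elim (Interp.weight w e) (Interp.weight w f)
  | .mul e f => fun p => Interp.weight w e p.1 * Interp.weight w f p.2
  | .seq e => fun l => (l.map (Interp.weight w e)).prod

/-- The weight of an object of a specification. -/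
def Obj.weight {S : Spec} : {e : Expr S.Idx} → Obj S e → Weight
  | _, .eps => 1
  | _, .atom a => atomWeight a
  | _, .cls _ x => tick * x.weight
  | _, .inl x => x.weight
  | _, .inr y => y.weight
  | _, .pair x y => x.weight * y.weight
  | _, .nil => 1
  | _, .cons x y => x.weight * y.weight

lemma Obj.weight_fst {S : Spec} {e : Expr S.Idx} (x : Obj S e) :
    x.weight.1 = FreeMonoid.ofList x.word := by
  induction x with
  | eps => rfl
  | atom a => rfl
  | cls i x ih => simp [Obj.weight, Obj.word, tick, ih]
  | inl x ih => exact ih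
  | inr x ih => exact ih
  | pair x y ihx ihy => simp [Obj.weight, Obj.word, ihx, ihy, FreeMonoid.ofList_append]
  | nil => rfl
  | cons x y ihx ihy => simp [Obj.weight, Obj.word, ihx, ihy, FreeMonoid.ofList_append]

/-- The evaluation of objects in a family of types `X i` that solves the system. -/
def Obj.eval {S : Spec} {X : S.Idx → Type} (α : ∀ i, Interp X (S.eqn i) → X i) :
    {e : Expr S.Idx} → Obj S e → Interp X e
  | _, .eps => Unit.unit
  | _, .atom _ => Unit.unit
  | _, .cls i x => α i (x.eval α)
  | _, .inl x => Sum.inl (x.eval α)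
  | _, .inr y => Sum.inr (y.eval α)
  | _, .pair x y => Prod.mk (x.eval α) (y.eval α)
  | _, .nil => List.nil
  | _, .cons x y => List.cons (x.eval α) (y.eval α)

lemma Obj.eval_injective {S : Spec} {X : S.Idx → Type} (α : ∀ i, Interp X (S.eqn i) → X i)
    (hα : ∀ i, Function.Injective (α i)) {e : Expr S.Idx} :
    Function.Injective (Obj.eval α : Obj S e → Interp X e) := by
  intro x y h
  induction x with
  | eps => cases y; rfl
  | atom a => cases y; rfl
  | cls i x ih =>
    cases y with
    | cls _ y => rw [ih (hα i h)]
  | inl x ih =>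
    cases y with
    | inl y => rw [ih (Sum.inl.inj h)]
    | inr y => exact absurd h Sum.inl_ne_inr
  | inr x ih =>
    cases y with
    | inl y => exact absurd h Sum.inr_ne_inl
    | inr y => rw [ih (Sum.inr.inj h)]
  | pair x y ihx ihy =>
    cases y with
    | pair x' y' => rw [ihx (Prod.mk.inj h).1, ihy (Prod.mk.inj h).2]
  | nil =>
    cases y with
    | nil => rfl
    | cons x y => exact absurd h (List.cons_ne_nil _ _).symm
  | cons x y ihx ihy =>
    cases y with
    | nil => exact absurd h (List.cons_ne_nil _ _)
    | cons x' y' => rw [ihx (List.cons.inj h).1, ihy (List.cons.inj h).2]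

lemma Obj.weight_eval {S : Spec} {X : S.Idx → Type} {w : ∀ i, X i → Weight}
    (α : ∀ i, Interp X (S.eqn i) → X i)
    (hw : ∀ i z, w i (α i z) = tick * Interp.weight w (S.eqn i) z) {e : Expr S.Idx} (x : Obj S e) :
    Interp.weight w e (x.eval α) = x.weight := by
  induction x with
  | eps => rfl
  | atom a => rfl
  | cls i x ih => exact (hw i _).trans (by rw [ih]; rfl)
  | inl x ih => exact ih
  | inr x ih => exact ih
  | pair x y ihx ihy =>
    exact congrArg₂ (· * ·) ihx ihy
  | nil => rfl
  | @cons e x y ihx ihy =>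
    have : Interp.weight w (.seq e) ((Obj.cons x y).eval α) =
      Interp.weight w e (x.eval α) * Interp.weight w (.seq e) (y.eval α) := List.prod_cons
    rw [this, ihx, ihy]; rfl

lemma Obj.eval_surjective {S : Spec} {X : S.Idx → Type} {w : ∀ i, X i → Weight}
    (α : ∀ i, Interp X (S.eqn i) → X i) (hα : ∀ i, Function.Surjective (α i))
    (hw : ∀ i z, w i (α i z) = tick * Interp.weight w (S.eqn i) z) :
    ∀ (n : ℕ) (e : Expr S.Idx) (z : Interp X e), (Interp.weight w e z).2.toAdd < n →
      ∃ x : Obj S e, x.eval α = z := by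
  intro n
  induction n with
  | zero => intro e z h; omega
  | succ n ihn =>
    intro e
    induction e with
    | zero => intro z; exact Empty.elim z
    | eps => intro z _; exact ⟨.eps, rfl⟩
    | atom a => intro z _; exact ⟨.atom a, rfl⟩
    | cls i =>
      intro z h
      obtain ⟨z', rfl⟩ := hα i z
      have h' : (w i (α i z')).2.toAdd < n + 1 := h
      rw [hw] at h'
      obtain ⟨x, rfl⟩ := ihn (S.eqn i) z' (by simp [tick] at h'; omega)
      exact ⟨.cls i x, rfl⟩
    | add e f ihe ihf =>
      rintro (z | z) h
      · obtain ⟨x, rfl⟩ := ihe z h; exact ⟨.inl x, rfl⟩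
      · obtain ⟨x, rfl⟩ := ihf z h; exact ⟨.inr x, rfl⟩
    | mul e f ihe ihf =>
      rintro ⟨z, z'⟩ h
      have h' : (Interp.weight w e z * Interp.weight w f z').2.toAdd < n + 1 := h
      simp at h'
      obtain ⟨x, rfl⟩ := ihe z (by omega)
      obtain ⟨x', rfl⟩ := ihf z' (by omega)
      exact ⟨.pair x x', rfl⟩
    | seq e ihe =>
      intro (l : List (Interp X e)) h
      induction l with
      | nil => exact ⟨.nil, rfl⟩
      | cons z l ihl =>
        have h' : (Interp.weight w e z * Interp.weight w (.seq e) l).2.toAdd < n + 1 := by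
          have : Interp.weight w (.seq e) (z :: l) =
            Interp.weight w e z * Interp.weight w (.seq e) l := List.prod_cons
          rwa [← this]
        simp only [Prod.snd_mul, toAdd_mul] at h'
        obtain ⟨x, rfl⟩ := ihe z (by omega)
        obtain ⟨x', rfl⟩ := ihl (by omega)
        exact ⟨.cons x x', rfl⟩

/-- The least solution is the only solution in which every unfolding of an equation counts: a
family of weighted sets that solves the system, with one tick per equation, is isomorphic to the
family of the objects of the specification. -/
theorem Obj.wiso_of_solution {S : Spec} {X : S.Idx → Type} {w : ∀ i, X i → Weight}
    (h : ∀ i, WIso (fun z => tick * Interp.weight w (S.eqn i) z) (w i)) (e : Expr S.Idx) :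
    WIso (Obj.weight : Obj S e → Weight) (Interp.weight w e) := by
  choose α hα using h
  exact WIso.of_bijective (Obj.eval fun i => α i)
    ⟨Obj.eval_injective _ fun i => (α i).injective,
      fun z => Obj.eval_surjective (w := w) _ (fun i => (α i).surjective) hα _ e z (Nat.lt_succ_self _)⟩
    fun x => Obj.weight_eval (fun i => α i) hα x

/-- The objects that are denoted by an expression, in terms of the objects of the classes. -/
def Obj.unfold {S : Spec} : {e : Expr S.Idx} → Obj S e → Interp (fun i => Obj S (.cls i)) e
  | _, .eps => Unit.unit
  | _, .atom _ => Unit.unit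
  | _, .cls i x => .cls i x
  | _, .inl x => Sum.inl x.unfold
  | _, .inr y => Sum.inr y.unfold
  | _, .pair x y => Prod.mk x.unfold y.unfold
  | _, .nil => List.nil
  | _, .cons x y => List.cons x.unfold y.unfold

/-- The objects of a specification form a solution of the system. -/
lemma Obj.wiso_interp {S : Spec} (e : Expr S.Idx) :
    WIso (Obj.weight : Obj S e → Weight)
      (Interp.weight (fun i => (Obj.weight : Obj S (.cls i) → Weight)) e) := by
  refine WIso.of_bijective Obj.unfold ⟨?_, ?_⟩ ?_
  · intro x y h
    induction x with
    | eps => cases y; rfl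
    | atom a => cases y; rfl
    | cls i x ih => cases y with
      | cls _ y => exact h
    | inl x ih =>
      cases y with
      | inl y => rw [ih (Sum.inl.inj h)]
      | inr y => exact absurd h Sum.inl_ne_inr
    | inr x ih =>
      cases y with
      | inl y => exact absurd h Sum.inr_ne_inl
      | inr y => rw [ih (Sum.inr.inj h)]
    | pair x y ihx ihy =>
      cases y with
      | pair x' y' => rw [ihx (Prod.mk.inj h).1, ihy (Prod.mk.inj h).2]
    | nil =>
      cases y with
      | nil => rfl
      | cons x y => exact absurd h (List.cons_ne_nil _ _).symm
    | cons x y ihx ihy =>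
      cases y with
      | nil => exact absurd h (List.cons_ne_nil _ _)
      | cons x' y' => rw [ihx (List.cons.inj h).1, ihy (List.cons.inj h).2]
  · intro z
    induction e with
    | zero => exact Empty.elim z
    | eps => exact ⟨.eps, rfl⟩
    | atom a => exact ⟨.atom a, rfl⟩
    | cls i => exact ⟨z, by cases z; rfl⟩
    | add e f ihe ihf =>
      rcases z with z | z
      · obtain ⟨x, rfl⟩ := ihe z; exact ⟨.inl x, rfl⟩
      · obtain ⟨x, rfl⟩ := ihf z; exact ⟨.inr x, rfl⟩
    | mul e f ihe ihf =>
      obtain ⟨z, z'⟩ := z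
      obtain ⟨x, rfl⟩ := ihe z
      obtain ⟨x', rfl⟩ := ihf z'
      exact ⟨.pair x x', rfl⟩
    | seq e ihe =>
      induction (z : List (Interp _ e)) with
      | nil => exact ⟨.nil, rfl⟩
      | cons z l ihl =>
        obtain ⟨x, rfl⟩ := ihe z
        obtain ⟨x', rfl⟩ := ihl
        exact ⟨.cons x x', rfl⟩
  · intro x
    induction x with
    | eps => rfl
    | atom a => rfl
    | cls i x ih => rfl
    | inl x ih => exact ih
    | inr x ih => exact ih
    | pair x y ihx ihy =>
      exact congrArg₂ (· * ·) ihx ihy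
    | nil => rfl
    | @cons e x y ihx ihy =>
      have : Interp.weight (fun i => (Obj.weight : Obj S (.cls i) → Weight)) (.seq e)
          (Obj.cons x y).unfold =
        Interp.weight _ e x.unfold * Interp.weight _ (.seq e) y.unfold := List.prod_cons
      rw [this, ihx, ihy]; rfl

/-- The equations of the system, for the objects of the specification. -/
lemma Obj.wiso_cls {S : Spec} (i : S.Idx) :
    WIso (fun x : Obj S (S.eqn i) => tick * x.weight) (Obj.weight : Obj S (.cls i) → Weight) :=
  WIso.of_bijective (Obj.cls i)
    ⟨fun x y h => by cases h; rfl, fun z => by cases z with | cls _ x => exact ⟨x, rfl⟩⟩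
    fun _ => rfl

/-! ### Presentations of weighted sets by specifications -/

/-- The three kinds of specifications in the statement. -/
inductive Kind : Type
  | general
  | contextFree
  | regular

/-- The expression may be used in a specification of the given kind. -/
def Expr.OfKind {ι : Type} : Kind → Expr ι → Prop
  | .general, _ => True
  | .contextFree, e => e.SeqFree
  | .regular, e => e.ClassFree

namespace Expr

variable {ι κ : Type}

@[simp] lemma ofKind_zero (k : Kind) : (zero : Expr ι).OfKind k := by cases k <;> trivial

@[simp] lemma ofKind_eps (k : Kind) : (eps : Expr ι).OfKind k := by cases k <;> trivial

@[simp] lemma ofKind_atom (k : Kind) (a : Atom) : (atom a : Expr ι).OfKind k := by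
  cases k <;> trivial

@[simp] lemma ofKind_add (k : Kind) (e f : Expr ι) :
    (add e f).OfKind k ↔ e.OfKind k ∧ f.OfKind k := by
  cases k <;> simp [OfKind, SeqFree, ClassFree]

@[simp] lemma ofKind_mul (k : Kind) (e f : Expr ι) :
    (mul e f).OfKind k ↔ e.OfKind k ∧ f.OfKind k := by
  cases k <;> simp [OfKind, SeqFree, ClassFree]

@[simp] lemma ofKind_seq (k : Kind) (e : Expr ι) :
    (seq e).OfKind k ↔ k ≠ .contextFree ∧ e.OfKind k := by
  cases k <;> simp [OfKind, SeqFree, ClassFree]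

@[simp] lemma ofKind_cls (k : Kind) (i : ι) : (cls i).OfKind k ↔ k ≠ .regular := by
  cases k <;> simp [OfKind, SeqFree, ClassFree]

end Expr

/-- The sequence construction is applied only to expressions without objects of size zero, when
the classes are interpreted as the weighted sets `X i`. -/
def Admissible {ι : Type} {X : ι → Type} (w : ∀ i, X i → Weight) : Expr ι → Prop
  | .add e f => Admissible w e ∧ Admissible w f
  | .mul e f => Admissible w e ∧ Admissible w f
  | .seq e => (∀ z : Interp X e, (Interp.weight w e z).1 ≠ 1) ∧ Admissible w e
  | _ => True

lemma Interp.length_le_of_admissible {ι : Type} {X : ι → Type} {w : ∀ i, X i → Weight}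
    {e : Expr ι} (h : Admissible w (.seq e)) (l : List (Interp X e)) :
    l.length ≤ (Interp.weight w (.seq e) l).1.length ∧
      ∀ z ∈ l, (Interp.weight w e z).1.length ≤ (Interp.weight w (.seq e) l).1.length := by
  induction l with
  | nil => simp
  | cons z l ih =>
    have h₁ : (Interp.weight w (.seq e) (List.cons z l)).1.length =
        (Interp.weight w e z).1.length + (Interp.weight w (.seq e) l).1.length := by
      refine Eq.trans ?_ (FreeMonoid.length_mul _ _)
      rfl
    have h₂ : (Interp.weight w e z).1.length ≠ 0 := by
      rw [Ne, FreeMonoid.length_eq_zero]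
      exact h.1 z
    refine ⟨by rw [List.length_cons]; omega, fun z' hz' => ?_⟩
    rcases List.mem_cons.1 hz' with rfl | hz'
    · omega
    · have := ih.2 z' hz'
      omega

/-- An admissible expression over combinatorial classes denotes a combinatorial class. -/
lemma Interp.finite {ι : Type} {X : ι → Type} {w : ∀ i, X i → Weight}
    (h : ∀ i n, {x : X i | (w i x).1.length = n}.Finite) {e : Expr ι} (he : Admissible w e)
    (n : ℕ) : {z | (Interp.weight w e z).1.length ≤ n}.Finite := by
  induction e with
  | zero => exact Set.finite_empty.subset fun z => Empty.elim z
  | eps => exact Set.toFinite (α := Unit) _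
  | atom a => exact Set.toFinite (α := Unit) _
  | cls i =>
    refine ((Set.finite_Iic n).biUnion fun j _ => h i j).subset fun x hx => ?_
    exact Set.mem_biUnion (Set.mem_Iic.2 hx) rfl
  | add e f ihe ihf =>
    refine (((ihe he.1).image Sum.inl).union ((ihf he.2).image Sum.inr)).subset ?_
    rintro (z | z) hz
    · exact .inl ⟨z, hz, rfl⟩
    · exact .inr ⟨z, hz, rfl⟩
  | mul e f ihe ihf =>
    refine ((ihe he.1).prod (ihf he.2)).subset ?_
    rintro ⟨z, z'⟩ hz
    have hz' : (Interp.weight w e z * Interp.weight w f z').1.length ≤ n := hz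
    rw [Prod.fst_mul, FreeMonoid.length_mul] at hz'
    exact ⟨le_trans (Nat.le_add_right _ _) hz', le_trans (Nat.le_add_left _ _) hz'⟩
  | seq e ih =>
    have : Finite {z // (Interp.weight w e z).1.length ≤ n} := (ih he.2).to_subtype
    refine ((List.finite_length_le {z // (Interp.weight w e z).1.length ≤ n} n).image
      (List.map Subtype.val)).subset fun (l : List (Interp X e)) hl => ?_
    have hl' : (Interp.weight w (.seq e) l).1.length ≤ n := hl
    obtain ⟨h₁, h₂⟩ := Interp.length_le_of_admissible he l
    refine ⟨l.attach.map fun z => ⟨z.1, (h₂ z.1 z.2).trans hl'⟩, ?_, ?_⟩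
    · simpa using h₁.trans hl'
    · simp [List.map_map, Function.comp_def]

lemma Obj.size_eq {S : Spec} {e : Expr S.Idx} (x : Obj S e) : x.size = x.weight.1.length := by
  rw [Obj.weight_fst]; rfl

lemma Obj.size_ne_zero {S : Spec} {e : Expr S.Idx} (x : Obj S e) :
    x.size ≠ 0 ↔ x.weight.1 ≠ 1 := by
  rw [Obj.size_eq, Ne, FreeMonoid.length_eq_zero]

lemma WIso.finite {X Y W : Type} {f : X → W} {g : Y → W} (h : WIso f g) {p : W → Prop}
    (hg : {y | p (g y)}.Finite) : {x | p (f x)}.Finite := by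
  obtain ⟨e, he⟩ := h
  refine (hg.preimage e.injective.injOn).subset fun x hx => ?_
  simpa [he] using hx

lemma WIso.forall_iff {X Y W : Type} {f : X → W} {g : Y → W} (h : WIso f g) {p : W → Prop} :
    (∀ x, p (f x)) ↔ ∀ y, p (g y) := by
  obtain ⟨e, he⟩ := h
  rw [← e.forall_congr_right]
  simp [he]

section Solution

variable {S : Spec} {X : S.Idx → Type} {w : ∀ i, X i → Weight}
  (h : ∀ i, WIso (fun z => tick * Interp.weight w (S.eqn i) z) (w i))

include h

lemma seqAdmissible_iff (e : Expr S.Idx) : SeqAdmissible S e ↔ Admissible w e := by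
  induction e with
  | zero => rfl
  | eps => rfl
  | atom a => rfl
  | cls i => rfl
  | add e f ihe ihf => exact and_congr ihe ihf
  | mul e f ihe ihf => exact and_congr ihe ihf
  | seq e ih =>
    refine and_congr ?_ ih
    simp only [Obj.size_ne_zero]
    exact (Obj.wiso_of_solution h e).forall_iff (p := fun x => x.1 ≠ 1)

/-- A system is well defined if its solution consists of combinatorial classes. -/
lemma wellDefined_of_solution (hfin : ∀ i n, {x : X i | (w i x).1.length = n}.Finite)
    (hadm : ∀ i, Admissible w (S.eqn i)) : S.WellDefined where
  finite_size i n := by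
    simp only [Obj.size_eq]
    exact (Obj.wiso_of_solution h (.cls i)).finite (p := fun x => x.1.length = n) (hfin i n)
  seq_admissible i := (seqAdmissible_iff h _).2 (hadm i)

end Solution

/-- The objects of the classes of `S`, as a solution of `S`. -/
lemma Obj.solution (S : Spec) (i : S.Idx) :
    WIso (fun z => tick * Interp.weight (fun i => (Obj.weight : Obj S (.cls i) → Weight))
      (S.eqn i) z) (Obj.weight : Obj S (.cls i) → Weight) :=
  ((Obj.wiso_interp (S.eqn i)).symm.comp (tick * ·)).trans (Obj.wiso_cls i)

/-- The objects of some specification of kind `k` correspond to the elements of `X`, with words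
of atoms given by `f`. -/
def Presented (k : Kind) {X : Type} (f : X → List Atom) : Prop :=
  ∃ S : Spec, (∀ i, (S.eqn i).OfKind k) ∧ S.WellDefined ∧
    WIso (Obj.word : Obj S (.cls S.start) → List Atom) f

lemma Presented.congr {k : Kind} {X Y : Type} {f : X → List Atom} {g : Y → List Atom}
    (hf : Presented k f) (h : WIso f g) : Presented k g := by
  obtain ⟨S, hk, hw, hS⟩ := hf
  exact ⟨S, hk, hw, hS.trans h⟩

/-! ### Adding a start class -/

/-- Rename the classes of an expression. -/
def Expr.map {ι κ : Type} (f : ι → κ) : Expr ι → Expr κ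
  | .zero => .zero
  | .eps => .eps
  | .atom a => .atom a
  | .cls i => .cls (f i)
  | .add e e' => .add (e.map f) (e'.map f)
  | .mul e e' => .mul (e.map f) (e'.map f)
  | .seq e => .seq (e.map f)

lemma Expr.OfKind.map {ι κ : Type} (f : ι → κ) {k : Kind} {e : Expr ι} (h : e.OfKind k) :
    (e.map f).OfKind k := by
  induction e <;> simp_all [Expr.map]

lemma Interp.wiso_map {ι κ : Type} {X : κ → Type} (w : ∀ i, X i → Weight) (f : ι → κ) :
    ∀ e : Expr ι, WIso (Interp.weight w (e.map f)) (Interp.weight (fun i => w (f i)) e)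
  | .zero => WIso.refl (W := Weight) (X := Empty) (fun z => z.elim)
  | .eps => WIso.refl (W := Weight) (X := Unit) (fun _ => 1)
  | .atom a => WIso.refl (W := Weight) (X := Unit) (fun _ => atomWeight a)
  | .cls i => WIso.refl (w (f i))
  | .add e e' => (Interp.wiso_map w f e).sum (Interp.wiso_map w f e')
  | .mul e e' => (Interp.wiso_map w f e).prod (Interp.wiso_map w f e')
  | .seq e => (Interp.wiso_map w f e).list

lemma Admissible.map {ι κ : Type} {X : κ → Type} (w : ∀ i, X i → Weight) (f : ι → κ)
    {e : Expr ι} (h : Admissible (fun i => w (f i)) e) : Admissible w (e.map f) := by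
  induction e with
  | zero => trivial
  | eps => trivial
  | atom a => trivial
  | cls i => trivial
  | add e f ihe ihf => exact ⟨ihe h.1, ihf h.2⟩
  | mul e f ihe ihf => exact ⟨ihe h.1, ihf h.2⟩
  | seq e ih =>
    exact ⟨((Interp.wiso_map w f e).forall_iff (p := fun x => x.1 ≠ 1)).2 h.1, ih h.2⟩

/-- The specification `S` with an additional start class, defined by the expression `e`. -/
def Spec.withStart (S : Spec) (e : Expr S.Idx) : Spec where
  Idx := Option S.Idx
  finite_idx := by
    have := S.finite_idx
    infer_instance
  eqn
    | none => e.map some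
    | some i => (S.eqn i).map some
  start := none

/-- An expression over a solution of a specification of kind `k` is itself presented by a
specification of kind `k`. -/
theorem Presented.of_expr {k : Kind} {S : Spec} (hk : ∀ i, (S.eqn i).OfKind k)
    {X : S.Idx → Type} {w : ∀ i, X i → Weight}
    (h : ∀ i, WIso (fun z => tick * Interp.weight w (S.eqn i) z) (w i))
    (hfin : ∀ i n, {x : X i | (w i x).1.length = n}.Finite)
    (hadm : ∀ i, Admissible w (S.eqn i)) {e : Expr S.Idx} (hek : e.OfKind k)
    (headm : Admissible w e) :
    Presented k (fun z => (Interp.weight w e z).1.toList) := by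
  let X' : (S.withStart e).Idx → Type := fun o => match o with
    | none => Interp X e
    | some i => X i
  let w' : ∀ o, X' o → Weight := fun o => match o with
    | none => fun z => tick * Interp.weight w e z
    | some i => w i
  have hsol : ∀ o, WIso (fun z => tick * Interp.weight w' ((S.withStart e).eqn o) z) (w' o) := by
    rintro (_ | i)
    · exact (Interp.wiso_map w' some e).comp (tick * ·)
    · exact ((Interp.wiso_map w' some (S.eqn i)).comp (tick * ·)).trans (h i)
  refine ⟨S.withStart e, ?_, ?_, ?_⟩
  · rintro (_ | i)
    · exact hek.map some
    · exact (hk i).map some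
  · refine wellDefined_of_solution hsol ?_ ?_
    · rintro (_ | i) n
      · refine (Interp.finite hfin headm n).subset fun z hz => ?_
        have hz' : (tick * Interp.weight w e z).1.length = n := hz
        simpa [tick] using hz'.le
      · exact hfin i n
    · rintro (_ | i)
      · exact Admissible.map w' some headm
      · exact Admissible.map w' some (hadm i)
  · have := (Obj.wiso_of_solution hsol (.cls none)).comp (fun x => x.1.toList)
    simp only [Obj.weight_fst] at this
    exact this.trans (WIso.of_eq fun z => by simp [Interp.weight, w', tick])

/-! ### Renaming the atoms and reversing the words -/

/-- Rename the atoms by `s` and, if `r` is true, reverse all products. -/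
def Expr.transform {ι : Type} (s : Atom → Atom) (r : Bool) : Expr ι → Expr ι
  | .zero => .zero
  | .eps => .eps
  | .atom a => .atom (s a)
  | .cls i => .cls i
  | .add e f => .add (e.transform s r) (f.transform s r)
  | .mul e f => if r then .mul (f.transform s r) (e.transform s r)
      else .mul (e.transform s r) (f.transform s r)
  | .seq e => .seq (e.transform s r)

/-- The effect of `Expr.transform` on words. -/
def transformWord (s : Atom → Atom) (r : Bool) (l : List Atom) : List Atom :=
  if r then (l.map s).reverse else l.map s

/-- The effect of `Expr.transform` on weights. -/
def transformWeight (s : Atom → Atom) (r : Bool) (x : Weight) : Weight :=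
  (FreeMonoid.ofList (transformWord s r x.1.toList), x.2)

section Transform

variable (s : Atom → Atom) (r : Bool)

lemma Expr.OfKind.transform {ι : Type} {k : Kind} {e : Expr ι} (h : e.OfKind k) :
    (e.transform s r).OfKind k := by
  cases r <;> induction e <;> simp_all [Expr.transform]

lemma transformWeight_one : transformWeight s r 1 = 1 := by
  cases r <;> rfl

lemma transformWeight_atomWeight (a : Atom) :
    transformWeight s r (atomWeight a) = atomWeight (s a) := by
  cases r <;> rfl

lemma transformWeight_tick_mul (x : Weight) :
    transformWeight s r (tick * x) = tick * transformWeight s r x := by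
  simp [transformWeight, tick]

lemma transformWeight_false_mul (x y : Weight) :
    transformWeight s false (x * y) = transformWeight s false x * transformWeight s false y := by
  simp [transformWeight, transformWord, FreeMonoid.ofList_append, FreeMonoid.toList_mul]

lemma transformWeight_true_mul (x y : Weight) :
    transformWeight s true (x * y) = transformWeight s true y * transformWeight s true x := by
  simp [transformWeight, transformWord, FreeMonoid.ofList_append, FreeMonoid.toList_mul, mul_comm]

lemma transformWeight_length (x : Weight) : (transformWeight s r x).1.length = x.1.length := by
  cases r <;> simp [transformWeight, transformWord, FreeMonoid.length]

lemma transformWeight_prod {X : Type} (f : X → Weight) :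
    WIso (fun l : List X => (l.map fun x => transformWeight s r (f x)).prod)
      (fun l : List X => transformWeight s r (l.map f).prod) := by
  cases r with
  | false =>
    refine WIso.of_eq fun l => ?_
    induction l with
    | nil => simp [transformWeight_one]
    | cons x l ih => simp [transformWeight_false_mul, ih]
  | true =>
    refine ⟨⟨List.reverse, List.reverse, List.reverse_reverse, List.reverse_reverse⟩, fun l => ?_⟩
    induction l with
    | nil => simp [transformWeight_one]
    | cons x l ih =>
      simp only [Equiv.coe_fn_mk, List.map_reverse] at ih
      simp [transformWeight_true_mul, ih]

lemma Interp.wiso_transform {ι : Type} {X : ι → Type} (w : ∀ i, X i → Weight) :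
    ∀ e : Expr ι, WIso (Interp.weight (fun i x => transformWeight s r (w i x)) (e.transform s r))
      (fun z => transformWeight s r (Interp.weight w e z))
  | .zero => ⟨Equiv.refl Empty, fun z => Empty.elim z⟩
  | .eps => ⟨Equiv.refl Unit, fun _ => transformWeight_one s r⟩
  | .atom a => ⟨Equiv.refl Unit, fun _ => transformWeight_atomWeight s r a⟩
  | .cls i => WIso.refl _
  | .add e f => ((Interp.wiso_transform w e).sum (Interp.wiso_transform w f)).trans
      (WIso.of_eq (by rintro (z | z) <;> rfl))
  | .mul e f => by
    have he := Interp.wiso_transform w e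
    have hf := Interp.wiso_transform w f
    cases r with
    | false =>
      exact (he.prod hf).trans (WIso.of_eq fun p => (transformWeight_false_mul s _ _).symm)
    | true =>
      refine (hf.prod he).trans ⟨Equiv.prodComm _ _, fun p => ?_⟩
      exact transformWeight_true_mul s _ _
  | .seq e => (Interp.wiso_transform w e).list.trans (transformWeight_prod s r _)

lemma Admissible.transform {ι : Type} {X : ι → Type} (w : ∀ i, X i → Weight) {e : Expr ι}
    (h : Admissible w e) :
    Admissible (fun i x => transformWeight s r (w i x)) (e.transform s r) := by
  induction e with
  | zero => trivial
  | eps => trivial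
  | atom a => trivial
  | cls i => trivial
  | add e f ihe ihf => exact ⟨ihe h.1, ihf h.2⟩
  | mul e f ihe ihf =>
    cases r with
    | false => exact ⟨ihe h.1, ihf h.2⟩
    | true => exact ⟨ihf h.2, ihe h.1⟩
  | seq e ih =>
    refine ⟨((Interp.wiso_transform s r w e).forall_iff (p := fun x => x.1 ≠ 1)).2 fun z => ?_,
      ih h.2⟩
    rw [Ne, ← FreeMonoid.length_eq_zero, transformWeight_length, FreeMonoid.length_eq_zero]
    exact h.1 z

end Transform

/-- The well-defined specification `S` gives a solution of combinatorial classes. -/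
lemma Spec.WellDefined.finite {S : Spec} (h : S.WellDefined) (i : S.Idx) (n : ℕ) :
    {x : Obj S (.cls i) | x.weight.1.length = n}.Finite := by
  simpa only [Obj.size_eq] using h.finite_size i n

lemma Spec.WellDefined.admissible {S : Spec} (h : S.WellDefined) (i : S.Idx) :
    Admissible (fun i => (Obj.weight : Obj S (.cls i) → Weight)) (S.eqn i) :=
  (seqAdmissible_iff (Obj.solution S) _).1 (h.seq_admissible i)

theorem Presented.transform (s : Atom → Atom) (r : Bool) {k : Kind} {X : Type}
    {f : X → List Atom} (h : Presented k f) :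
    Presented k (fun x => transformWord s r (f x)) := by
  obtain ⟨S, hk, hw, hS⟩ := h
  let T : Spec := ⟨S.Idx, S.finite_idx, fun i => (S.eqn i).transform s r, S.start⟩
  let w : ∀ i, Obj S (.cls i) → Weight := fun i x => transformWeight s r x.weight
  have hsol : ∀ i, WIso (fun z => tick * Interp.weight w (T.eqn i) z) (w i) := fun i => by
    refine ((Interp.wiso_transform s r _ (S.eqn i)).comp (tick * ·)).trans ?_
    simp only [← transformWeight_tick_mul]
    exact (Obj.solution S i).comp (transformWeight s r)
  refine ⟨T, fun i => (hk i).transform s r, wellDefined_of_solution hsol ?_ ?_, ?_⟩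
  · intro i n
    simp only [w, transformWeight_length]
    exact hw.finite i n
  · exact fun i => (hw.admissible i).transform s r
  · have := (Obj.wiso_of_solution hsol (.cls S.start)).comp (fun x => x.1.toList)
    simp only [Obj.weight_fst] at this
    refine this.trans ((WIso.of_eq fun x => ?_).trans (hS.comp (transformWord s r)))
    simp [Interp.weight, w, transformWeight, Obj.weight_fst]

/-! ### Finite sums of expressions -/

/-- The sum of finitely many expressions. -/
def Expr.sumFin {ι : Type} : (m : ℕ) → (Fin m → Expr ι) → Expr ι
  | 0, _ => .zero
  | m + 1, f => .add (f 0) (Expr.sumFin m fun i => f i.succ)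

/-- The expression `e` if `p` holds, and the empty sum otherwise. -/
def Expr.guard {ι : Type} (p : Prop) [Decidable p] (e : Expr ι) : Expr ι := if p then e else .zero

section

variable {ι : Type} {X : ι → Type} (w : ∀ i, X i → Weight)

lemma Expr.OfKind.sumFin {k : Kind} {m : ℕ} {f : Fin m → Expr ι} (h : ∀ i, (f i).OfKind k) :
    (Expr.sumFin m f).OfKind k := by
  induction m with
  | zero => simp [Expr.sumFin]
  | succ m ih => simp [Expr.sumFin, h, ih]

lemma Expr.OfKind.guard {k : Kind} {p : Prop} [Decidable p] {e : Expr ι} (h : e.OfKind k) :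
    (Expr.guard p e).OfKind k := by
  unfold Expr.guard; split_ifs <;> simp [h]

lemma Admissible.sumFin {m : ℕ} {f : Fin m → Expr ι} (h : ∀ i, Admissible w (f i)) :
    Admissible w (Expr.sumFin m f) := by
  induction m with
  | zero => trivial
  | succ m ih => exact ⟨h 0, ih fun i => h i.succ⟩

lemma Admissible.guard {p : Prop} [Decidable p] {e : Expr ι} (h : p → Admissible w e) :
    Admissible w (Expr.guard p e) := by
  unfold Expr.guard; split_ifs with hp
  · exact h hp
  · trivial

lemma Interp.wiso_sumFin {m : ℕ} (f : Fin m → Expr ι) :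
    WIso (Interp.weight w (Expr.sumFin m f))
      (fun p : Σ i, Interp X (f i) => Interp.weight w (f p.1) p.2) := by
  induction m with
  | zero =>
    have : IsEmpty (Interp X (Expr.sumFin 0 f)) := inferInstanceAs (IsEmpty Empty)
    exact WIso.of_isEmpty _ _
  | succ m ih =>
    refine ((WIso.refl (Interp.weight w (f 0))).sum (ih fun i => f i.succ)).trans ?_
    refine WIso.of_bijective (Sum.elim (fun z => ⟨0, z⟩) (fun p => ⟨p.1.succ, p.2⟩)) ⟨?_, ?_⟩ ?_
    · rintro (z | ⟨i, z⟩) (z' | ⟨i', z'⟩) h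
      · simp only [Sum.elim_inl, Sigma.mk.injEq, heq_eq_eq, true_and] at h; rw [h]
      · exact absurd (congrArg Sigma.fst h) (Fin.succ_ne_zero i').symm
      · exact absurd (congrArg Sigma.fst h) (Fin.succ_ne_zero i)
      · have hi := Fin.succ_injective _ (congrArg Sigma.fst h)
        subst hi
        simp only [Sum.elim_inr, Sigma.mk.injEq, heq_eq_eq, true_and] at h; rw [h]
    · rintro ⟨i, z⟩
      cases i using Fin.cases with
      | zero => exact ⟨Sum.inl z, rfl⟩
      | succ i => exact ⟨Sum.inr ⟨i, z⟩, rfl⟩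
    · rintro (z | ⟨i, z⟩) <;> rfl

lemma Interp.wiso_guard {p : Prop} [Decidable p] (e : Expr ι) :
    WIso (Interp.weight w (Expr.guard p e))
      (fun z : PLift p × Interp X e => Interp.weight w e z.2) := by
  by_cases hp : p
  · rw [Expr.guard, if_pos hp]
    refine WIso.of_bijective (fun z => (⟨hp⟩, z)) ⟨fun x y h => (Prod.mk.inj h).2, ?_⟩ fun _ => rfl
    rintro ⟨⟨_⟩, z⟩
    exact ⟨z, rfl⟩
  · rw [Expr.guard, if_neg hp]
    have : IsEmpty (Interp X (.zero : Expr ι)) := inferInstanceAs (IsEmpty Empty)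
    have : IsEmpty (PLift p × Interp X e) := ⟨fun z => hp z.1.down⟩
    exact WIso.of_isEmpty _ _

end

/-! ### Runs of a transducer -/

/-- The runs from state `q` to state `q'` of the transducer with states `Fin m` that may go from
`q` to `q₁` when reading the atom `a`, producing an output in `out q a q₁`. The outputs are
weights, since an output may be described by auxiliary classes of a specification. -/
def Run {m : ℕ} (out : Fin m → Atom → Fin m → Set Weight) :
    Fin m → List Atom → Fin m → Type
  | q, [], q' => PLift (q = q')
  | q, a :: l, q' => Σ q₁, out q a q₁ × Run out q₁ l q'

namespace Run

variable {m : ℕ} {out : Fin m → Atom → Fin m → Set Weight}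

/-- The total output of a run. -/
def weight : ∀ {q : Fin m} {l : List Atom} {q' : Fin m}, Run out q l q' → Weight
  | _, [], _, _ => 1
  | _, _ :: _, _, ρ => ρ.2.1.1 * ρ.2.2.weight

/-- A run on a concatenation is a pair of runs. -/
lemma wiso_append (l l' : List Atom) (q q' : Fin m) :
    WIso (fun ρ : Run out q (l ++ l') q' => ρ.weight)
      (fun p : Σ q₁, Run out q l q₁ × Run out q₁ l' q' => p.2.1.weight * p.2.2.weight) := by
  induction l generalizing q with
  | nil =>
    refine WIso.of_bijective (fun ρ => ⟨q, ⟨rfl⟩, ρ⟩) ⟨?_, ?_⟩ fun _ => one_mul _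
    · intro ρ ρ' h
      exact (Prod.mk.inj (eq_of_heq (Sigma.mk.inj h).2)).2
    · rintro ⟨q₁, ⟨rfl⟩, ρ⟩
      exact ⟨ρ, rfl⟩
  | cons a l ih =>
    have h₁ : WIso (fun ρ : Run out q (a :: (l ++ l')) q' => ρ.weight)
        (fun p : Σ q₁, out q a q₁ × (Σ q₂, Run out q₁ l q₂ × Run out q₂ l' q') =>
          (p.2.1 : Weight) * (p.2.2.2.1.weight * p.2.2.2.2.weight)) :=
      WIso.sigma (f := fun q₁ (p : out q a q₁ × Run out q₁ (l ++ l') q') =>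
          (p.1 : Weight) * p.2.weight)
        (g := fun q₁ (p : out q a q₁ × (Σ q₂, Run out q₁ l q₂ × Run out q₂ l' q')) =>
          (p.1 : Weight) * (p.2.2.1.weight * p.2.2.2.weight))
        fun q₁ => (WIso.refl (Subtype.val : out q a q₁ → Weight)).prod (ih q₁)
    refine h₁.trans ⟨⟨fun p => ⟨p.2.2.1, ⟨p.1, p.2.1, p.2.2.2.1⟩, p.2.2.2.2⟩,
      fun p => ⟨p.2.1.1, p.2.1.2.1, p.1, p.2.1.2.2, p.2.2⟩, fun _ => rfl, fun _ => rfl⟩,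
      fun p => ?_⟩
    exact mul_assoc _ _ _

lemma length_le (hne : ∀ q a q', ∀ o ∈ out q a q', o.1 ≠ 1) {q : Fin m} {l : List Atom}
    {q' : Fin m} (ρ : Run out q l q') : l.length ≤ ρ.weight.1.length := by
  induction l generalizing q with
  | nil => simp
  | cons a l ih =>
    obtain ⟨q₁, o, ρ⟩ := ρ
    have h₁ : o.1.1.length ≠ 0 := by
      rw [Ne, FreeMonoid.length_eq_zero]
      exact hne _ _ _ o.1 o.2
    have h₂ := ih ρ
    change _ ≤ (o.1 * ρ.weight).1.length
    simp only [List.length_cons, Prod.fst_mul, FreeMonoid.length_mul]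
    omega

lemma le (hmono : ∀ q a q', (out q a q').Nonempty → q ≤ q') {q : Fin m} {l : List Atom}
    {q' : Fin m} (ρ : Run out q l q') : q ≤ q' := by
  induction l generalizing q with
  | nil => exact ρ.down.le
  | cons a l ih =>
    obtain ⟨q₁, o, ρ⟩ := ρ
    exact (hmono _ _ _ ⟨_, o.2⟩).trans (ih ρ)

lemma finite_length_le
    (hfin : ∀ q a q' n, {o : out q a q' | o.1.1.length ≤ n}.Finite)
    (q : Fin m) (l : List Atom) (q' : Fin m) (n : ℕ) :
    {ρ : Run out q l q' | ρ.weight.1.length ≤ n}.Finite := by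
  induction l generalizing q with
  | nil =>
    have : Subsingleton (Run out q [] q') := inferInstanceAs (Subsingleton (PLift _))
    exact Set.toFinite _
  | cons a l ih =>
    have h : (⋃ q₁ : Fin m, (fun p : out q a q₁ × Run out q₁ l q' =>
        (⟨q₁, p⟩ : Run out q (a :: l) q')) ''
        ({o | o.1.1.length ≤ n} ×ˢ {ρ | ρ.weight.1.length ≤ n})).Finite :=
      Set.finite_iUnion fun q₁ => Set.Finite.image _ (Set.Finite.prod (hfin _ _ _ _) (ih q₁))
    refine h.subset ?_
    rintro ⟨q₁, o, ρ⟩ hρ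
    have hρ' : (o.1 * ρ.weight).1.length ≤ n := hρ
    rw [Prod.fst_mul, FreeMonoid.length_mul] at hρ'
    exact Set.mem_iUnion.2 ⟨q₁, (o, ρ), ⟨by simp; omega, by simp; omega⟩, rfl⟩

end Run

/-! ### Sequences of transitions without cycles other than loops -/

/-- The paths from `q` to `q'` in the graph with arrows `V q q'`. -/
inductive Chain {Q : Type} (V : Q → Q → Type) : Q → Q → Type
  | nil (q : Q) : Chain V q q
  | cons {p q r : Q} (v : V p q) (c : Chain V q r) : Chain V p r

/-- The product of the weights along a path. -/
def Chain.weight {Q : Type} {V : Q → Q → Type} (w : ∀ {p q}, V p q → Weight) :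
    {p q : Q} → Chain V p q → Weight
  | _, _, .nil _ => 1
  | _, _, .cons v c => w v * c.weight w

section Star

variable {m : ℕ} {V : Fin m → Fin m → Type} (w : ∀ {p q}, V p q → Weight)

/-- A path that is trivial or that starts with an arrow to a larger vertex. -/
def Chain.ofRest (q q' : Fin m) :
    (PLift (q = q') ⊕ Σ q₁, PLift (q < q₁) × (V q q₁ × Chain V q₁ q')) → Chain V q q'
  | .inl h => h.down ▸ .nil q
  | .inr p => .cons p.2.2.1 p.2.2.2

/-- A path that starts with some loops. -/
def Chain.ofLoops {Q : Type} {V : Q → Q → Type} {q q' : Q} (l : List (V q q)) (c : Chain V q q') :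
    Chain V q q' := l.foldr (fun v c => .cons v c) c

lemma Chain.ofRest_ne_cons {q q' : Fin m} (v : V q q) (c : Chain V q q') (r) :
    Chain.ofRest q q' r ≠ .cons v c := by
  rcases r with h | ⟨q₁, ⟨h⟩, v', c'⟩ <;> intro hc
  · obtain rfl := h.down
    cases hc
  · obtain ⟨h₁, _⟩ := Chain.cons.inj hc
    exact h.ne' h₁

/-- A path consists of loops at its first vertex, followed by nothing or by an arrow to a larger
vertex and a path from there. -/
lemma Chain.wiso_loops (hV : ∀ p q, V p q → p ≤ q) (q q' : Fin m) :
    WIso (fun x : List (V q q) × (PLift (q = q') ⊕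
          Σ q₁, PLift (q < q₁) × (V q q₁ × Chain V q₁ q')) =>
        (x.1.map w).prod * Sum.elim (fun _ => (1 : Weight))
          (fun p => w p.2.2.1 * p.2.2.2.weight w) x.2)
      (fun c : Chain V q q' => c.weight w) := by
  refine WIso.of_bijective (fun x => Chain.ofLoops x.1 (Chain.ofRest q q' x.2)) ⟨?_, ?_⟩ ?_
  · rintro ⟨l, r⟩ ⟨l', r'⟩ h
    induction l generalizing l' with
    | nil =>
      cases l' with
      | cons v l' => exact absurd h (Chain.ofRest_ne_cons _ _ _)
      | nil =>
        have h' : Chain.ofRest q q' r = Chain.ofRest q q' r' := h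
        rcases r with h₁ | ⟨q₁, ⟨hq⟩, v, c⟩ <;> rcases r' with h₂ | ⟨q₁', ⟨hq'⟩, v', c'⟩
        · cases h₁; cases h₂; rfl
        · obtain rfl := h₁.down
          cases h'
        · obtain rfl := h₂.down
          cases h'
        · cases h'
          rfl
    | cons v l ih =>
      cases l' with
      | nil => exact absurd h.symm (Chain.ofRest_ne_cons _ _ _)
      | cons v' l' =>
        obtain ⟨_, h₁, h₂⟩ := Chain.cons.inj h
        obtain rfl := eq_of_heq h₁
        obtain ⟨rfl, rfl⟩ := Prod.mk.inj (ih l' (eq_of_heq h₂))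
        rfl
  · intro c
    induction c with
    | nil p => exact ⟨([], .inl ⟨rfl⟩), rfl⟩
    | @cons p p₁ r v c ih =>
      by_cases hp : p₁ = p
      · subst hp
        obtain ⟨x, hx⟩ := ih
        exact ⟨(v :: x.1, x.2), congrArg (Chain.cons v) hx⟩
      · exact ⟨([], .inr ⟨p₁, ⟨lt_of_le_of_ne (hV _ _ v) (Ne.symm hp)⟩, v, c⟩), rfl⟩
  · rintro ⟨l, r⟩
    induction l with
    | nil =>
      rcases r with h | ⟨q₁, ⟨h⟩, v, c⟩
      · obtain rfl := h.down
        exact (one_mul (1 : Weight)).symm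
      · exact (one_mul _).symm
    | cons v l ih =>
      rw [List.map_cons, List.prod_cons, mul_assoc]
      exact congrArg (w v * ·) ih

variable {ι : Type} {X : ι → Type} (u : ∀ i, X i → Weight)

/-- The expression for the paths in the graph whose arrows from `q` to `q'` are denoted by
`M q q'`. All arrows other than loops lead to larger vertices; `n` bounds the number of these. -/
def Expr.star (M : Fin m → Fin m → Expr ι) : ℕ → Fin m → Fin m → Expr ι
  | 0, _, _ => .zero
  | n + 1, q, q' => .mul (.seq (M q q)) (.add (.guard (q = q') .eps)
      (.sumFin m fun q₁ => .guard (q < q₁) (.mul (M q q₁) (Expr.star M n q₁ q'))))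

lemma Interp.wiso_star (hV : ∀ p q, V p q → p ≤ q) (M : Fin m → Fin m → Expr ι)
    (hM : ∀ q q', WIso (Interp.weight u (M q q')) (w : V q q' → Weight)) :
    ∀ n (q q' : Fin m), m ≤ n + q → WIso (Interp.weight u (Expr.star M n q q'))
      (fun c : Chain V q q' => c.weight w)
  | 0, q, q', h => absurd q.2 (by omega)
  | n + 1, q, q', h => by
    refine WIso.trans ?_ (Chain.wiso_loops w hV q q')
    refine (hM q q).list.prod (((Interp.wiso_guard u .eps).trans ?_).sum
      ((Interp.wiso_sumFin u _).trans (WIso.sigma fun q₁ => (Interp.wiso_guard u _).trans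
        (?_ : WIso _ (fun p : PLift (q < q₁) × (V q q₁ × Chain V q₁ q') =>
          w p.2.1 * p.2.2.weight w)))))
    · exact ⟨⟨fun p => p.1, fun h => (h, Unit.unit), fun _ => rfl, fun _ => rfl⟩, fun _ => rfl⟩
    · by_cases hq : q < q₁
      · obtain ⟨e, he⟩ := (hM q q₁).prod (Interp.wiso_star hV M hM n q₁ q' (by
          have : (q : ℕ) < q₁ := hq
          omega))
        exact ⟨(Equiv.refl _).prodCongr e, fun p => he p.2⟩
      · have h₁ : IsEmpty (PLift (q < q₁)) := ⟨fun h => hq h.down⟩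
        exact ⟨Equiv.equivOfIsEmpty _ _, fun p => (h₁.false p.1).elim⟩

lemma Expr.OfKind.star {k : Kind} (hk : k ≠ .contextFree) {M : Fin m → Fin m → Expr ι}
    (h : ∀ q q', (M q q').OfKind k) : ∀ n q q', (Expr.star M n q q').OfKind k
  | 0, _, _ => by simp [Expr.star]
  | n + 1, q, q' => by
    simp only [Expr.star, Expr.ofKind_mul, Expr.ofKind_seq, Expr.ofKind_add]
    refine ⟨⟨hk, h q q⟩, OfKind.guard (by simp), OfKind.sumFin fun q₁ => OfKind.guard ?_⟩
    simp only [Expr.ofKind_mul]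
    exact ⟨h _ _, Expr.OfKind.star hk h n _ _⟩

lemma Admissible.star {M : Fin m → Fin m → Expr ι} (h : ∀ q q', Admissible u (M q q'))
    (hne : ∀ q (z : Interp X (M q q)), (Interp.weight u _ z).1 ≠ 1) :
    ∀ n q q', Admissible u (Expr.star M n q q')
  | 0, _, _ => trivial
  | n + 1, q, _ => ⟨⟨hne q, h q q⟩, Admissible.guard u fun _ => trivial,
      Admissible.sumFin u fun _ => Admissible.guard u fun _ =>
        ⟨h _ _, Admissible.star h hne n _ _⟩⟩

end Star

/-! ### Transducing the objects of a specification -/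

section Transduce

variable {m : ℕ} (out : Fin m → Atom → Fin m → Set Weight) {ι : Type} {Y : ι → Type}
  (w : ∀ i, Y i → Weight)

/-- The output of a run on the word of an object; the ticks of the object are retained. -/
def runWeight {q q' : Fin m} (x : Weight) (ρ : Run out q x.1.toList q') : Weight :=
  (1, x.2) * ρ.weight

lemma Run.wiso_mul (x y : Weight) (q q' : Fin m) :
    WIso (fun ρ : Run out q (x * y).1.toList q' => runWeight out (x * y) ρ)
      (fun p : Σ q₁, Run out q x.1.toList q₁ × Run out q₁ y.1.toList q' =>
        runWeight out x p.2.1 * runWeight out y p.2.2) := by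
  refine ((Run.wiso_append (out := out) x.1.toList y.1.toList q q').comp
    ((1, (x * y).2) * ·)).trans (WIso.of_eq fun p => ?_)
  simp only [runWeight]
  ext
  · simp
  · simp [mul_mul_mul_comm]

/-- The objects denoted by `e`, with a run on their words. -/
abbrev Transduced (e : Expr ι) (q q' : Fin m) : Type :=
  Σ z : Interp Y e, Run out q (Interp.weight w e z).1.toList q'

/-- The weight of an object with a run: the output of the run. -/
def Transduced.weight (e : Expr ι) (q q' : Fin m) (p : Transduced out w e q q') : Weight :=
  runWeight out _ p.2

/-- An auxiliary class with weighted set `B`, and for each class of the given system and each pair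
of states the objects with a run between these states. -/
def TransducedClass (B : Type) : Option (Fin m × ι × Fin m) → Type
  | none => B
  | some t => Transduced out w (.cls t.2.1) t.1 t.2.2

/-- The weights on `TransducedClass`. -/
def TransducedClass.weight {B : Type} (b : B → Weight) :
    ∀ o, TransducedClass out w B o → Weight
  | none => b
  | some t => Transduced.weight out w (.cls t.2.1) t.1 t.2.2

/-- The expression for the objects denoted by `e` with a run from `q` to `q'`, where `W` has the
expressions for the outputs of the transducer. -/
def Expr.transduce (W : Fin m → Atom → Fin m → Expr (Option (Fin m × ι × Fin m))) :
    Expr ι → Fin m → Fin m → Expr (Option (Fin m × ι × Fin m))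
  | .zero, _, _ => .zero
  | .eps, q, q' => .guard (q = q') .eps
  | .atom a, q, q' => W q a q'
  | .cls i, q, q' => .cls (some (q, i, q'))
  | .add e f, q, q' => .add (e.transduce W q q') (f.transduce W q q')
  | .mul e f, q, q' => .sumFin m fun q₁ => .mul (e.transduce W q q₁) (f.transduce W q₁ q')
  | .seq e, q, q' => Expr.star (e.transduce W) m q q'

variable {out w}

/-- A run on a pair of objects is a pair of runs; the bijection preserves the pair of objects. -/
lemma Transduced.wiso_pair (e f : Expr ι) (q q' : Fin m) :
    WIso (fun p : Σ q₁, Transduced out w e q q₁ × Transduced out w f q₁ q' =>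
        ((Transduced.weight out w e q p.1 p.2.1 * Transduced.weight out w f p.1 q' p.2.2,
          (p.2.1.1, p.2.2.1)) : Weight × (Interp Y e × Interp Y f)))
      (fun p : Transduced out w (.mul e f) q q' =>
        (Transduced.weight out w (.mul e f) q q' p, (p.1 : Interp Y e × Interp Y f))) := by
  have h₁ : WIso (fun p : Σ q₁, Transduced out w e q q₁ × Transduced out w f q₁ q' =>
        ((Transduced.weight out w e q p.1 p.2.1 * Transduced.weight out w f p.1 q' p.2.2,
          (p.2.1.1, p.2.2.1)) : Weight × (Interp Y e × Interp Y f)))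
      (fun p : Σ z : Interp Y e × Interp Y f, Σ q₁,
          Run out q (Interp.weight w e z.1).1.toList q₁ ×
            Run out q₁ (Interp.weight w f z.2).1.toList q' =>
        (runWeight out (Interp.weight w e p.1.1) p.2.2.1 *
          runWeight out (Interp.weight w f p.1.2) p.2.2.2, p.1)) :=
    ⟨⟨fun p => ⟨(p.2.1.1, p.2.2.1), p.1, p.2.1.2, p.2.2.2⟩,
      fun p => ⟨p.2.1, ⟨p.1.1, p.2.2.1⟩, ⟨p.1.2, p.2.2.2⟩⟩, fun _ => rfl, fun _ => rfl⟩,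
      fun _ => rfl⟩
  have h₂ : ∀ z : Interp Y e × Interp Y f,
      WIso (fun p : Σ q₁, Run out q (Interp.weight w e z.1).1.toList q₁ ×
          Run out q₁ (Interp.weight w f z.2).1.toList q' =>
        (runWeight out (Interp.weight w e z.1) p.2.1 *
          runWeight out (Interp.weight w f z.2) p.2.2, z))
      (fun ρ : Run out q (Interp.weight w e z.1 * Interp.weight w f z.2).1.toList q' =>
        (runWeight out _ ρ, z)) :=
    fun z => (Run.wiso_mul (out := out) _ _ q q').symm.comp fun x => (x, z)
  have h₃ := h₁.trans (WIso.sigma h₂)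
  exact h₃

/-- A run on a sequence of objects is a path of objects with runs. -/
lemma Transduced.wiso_seq (e : Expr ι) (q q' : Fin m) :
    WIso (fun c : Chain (Transduced out w e) q q' => c.weight (Transduced.weight out w e _ _))
      (Transduced.weight out w (.seq e) q q') := by
  choose E hE using fun q q' => Transduced.wiso_pair (out := out) (w := w) e (.seq e) q q'
  have hE₁ := fun q q' p => congrArg Prod.fst (hE q q' p)
  have hE₂ := fun q q' p => congrArg Prod.snd (hE q q' p)
  -- the run on a nonempty sequence `z :: l` is a run on the pair `(z, l)`
  let uncons {q q' : Fin m} (p : Transduced out w (.mul e (.seq e)) q q') :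
      Transduced out w (.seq e) q q' :=
    ⟨(List.cons (Prod.fst p.1) (Prod.snd p.1) : List (Interp Y e)), p.2⟩
  have uncons_injective {q q' : Fin m} : Function.Injective
      (uncons : Transduced out w (.mul e (.seq e)) q q' → _) := by
    rintro ⟨⟨z, l⟩, ρ⟩ ⟨⟨z', l'⟩, ρ'⟩ h
    have h₁ : z :: l = z' :: l' := congrArg Sigma.fst h
    obtain ⟨rfl, rfl⟩ := List.cons.inj h₁
    have h₂ : HEq ρ ρ' := (Sigma.mk.inj h).2
    rw [eq_of_heq h₂]
  let F : ∀ {q q'}, Chain (Transduced out w e) q q' → Transduced out w (.seq e) q q' :=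
    fun c => c.rec (motive := fun q q' _ => Transduced out w (.seq e) q q')
      (fun q => ⟨([] : List (Interp Y e)), ⟨rfl⟩⟩)
      (fun {p q r} v _ x => uncons (E p r ⟨q, v, x⟩))
  refine WIso.of_bijective F ⟨?_, ?_⟩ ?_
  · intro c c' h
    induction c with
    | nil p =>
      cases c' with
      | nil => rfl
      | cons v c' => exact absurd (congrArg Sigma.fst h) (List.cons_ne_nil _ _).symm
    | @cons p p₁ r v c ih =>
      cases c' with
      | nil => exact absurd (congrArg Sigma.fst h) (List.cons_ne_nil _ _)
      | cons v' c' =>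
        have h₁ := (E _ _).injective (uncons_injective h)
        cases Sigma.mk.inj h₁ with
        | intro h₂ h₃ =>
          subst h₂
          obtain ⟨rfl, h₄⟩ := Prod.mk.inj (eq_of_heq h₃)
          rw [ih h₄]
  · rintro ⟨l, ρ⟩
    induction (l : List (Interp Y e)) generalizing q with
    | nil =>
      obtain rfl : q = q' := ρ.down
      exact ⟨.nil q, rfl⟩
    | cons z l ih =>
      obtain ⟨⟨q₁, v, x⟩, hx⟩ := (E q q').surjective ⟨(z, l), ρ⟩
      have hl : x.1 = l := by
        have := hE₂ q q' ⟨q₁, v, x⟩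
        rw [hx] at this
        exact (congrArg Prod.snd this).symm
      obtain ⟨l', ρ'⟩ := x
      obtain rfl : l' = l := hl
      obtain ⟨c, hc⟩ := ih q₁ ρ'
      refine ⟨.cons v c, ?_⟩
      change uncons (E q q' ⟨q₁, v, F c⟩) = _
      rw [hc, hx]
  · intro c
    induction c with
    | nil p => rfl
    | @cons p p₁ r v c ih =>
      refine (hE₁ p r ⟨p₁, v, F c⟩).trans ?_
      exact congrArg (Transduced.weight out w e p p₁ v * ·) ih

/-- The expression `Expr.transduce W e q q'` denotes the objects of `e` with a run from `q` to
`q'`. -/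
theorem Interp.wiso_transduce {B : Type} {b : B → Weight}
    (hmono : ∀ q a q', (out q a q').Nonempty → q ≤ q')
    {W : Fin m → Atom → Fin m → Expr (Option (Fin m × ι × Fin m))}
    (hW : ∀ q a q', WIso (Interp.weight (TransducedClass.weight out w b) (W q a q'))
      (Subtype.val : out q a q' → Weight)) (e : Expr ι) (q q' : Fin m) :
    WIso (Interp.weight (TransducedClass.weight out w b) (e.transduce W q q'))
      (Transduced.weight out w e q q') := by
  induction e generalizing q q' with
  | zero => exact ⟨⟨fun z => Empty.elim z, fun z => Empty.elim z.1, fun z => Empty.elim z,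
      fun z => Empty.elim z.1⟩, fun z => Empty.elim z⟩
  | eps =>
    refine (Interp.wiso_guard _ _).trans
      ⟨⟨fun z => ⟨Unit.unit, z.1⟩, fun p => (p.2, Unit.unit), fun _ => rfl, fun _ => rfl⟩,
        fun z => rfl⟩
  | atom a =>
    refine (hW q a q').trans (WIso.of_bijective
      (fun o => ⟨Unit.unit, ⟨q', o, ⟨rfl⟩⟩⟩) ⟨fun o o' h => ?_, ?_⟩ fun o => ?_)
    · have h₁ := eq_of_heq (Sigma.mk.inj h).2
      exact (Prod.mk.inj (eq_of_heq (Sigma.mk.inj h₁).2)).1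
    · rintro ⟨_, q₁, o, ⟨rfl⟩⟩
      exact ⟨o, rfl⟩
    · exact (one_mul _).trans (mul_one _)
  | cls i => exact WIso.refl _
  | add e f ihe ihf =>
    refine ((ihe q q').sum (ihf q q')).trans ⟨⟨Sum.elim (fun p => ⟨Sum.inl p.1, p.2⟩)
      (fun p => ⟨Sum.inr p.1, p.2⟩), ?_, ?_, ?_⟩, ?_⟩
    · exact fun p => match p with
        | ⟨Sum.inl z, ρ⟩ => Sum.inl ⟨z, ρ⟩
        | ⟨Sum.inr z, ρ⟩ => Sum.inr ⟨z, ρ⟩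
    · rintro (p | p) <;> rfl
    · rintro ⟨z | z, ρ⟩ <;> rfl
    · rintro (p | p) <;> rfl
  | mul e f ihe ihf =>
    exact (Interp.wiso_sumFin _ _).trans ((WIso.sigma fun q₁ => (ihe q q₁).prod (ihf q₁ q')).trans
      ((Transduced.wiso_pair e f q q').comp Prod.fst))
  | seq e ih =>
    refine (Interp.wiso_star _ _ (fun p q v => v.2.le hmono) _ ih _ q q' (by omega)).trans
      (Transduced.wiso_seq e q q')

lemma Transduced.length_le (hne : ∀ q a q', ∀ o ∈ out q a q', o.1 ≠ 1) {e : Expr ι}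
    {q q' : Fin m} (p : Transduced out w e q q') :
    (Interp.weight w e p.1).1.length ≤ (Transduced.weight out w e q q' p).1.length := by
  refine (Run.length_le hne p.2).trans_eq ?_
  simp [Transduced.weight, runWeight]

lemma Expr.OfKind.transduce {k : Kind}
    {W : Fin m → Atom → Fin m → Expr (Option (Fin m × ι × Fin m))}
    (hW : ∀ q a q', (W q a q').OfKind k) {e : Expr ι} (h : e.OfKind k) (q q' : Fin m) :
    (e.transduce W q q').OfKind k := by
  induction e generalizing q q' with
  | zero => simp [Expr.transduce]
  | eps => exact Expr.OfKind.guard (by simp)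
  | atom a => exact hW q a q'
  | cls i => simpa [Expr.transduce] using h
  | add e f ihe ihf =>
    rw [Expr.ofKind_add] at h
    simp [Expr.transduce, ihe h.1, ihf h.2]
  | mul e f ihe ihf =>
    rw [Expr.ofKind_mul] at h
    exact Expr.OfKind.sumFin fun q₁ => by simp [ihe h.1, ihf h.2]
  | seq e ih =>
    rw [Expr.ofKind_seq] at h
    exact Expr.OfKind.star h.1 (ih h.2) _ _ _

lemma Admissible.transduce {B : Type} {b : B → Weight}
    (hne : ∀ q a q', ∀ o ∈ out q a q', o.1 ≠ 1)
    (hmono : ∀ q a q', (out q a q').Nonempty → q ≤ q')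
    {W : Fin m → Atom → Fin m → Expr (Option (Fin m × ι × Fin m))}
    (hW : ∀ q a q', WIso (Interp.weight (TransducedClass.weight out w b) (W q a q'))
      (Subtype.val : out q a q' → Weight))
    (hWa : ∀ q a q', Admissible (TransducedClass.weight out w b) (W q a q'))
    {e : Expr ι} (h : Admissible w e) (q q' : Fin m) :
    Admissible (TransducedClass.weight out w b) (e.transduce W q q') := by
  induction e generalizing q q' with
  | zero => trivial
  | eps => exact Admissible.guard _ fun _ => trivial
  | atom a => exact hWa q a q'
  | cls i => trivial
  | add e f ihe ihf => exact ⟨ihe h.1 q q', ihf h.2 q q'⟩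
  | mul e f ihe ihf =>
    exact Admissible.sumFin _ fun q₁ => ⟨ihe h.1 q q₁, ihf h.2 q₁ q'⟩
  | seq e ih =>
    refine Admissible.star _ (ih h.2) (fun q => ?_) m q q'
    refine ((Interp.wiso_transduce hmono hW e q q).forall_iff (p := fun x => x.1 ≠ 1)).2 fun p => ?_
    have h₁ := Transduced.length_le hne p
    have h₂ := h.1 p.1
    rw [Ne, ← FreeMonoid.length_eq_zero] at h₂ ⊢
    omega

lemma Run.wiso_tick (x : Weight) (q q' : Fin m) :
    WIso (fun ρ : Run out q x.1.toList q' => tick * runWeight out x ρ)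
      (fun ρ : Run out q (tick * x).1.toList q' => runWeight out (tick * x) ρ) :=
  ⟨Equiv.refl _, fun ρ => by
    change (1, tick.2 * x.2) * Run.weight _ = tick * ((1, x.2) * ρ.weight)
    rw [← mul_assoc]
    rfl⟩

lemma WIso.sigma_map {X Y V V' : Type} {f : X → V} {g : Y → V} (h : WIso f g) {P : V → Type}
    (v : ∀ x, P x → V') :
    WIso (fun p : Σ x, P (f x) => v _ p.2) (fun p : Σ y, P (g y) => v _ p.2) := by
  obtain ⟨e, he⟩ := h
  obtain rfl : f = fun x => g (e x) := funext fun x => (he x).symm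
  exact ⟨Equiv.sigmaCongrLeft (β := fun y => P (g y)) e, fun _ => rfl⟩

lemma Transduced.wiso_cls {i : ι} {e : Expr ι}
    (h : WIso (fun z => tick * Interp.weight w e z) (w i)) (q q' : Fin m) :
    WIso (fun p => tick * Transduced.weight out w e q q' p)
      (Transduced.weight out w (.cls i) q q') := by
  have h₁ := WIso.sigma fun z => Run.wiso_tick (out := out) (Interp.weight w e z) q q'
  have h₂ := h.sigma_map (P := fun x => Run out q x.1.toList q') fun x ρ => runWeight out x ρ
  exact h₁.trans h₂

lemma Transduced.finite (hne : ∀ q a q', ∀ o ∈ out q a q', o.1 ≠ 1)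
    (hfin : ∀ q a q' n, {o : out q a q' | o.1.1.length ≤ n}.Finite) {e : Expr ι}
    (h : ∀ n, {z | (Interp.weight w e z).1.length = n}.Finite) (q q' : Fin m) (n : ℕ) :
    {p | (Transduced.weight out w e q q' p).1.length = n}.Finite := by
  have h₁ : {z | (Interp.weight w e z).1.length ≤ n}.Finite := by
    refine ((Set.finite_Iic n).biUnion fun j _ => h j).subset fun z hz => ?_
    simpa using hz
  refine (h₁.biUnion fun z _ => (Run.finite_length_le hfin q (Interp.weight w e z).1.toList q'
    n).image (fun ρ => (⟨z, ρ⟩ : Transduced out w e q q'))).subset ?_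
  rintro ⟨z, ρ⟩ hp
  have hp' : (Transduced.weight out w e q q' ⟨z, ρ⟩).1.length = n := hp
  have hz := (Transduced.length_le hne (⟨z, ρ⟩ : Transduced out w e q q')).trans_eq hp'
  refine Set.mem_biUnion hz ⟨ρ, ?_, rfl⟩
  simpa [Transduced.weight, runWeight] using hp'.le

end Transduce

/-- The specification whose classes are an auxiliary one, defined by `A`, and the classes of `S`
with runs between given states. -/
def Spec.transduce (S : Spec) {m : ℕ}
    (W : Fin m → Atom → Fin m → Expr (Option (Fin m × S.Idx × Fin m)))
    (A : Expr (Option (Fin m × S.Idx × Fin m))) : Spec where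
  Idx := Option (Fin m × S.Idx × Fin m)
  finite_idx := by
    have := S.finite_idx
    infer_instance
  eqn
    | none => A
    | some t => (S.eqn t.2.1).transduce W t.1 t.2.2
  start := none

/-- A class that is described by an expression over the objects of `S` with runs of a transducer
is presented by a specification of the same kind as `S`. -/
theorem Presented.transduce {k : Kind} {S : Spec} (hk : ∀ i, (S.eqn i).OfKind k)
    (hS : S.WellDefined) {m : ℕ} {out : Fin m → Atom → Fin m → Set Weight}
    (hne : ∀ q a q', ∀ o ∈ out q a q', o.1 ≠ 1)
    (hmono : ∀ q a q', (out q a q').Nonempty → q ≤ q')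
    (hfin : ∀ q a q' n, {o : out q a q' | o.1.1.length ≤ n}.Finite)
    {w : ∀ i, Obj S (.cls i) → Weight} (hw : w = fun _ => Obj.weight)
    {B : Type} {b : B → Weight} (hb : ∀ n, {x | (b x).1.length = n}.Finite)
    {W : Fin m → Atom → Fin m → Expr (Option (Fin m × S.Idx × Fin m))}
    (hW : ∀ q a q', WIso (Interp.weight (TransducedClass.weight out w b) (W q a q'))
      (Subtype.val : out q a q' → Weight))
    (hWa : ∀ q a q', Admissible (TransducedClass.weight out w b) (W q a q'))
    (hWk : ∀ q a q', (W q a q').OfKind k)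
    {A : Expr (Option (Fin m × S.Idx × Fin m))}
    (hA : WIso (fun z => tick * Interp.weight (TransducedClass.weight out w b) A z) b)
    (hAa : Admissible (TransducedClass.weight out w b) A) (hAk : A.OfKind k)
    {e : Expr (Option (Fin m × S.Idx × Fin m))} (hek : e.OfKind k)
    (hea : Admissible (TransducedClass.weight out w b) e) :
    Presented k (fun z => (Interp.weight (TransducedClass.weight out w b) e z).1.toList) := by
  subst hw
  refine Presented.of_expr (S := S.transduce W A) ?_ (w := TransducedClass.weight out _ b)
    ?_ ?_ ?_ hek hea
  · rintro (_ | ⟨q, i, q'⟩)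
    · exact hAk
    · exact (hk i).transduce hWk q q'
  · rintro (_ | ⟨q, i, q'⟩)
    · exact hA
    · exact ((Interp.wiso_transduce hmono hW (S.eqn i) q q').comp (tick * ·)).trans
        (Transduced.wiso_cls (Obj.solution S i) q q')
  · rintro (_ | ⟨q, i, q'⟩) n
    · exact hb n
    · exact Transduced.finite hne hfin (w := fun _ => Obj.weight) (e := .cls i) (hS.finite i) q q' n
  · rintro (_ | ⟨q, i, q'⟩)
    · exact hAa
    · exact Admissible.transduce hne hmono hW hWa (hS.admissible i) q q'

/-! ### Inserted words -/

/-- The number of ticks of a word `Z ⋯ Z` of length `n`, as an object denoted by `zStar k`. -/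
def starTicks : Kind → ℕ → Multiplicative ℕ
  | .regular, _ => 1
  | _, n => Multiplicative.ofAdd (n + 1)

/-- The weight of the word `Z ⋯ Z` of length `n`, as an object denoted by `zStar k`. -/
def starWeight (k : Kind) (n : ℕ) : Weight :=
  (FreeMonoid.ofList (List.replicate n .Z), starTicks k n)

/-- The weights of the auxiliary class: its objects are the words `Z ⋯ Z`. -/
def auxWeight (k : Kind) (n : ℕ) : Weight :=
  (FreeMonoid.ofList (List.replicate n .Z), match k with
    | .regular => Multiplicative.ofAdd 1
    | _ => Multiplicative.ofAdd (n + 1))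

/-- The equation of the auxiliary class of words `Z ⋯ Z`. -/
def auxEqn {κ : Type} : Kind → Expr (Option κ)
  | .regular => .seq (.atom .Z)
  | _ => .add .eps (.mul (.atom .Z) (.cls none))

/-- The words `Z ⋯ Z`: a sequence in a regular specification, and the auxiliary class in the
specifications of other kinds. -/
def zStar {κ : Type} : Kind → Expr (Option κ)
  | .regular => .seq (.atom .Z)
  | _ => .cls none

/-- The forms of the words that are inserted between two consecutive entries: the empty word, the
words of atoms `Z`, possibly required to be nonempty, and these words with a final atom `R`. -/
inductive Insertion : Type
  | empty
  | plus
  | star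
  | last

namespace Insertion

/-- There is a word of length `n` of this form. -/
def Allows : Insertion → ℕ → Prop
  | empty, n => n = 0
  | plus, n => n ≠ 0
  | star, _ => True
  | last, n => n ≠ 0

/-- The word of length `n` of this form. -/
def word : Insertion → ℕ → List Atom
  | last, n => List.replicate (n - 1) .Z ++ [.R]
  | _, n => List.replicate n .Z

/-- The word of length `n`, with the ticks that it has as an object denoted by `expr`. -/
def weight (k : Kind) (s : Insertion) (n : ℕ) : Weight :=
  (FreeMonoid.ofList (s.word n), match s with
    | empty => 1
    | star => starTicks k n
    | _ => starTicks k (n - 1))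

/-- The expression for the words of this form. -/
def expr {κ : Type} (k : Kind) : Insertion → Expr (Option κ)
  | empty => .eps
  | plus => .mul (.atom .Z) (zStar k)
  | star => zStar k
  | last => .mul (zStar k) (.atom .R)

lemma length_word {s : Insertion} {n : ℕ} (h : s.Allows n) : (s.word n).length = n := by
  cases s <;> simp_all [word, Allows]
  omega

lemma expr_ofKind {κ : Type} (k : Kind) (s : Insertion) : (s.expr k : Expr (Option κ)).OfKind k := by
  cases k <;> cases s <;> simp [expr, zStar]

end Insertion

lemma replicate_prod (n : ℕ) :
    ((List.replicate n Unit.unit).map fun _ => atomWeight .Z).prod =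
      (FreeMonoid.ofList (List.replicate n Atom.Z), 1) := by
  induction n with
  | zero => rfl
  | succ n ih =>
    rw [List.replicate_succ, List.map_cons, List.prod_cons, ih]
    rfl

lemma wiso_seq_Z : WIso (fun l : List Unit => (l.map fun _ => atomWeight .Z).prod)
    (fun n : ℕ => ((FreeMonoid.ofList (List.replicate n Atom.Z), 1) : Weight)) := by
  refine WIso.symm ⟨⟨fun n => List.replicate n Unit.unit, List.length, fun n => by simp,
    fun l => (List.eq_replicate_iff.2 ⟨rfl, fun _ _ => rfl⟩).symm⟩, fun n => replicate_prod n⟩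

section

variable {κ : Type} (k : Kind) {X : Option κ → Type} {w : ∀ o, X o → Weight}
  (hX : WIso (w none) (auxWeight k))

include hX

lemma wiso_auxEqn : WIso (fun z => tick * Interp.weight w (auxEqn k) z) (auxWeight k) := by
  have h₁ (hX' : WIso (w none) fun n => ((FreeMonoid.ofList (List.replicate n .Z),
      Multiplicative.ofAdd (n + 1)) : Weight)) :
      WIso (fun z : Unit ⊕ Unit × X none => tick * Sum.elim (fun _ => (1 : Weight))
        (fun p => atomWeight .Z * w none p.2) z)
      (fun n => ((FreeMonoid.ofList (List.replicate n .Z),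
        Multiplicative.ofAdd (n + 1)) : Weight)) := by
    refine ((((WIso.refl (fun _ : Unit => (1 : Weight))).sum
      ((WIso.refl fun _ : Unit => atomWeight .Z).prod hX')).comp (tick * ·)).trans
      (WIso.of_bijective (Sum.elim (fun _ => 0) (fun p => p.2 + 1)) ⟨?_, ?_⟩ ?_))
    · rintro (_ | ⟨_, n⟩) (_ | ⟨_, n'⟩) h <;> simp_all
    · rintro (_ | n)
      · exact ⟨.inl .unit, rfl⟩
      · exact ⟨.inr (.unit, n), rfl⟩
    · rintro (_ | ⟨_, n⟩)
      · rfl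
      · refine Prod.ext rfl ?_
        change Multiplicative.ofAdd (n + 1 + 1) =
          Multiplicative.ofAdd 1 * (1 * Multiplicative.ofAdd (n + 1))
        rw [one_mul, ← ofAdd_add, add_comm]
  cases k with
  | regular => exact wiso_seq_Z.comp (tick * ·)
  | general => exact h₁ hX
  | contextFree => exact h₁ hX

lemma wiso_zStar : WIso (Interp.weight w (zStar k)) (starWeight k) := by
  cases k with
  | regular => exact wiso_seq_Z
  | general => exact hX
  | contextFree => exact hX

/-- The expression of a form of insertions denotes the words of this form. -/
lemma Insertion.wiso_expr (s : Insertion) :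
    WIso (Interp.weight w (s.expr k)) (fun n : {n // s.Allows n} => s.weight k n) := by
  have h := wiso_zStar k hX
  cases s with
  | empty =>
    exact ⟨⟨fun _ => ⟨0, rfl⟩, fun _ => .unit, fun _ => rfl, fun n => Subtype.ext n.2.symm⟩,
      fun _ => rfl⟩
  | plus =>
    refine ((WIso.refl fun _ : Unit => atomWeight .Z).prod h).trans
      ⟨⟨fun p => ⟨p.2 + 1, Nat.succ_ne_zero _⟩, fun n => (.unit, n.1 - 1), fun _ => rfl, ?_⟩,
        fun p => ?_⟩
    · rintro ⟨n, hn⟩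
      exact Subtype.ext (Nat.succ_pred_eq_of_ne_zero hn)
    · exact Prod.ext rfl (one_mul _).symm
  | star =>
    exact h.trans ⟨⟨fun n => ⟨n, trivial⟩, fun n => n.1, fun _ => rfl, fun _ => rfl⟩, fun _ => rfl⟩
  | last =>
    refine (h.prod (WIso.refl fun _ : Unit => atomWeight .R)).trans
      ⟨⟨fun p => ⟨p.1 + 1, Nat.succ_ne_zero _⟩, fun n => (n.1 - 1, .unit), fun _ => rfl, ?_⟩,
        fun p => ?_⟩
    · rintro ⟨n, hn⟩
      exact Subtype.ext (Nat.succ_pred_eq_of_ne_zero hn)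
    · exact Prod.ext rfl (mul_one _).symm

end

lemma auxEqn_ofKind {κ : Type} (k : Kind) : (auxEqn k : Expr (Option κ)).OfKind k := by
  cases k <;> simp [auxEqn]

lemma admissible_auxEqn {κ : Type} (k : Kind) {X : Option κ → Type} (w : ∀ o, X o → Weight) :
    Admissible w (auxEqn k) := by
  cases k with
  | regular => exact ⟨fun _ => FreeMonoid.of_ne_one _, trivial⟩
  | general => exact ⟨trivial, trivial, trivial⟩
  | contextFree => exact ⟨trivial, trivial, trivial⟩

lemma Insertion.admissible_expr {κ : Type} (k : Kind) {X : Option κ → Type}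
    (w : ∀ o, X o → Weight) (s : Insertion) : Admissible w (s.expr k) := by
  have h : Admissible w (zStar k) := by
    cases k with
    | regular => exact ⟨fun _ => FreeMonoid.of_ne_one _, trivial⟩
    | general => trivial
    | contextFree => trivial
  cases s with
  | empty => trivial
  | plus => exact ⟨trivial, h⟩
  | star => exact h
  | last => exact ⟨h, trivial⟩

/-! ### Inserting an increasing sequence of entries to the right -/

/-- The atom of an entry after further entries have been placed to its right. -/
def keepAtom : Atom → Atom
  | .R => .Z
  | .LR => .L
  | a => a

/-- The atom marks a rightmost entry. -/
def IsRight (a : Atom) : Prop := a = .R ∨ a = .LR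

/-- The words of a permutation with additional entries `none`, to be placed to the right in
increasing order. Some `none` is below the rightmost of the old entries. -/
def FirstBelow : List (Option Atom) → Prop
  | [] => False
  | none :: _ => True
  | some a :: u => ¬ IsRight a ∧ FirstBelow u

open Classical in
/-- The word of the enlarged permutation: the last of the additional entries is the new rightmost
entry. -/
noncomputable def insertWord : List (Option Atom) → List Atom
  | [] => []
  | none :: u => (if none ∈ u then .Z else .R) :: insertWord u
  | some a :: u => keepAtom a :: insertWord u

/-- The states of the transducer that inserts the entries: in state `0` none has been inserted, in
state `1` some have been inserted and others will follow, in the states `2` and `3` all have been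
inserted, where in state `2` no atom has been read. The table has the form of the words that are
inserted in a transition. -/
def insTable : Fin 4 → Fin 4 → Option Insertion
  | 0, 0 => some .empty
  | 0, 1 => some .plus
  | 0, 3 => some .last
  | 1, 1 => some .star
  | 1, 3 => some .last
  | 2, 3 => some .empty
  | 3, 3 => some .empty
  | _, _ => none

/-- The words that are inserted before the first atom, by the state that is reached. -/
def insStart : Fin 4 → Option Insertion
  | 0 => some .empty
  | 1 => some .plus
  | 2 => some .last
  | 3 => none

/-- What remains to be done in each state. -/
def Good (q : Fin 4) (u : List (Option Atom)) : Prop :=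
  match q with
  | 0 => FirstBelow u
  | 1 => none ∈ u
  | 2 => none ∉ u ∧ u ≠ []
  | 3 => none ∉ u

/-- The words of the given form, if there is one. -/
def Insertion.words (k : Kind) (o : Option Insertion) : Set Weight :=
  {y | ∃ s, o = some s ∧ ∃ n, s.Allows n ∧ y = s.weight k n}

/-- The expression for the words of the given form, if there is one. -/
def Insertion.wordsExpr {κ : Type} (k : Kind) : Option Insertion → Expr (Option κ)
  | none => .zero
  | some s => s.expr k

/-- The outputs of the transducer. -/
def insOut (k : Kind) (q : Fin 4) (a : Atom) (q' : Fin 4) : Set Weight :=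
  {x | ¬ (q = 0 ∧ IsRight a) ∧ ∃ y ∈ Insertion.words k (insTable q q'),
    x = atomWeight (keepAtom a) * y}

open Classical in
/-- The expressions for the outputs of the transducer. -/
noncomputable def insExpr {κ : Type} (k : Kind) (q : Fin 4) (a : Atom) (q' : Fin 4) :
    Expr (Option κ) :=
  .guard (¬ (q = 0 ∧ IsRight a))
    (.mul (.atom (keepAtom a)) (Insertion.wordsExpr k (insTable q q')))

lemma Insertion.length_weight {k : Kind} {s : Insertion} {n : ℕ} (h : s.Allows n) :
    (s.weight k n).1.length = n := Insertion.length_word h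

lemma Insertion.wiso_wordsExpr {κ : Type} (k : Kind) {X : Option κ → Type}
    {w : ∀ o, X o → Weight} (hX : WIso (w none) (auxWeight k)) (o : Option Insertion) :
    WIso (Interp.weight w (wordsExpr k o)) (Subtype.val : words k o → Weight) := by
  cases o with
  | none =>
    have : IsEmpty (words k none) := ⟨fun x => by obtain ⟨s, hs, _⟩ := x.2; cases hs⟩
    exact ⟨⟨fun z => Empty.elim z, fun x => isEmptyElim x, fun z => Empty.elim z,
      fun x => isEmptyElim x⟩, fun z => Empty.elim z⟩
  | some s =>
    refine (Insertion.wiso_expr k hX s).trans (WIso.of_bijective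
      (fun n => ⟨s.weight k n, s, rfl, n, n.2, rfl⟩) ⟨fun n n' h => ?_, ?_⟩ fun _ => rfl)
    · have := congrArg (fun x => x.1.1.length) h
      exact Subtype.ext (by simpa [length_weight n.2, length_weight n'.2] using this)
    · rintro ⟨_, s', hs, n, hn, rfl⟩
      cases hs
      exact ⟨⟨n, hn⟩, rfl⟩

lemma wiso_insExpr {κ : Type} (k : Kind) {X : Option κ → Type}
    {w : ∀ o, X o → Weight} (hX : WIso (w none) (auxWeight k)) (q : Fin 4) (a : Atom)
    (q' : Fin 4) :
    WIso (Interp.weight w (insExpr k q a q')) (Subtype.val : insOut k q a q' → Weight) := by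
  classical
  have h := (WIso.refl fun _ : Unit => atomWeight (keepAtom a)).prod
    (Insertion.wiso_wordsExpr k hX (insTable q q'))
  obtain ⟨e, he⟩ := h
  have h' : WIso (fun z : PLift (¬ (q = 0 ∧ IsRight a)) ×
        (Unit × Interp X (Insertion.wordsExpr k (insTable q q'))) =>
        atomWeight (keepAtom a) * Interp.weight w _ z.2.2)
      (fun z : PLift (¬ (q = 0 ∧ IsRight a)) × (Unit × Insertion.words k (insTable q q')) =>
        atomWeight (keepAtom a) * z.2.2.1) :=
    ⟨(Equiv.refl _).prodCongr e, fun z => he z.2⟩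
  refine (Interp.wiso_guard _ _).trans (h'.trans ?_)
  refine WIso.of_bijective (fun z => ⟨atomWeight (keepAtom a) * z.2.2.1, z.1.down, z.2.2.1,
    z.2.2.2, rfl⟩) ⟨?_, ?_⟩ fun _ => rfl
  · rintro ⟨⟨h⟩, _, y⟩ ⟨⟨h'⟩, _, y'⟩ hz
    have := mul_left_cancel (congrArg Subtype.val hz)
    obtain rfl : y = y' := Subtype.ext this
    rfl
  · rintro ⟨_, h, y, hy, rfl⟩
    exact ⟨(⟨h⟩, .unit, ⟨y, hy⟩), rfl⟩

lemma insExpr_ofKind {κ : Type} (k : Kind) (q : Fin 4) (a : Atom) (q' : Fin 4) :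
    (insExpr k q a q' : Expr (Option κ)).OfKind k := by
  classical
  refine Expr.OfKind.guard ?_
  cases insTable q q' <;> simp [Insertion.wordsExpr, Insertion.expr_ofKind]

lemma Insertion.admissible_wordsExpr {κ : Type} (k : Kind) {X : Option κ → Type}
    (w : ∀ o, X o → Weight) (o : Option Insertion) : Admissible w (wordsExpr k o) := by
  cases o with
  | none => trivial
  | some s => exact admissible_expr k w s

lemma admissible_insExpr {κ : Type} (k : Kind) {X : Option κ → Type} (w : ∀ o, X o → Weight)
    (q : Fin 4) (a : Atom) (q' : Fin 4) : Admissible w (insExpr k q a q') := by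
  classical
  exact Admissible.guard _ fun _ => ⟨trivial, Insertion.admissible_wordsExpr k w _⟩

lemma insOut_ne_one {k : Kind} {q : Fin 4} {a : Atom} {q' : Fin 4} {x : Weight}
    (hx : x ∈ insOut k q a q') : x.1 ≠ 1 := by
  obtain ⟨_, y, _, rfl⟩ := hx
  exact List.cons_ne_nil _ _

lemma insOut_mono {k : Kind} {q : Fin 4} {a : Atom} {q' : Fin 4}
    (h : (insOut k q a q').Nonempty) : q ≤ q' := by
  obtain ⟨_, _, _, ⟨s, hs, _⟩, _⟩ := h
  fin_cases q <;> fin_cases q' <;> simp_all [insTable]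

lemma Insertion.finite_words (k : Kind) (o : Option Insertion) (n : ℕ) :
    {y : Weight | y ∈ words k o ∧ y.1.length ≤ n}.Finite := by
  cases o with
  | none => exact Set.finite_empty.subset fun y ⟨⟨s, hs, _⟩, _⟩ => by cases hs
  | some s =>
    refine ((Set.finite_Iic n).image (s.weight k)).subset ?_
    rintro _ ⟨⟨s', hs, j, hj, rfl⟩, h⟩
    cases hs
    rw [length_weight hj] at h
    exact ⟨j, h, rfl⟩

lemma insOut_finite (k : Kind) (q : Fin 4) (a : Atom) (q' : Fin 4) (n : ℕ) :
    {o : insOut k q a q' | o.1.1.length ≤ n}.Finite := by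
  refine Set.Finite.of_finite_image (f := Subtype.val) ?_ Subtype.val_injective.injOn
  refine ((Insertion.finite_words k (insTable q q') n).image
    (atomWeight (keepAtom a) * ·)).subset ?_
  rintro _ ⟨⟨_, _, y, hy, rfl⟩, h, rfl⟩
  refine ⟨y, ⟨hy, ?_⟩, rfl⟩
  have h' : (atomWeight (keepAtom a) * y).1.length ≤ n := h
  rw [Prod.fst_mul, FreeMonoid.length_mul] at h'
  omega

/-! ### The runs of the insertion transducer -/

lemma exists_replicate_none (u : List (Option Atom)) :
    ∃ n u', u = List.replicate n none ++ u' ∧ u'.head? ≠ some none := by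
  induction u with
  | nil => exact ⟨0, [], rfl, by simp⟩
  | cons x u ih =>
    cases x with
    | none =>
      obtain ⟨n, u', rfl, h⟩ := ih
      exact ⟨n + 1, u', rfl, h⟩
    | some a => exact ⟨0, some a :: u, rfl, by simp⟩

lemma replicate_none_inj {n n' : ℕ} {u u' : List (Option Atom)} (hu : u.head? ≠ some none)
    (hu' : u'.head? ≠ some none)
    (h : List.replicate n none ++ u = List.replicate n' none ++ u') : n = n' ∧ u = u' := by
  induction n generalizing n' with
  | zero =>
    cases n' with
    | zero => exact ⟨rfl, h⟩
    | succ n' =>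
      rw [List.replicate_zero, List.nil_append] at h
      rw [h] at hu
      simp [List.replicate_succ] at hu
  | succ n ih =>
    cases n' with
    | zero =>
      rw [List.replicate_zero, List.nil_append] at h
      rw [← h] at hu'
      simp [List.replicate_succ] at hu'
    | succ n' =>
      simp only [List.replicate_succ, List.cons_append, List.cons.injEq, true_and] at h
      obtain ⟨rfl, rfl⟩ := ih h
      exact ⟨rfl, rfl⟩

lemma insertWord_replicate_of_mem (n : ℕ) {u : List (Option Atom)} (h : none ∈ u) :
    insertWord (List.replicate n none ++ u) = List.replicate n .Z ++ insertWord u := by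
  induction n with
  | zero => rfl
  | succ n ih => simp [List.replicate_succ, insertWord, ih, h]

lemma insertWord_replicate_of_notMem {n : ℕ} (hn : n ≠ 0) {u : List (Option Atom)}
    (h : none ∉ u) :
    insertWord (List.replicate n none ++ u) =
      List.replicate (n - 1) .Z ++ [.R] ++ insertWord u := by
  obtain ⟨n, rfl⟩ := Nat.exists_eq_succ_of_ne_zero hn
  induction n with
  | zero => simp [insertWord, h]
  | succ n ih =>
    rw [List.replicate_succ, List.cons_append, insertWord, ih (Nat.succ_ne_zero _)]
    simp [List.replicate_succ]

/-- The word that is inserted in a transition, or at the start, is the one that is determined by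
the remaining states. -/
lemma insertWord_replicate {o : Option Insertion} {q : Fin 4} (ho : o = insStart q ∨
    ∃ q₀, o = insTable q₀ q) {s : Insertion} (hs : o = some s) {n : ℕ} (hn : s.Allows n)
    {u : List (Option Atom)} (hu : Good q u) :
    insertWord (List.replicate n none ++ u) = s.word n ++ insertWord u := by
  have h₁ : s = .empty ∨ ((s = .plus ∨ s = .star) ∧ none ∈ u) ∨ s = .last ∧ none ∉ u := by
    rcases ho with rfl | ⟨q₀, rfl⟩
    · fin_cases q <;> simp_all [insStart, Good]
    · fin_cases q₀ <;> fin_cases q <;> simp_all [insTable, Good]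
  rcases h₁ with rfl | ⟨rfl | rfl, h⟩ | ⟨rfl, h⟩
  · obtain rfl : n = 0 := hn
    rfl
  · exact insertWord_replicate_of_mem n h
  · exact insertWord_replicate_of_mem n h
  · exact insertWord_replicate_of_notMem hn h

lemma firstBelow_replicate {n : ℕ} (hn : n ≠ 0) (u : List (Option Atom)) :
    FirstBelow (List.replicate n none ++ u) := by
  obtain ⟨n, rfl⟩ := Nat.exists_eq_succ_of_ne_zero hn
  trivial

lemma good_step {q q' : Fin 4} {a : Atom} (ha : ¬ (q = 0 ∧ IsRight a)) {s : Insertion}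
    (hs : insTable q q' = some s) {n : ℕ} (hn : s.Allows n) {u : List (Option Atom)}
    (hu : Good q' u) : Good q (some a :: (List.replicate n none ++ u)) := by
  fin_cases q <;> fin_cases q' <;> simp_all [insTable, Good] <;> subst hs <;>
    simp_all [Insertion.Allows, FirstBelow, firstBelow_replicate]

lemma exists_step {q : Fin 4} {a : Atom} {n : ℕ} {u : List (Option Atom)}
    (h : Good q (some a :: (List.replicate n none ++ u))) :
    ¬ (q = 0 ∧ IsRight a) ∧ ∃ q' s, insTable q q' = some s ∧ s.Allows n ∧ Good q' u := by
  by_cases hm : none ∈ u <;> by_cases hn : n = 0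
  · subst hn
    fin_cases q
    · exact ⟨fun h' => h.1 h'.2, 0, .empty, rfl, rfl, h.2⟩
    · exact ⟨by simp, 1, .star, rfl, trivial, hm⟩
    · simp [Good, hm] at h
    · simp [Good, hm] at h
  · fin_cases q
    · exact ⟨fun h' => h.1 h'.2, 1, .plus, rfl, hn, hm⟩
    · exact ⟨by simp, 1, .star, rfl, trivial, hm⟩
    · simp [Good, hm] at h
    · simp [Good, hm] at h
  · subst hn
    fin_cases q
    · exact ⟨fun h' => h.1 h'.2, 0, .empty, rfl, rfl, h.2⟩
    · simp [Good, hm] at h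
    · exact ⟨by simp, 3, .empty, rfl, rfl, hm⟩
    · exact ⟨by simp, 3, .empty, rfl, rfl, hm⟩
  · fin_cases q
    · exact ⟨fun h' => h.1 h'.2, 3, .last, rfl, hn, hm⟩
    · exact ⟨by simp, 3, .last, rfl, hn, hm⟩
    · simp [Good, hn] at h
    · simp [Good, hn] at h

lemma step_unique {q q₁ q₂ : Fin 4} {s₁ s₂ : Insertion} (h₁ : insTable q q₁ = some s₁)
    (h₂ : insTable q q₂ = some s₂) {n : ℕ} (hn₁ : s₁.Allows n) (hn₂ : s₂.Allows n)
    {u : List (Option Atom)} (hu₁ : Good q₁ u) (hu₂ : Good q₂ u) : q₁ = q₂ := by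
  fin_cases q <;> fin_cases q₁ <;> fin_cases q₂ <;> simp_all [insTable, Good] <;> subst h₁ <;> 
    subst h₂ <;> simp_all [Insertion.Allows]

/-- A permutation word with additional entries that may be inserted from the state `q`, where the
first entry is an old one. -/
abbrev Remaining (q : Fin 4) (l : List Atom) : Type :=
  {u : List (Option Atom) // u.reduceOption = l ∧ u.head? ≠ some none ∧ Good q u}

lemma reduceOption_replicate_none (n : ℕ) (u : List (Option Atom)) :
    (List.replicate n none ++ u).reduceOption = u.reduceOption := by
  induction n with
  | zero => rfl
  | succ n ih => simpa [List.replicate_succ] using ih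

lemma length_of_mem_words {k : Kind} {o : Option Insertion} {y : Weight}
    (hy : y ∈ Insertion.words k o) :
    ∃ s, o = some s ∧ s.Allows y.1.length ∧ y = s.weight k y.1.length := by
  obtain ⟨s, hs, n, hn, rfl⟩ := hy
  rw [Insertion.length_weight hn]
  exact ⟨s, hs, hn, rfl⟩

lemma length_of_mem_insOut {k : Kind} {q : Fin 4} {a : Atom} {q' : Fin 4} {x : Weight}
    (hx : x ∈ insOut k q a q') : ¬ (q = 0 ∧ IsRight a) ∧ ∃ s, insTable q q' = some s ∧
      s.Allows (x.1.length - 1) ∧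
      x = atomWeight (keepAtom a) * s.weight k (x.1.length - 1) := by
  obtain ⟨ha, y, hy, rfl⟩ := hx
  obtain ⟨s, hs, hn, h⟩ := length_of_mem_words hy
  have : (atomWeight (keepAtom a) * y).1.length - 1 = y.1.length := by
    simp [atomWeight]
  rw [this]
  exact ⟨ha, s, hs, hn, congrArg _ h⟩

/-- The accepting runs of the transducer correspond to the possible ways to insert entries. -/
lemma wiso_run (k : Kind) (l : List Atom) (q : Fin 4) :
    WIso (fun ρ : Run (insOut k) q l 3 => ρ.weight.1.toList)
      (fun u : Remaining q l => insertWord u.1) := by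
  induction l generalizing q with
  | nil =>
    have h : ∀ u : Remaining q [], u.1 = [] := by
      rintro ⟨u, hu, hu', _⟩
      obtain ⟨n, v, rfl, hv⟩ := exists_replicate_none u
      rw [reduceOption_replicate_none] at hu
      have hv' : v = [] := by
        cases v with
        | nil => rfl
        | cons x v => cases x <;> simp_all
      subst hv'
      cases n with
      | zero => rfl
      | succ n => simp [List.replicate_succ] at hu'
    refine WIso.of_bijective (fun ρ => ⟨[], rfl, by simp, ?_⟩) ⟨fun ρ ρ' _ => ?_, fun u => ?_⟩
      fun _ => rfl
    · obtain rfl : q = 3 := ρ.down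
      simp [Good]
    · cases ρ; cases ρ'; rfl
    · have hu := h u
      refine ⟨⟨?_⟩, Subtype.ext hu.symm⟩
      have hg := u.2.2.2
      rw [hu] at hg
      fin_cases q <;> simp_all [Good, FirstBelow]
  | cons a l ih =>
    have h₁ : WIso (fun ρ : Run (insOut k) q (a :: l) 3 => ρ.weight.1.toList)
        (fun p : Σ q₁, insOut k q a q₁ × Remaining q₁ l =>
          p.2.1.1.1.toList ++ insertWord p.2.2.1) :=
      WIso.sigma (f := fun q₁ (p : insOut k q a q₁ × Run (insOut k) q₁ l 3) =>
          p.1.1.1.toList ++ p.2.weight.1.toList)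
        (g := fun q₁ (p : insOut k q a q₁ × Remaining q₁ l) =>
          p.1.1.1.toList ++ insertWord p.2.1) fun q₁ => by
        obtain ⟨e, he⟩ := ih q₁
        exact ⟨(Equiv.refl _).prodCongr e, fun p => congrArg (p.1.1.1.toList ++ ·) (he p.2)⟩
    refine h₁.trans (WIso.of_bijective (fun p => ⟨some a ::
      (List.replicate (p.2.1.1.1.length - 1) none ++ p.2.2.1), ?_, by simp, ?_⟩)
      ⟨?_, ?_⟩ ?_)
    · rw [List.reduceOption_cons_of_some, reduceOption_replicate_none, p.2.2.2.1]
    · obtain ⟨ha, s, hs, hn, -⟩ := length_of_mem_insOut p.2.1.2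
      exact good_step ha hs hn p.2.2.2.2.2
    · rintro ⟨q₁, ⟨x, hx⟩, ⟨u, hul, huh, hug⟩⟩ ⟨q₂, ⟨y, hy⟩, ⟨v, hvl, hvh, hvg⟩⟩ h
      have h' := (List.cons.inj (congrArg Subtype.val h)).2
      obtain ⟨hn, rfl⟩ := replicate_none_inj huh hvh h'
      obtain ⟨ha, s, hs, hsn, hxs⟩ := length_of_mem_insOut hx
      obtain ⟨-, s', hs', hsn', hys⟩ := length_of_mem_insOut hy
      simp only at hn
      rw [← hn] at hsn' hys
      obtain rfl := step_unique hs hs' hsn hsn' hug hvg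
      obtain rfl : s = s' := Option.some.inj (hs.symm.trans hs')
      have hxy : x = y := hxs.trans hys.symm
      subst hxy
      rfl
    · rintro ⟨u, hul, huh, hug⟩
      cases u with
      | nil => simp at hul
      | cons x u =>
        cases x with
        | none => simp at huh
        | some b =>
          rw [List.reduceOption_cons_of_some] at hul
          obtain ⟨rfl, rfl⟩ := List.cons.inj hul
          obtain ⟨n, u', rfl, hu'⟩ := exists_replicate_none u
          obtain ⟨ha, q', s, hs, hn, hg⟩ := exists_step hug
          refine ⟨⟨q', ⟨_, ha, _, ⟨s, hs, n, hn, rfl⟩, rfl⟩,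
            ⟨u', (reduceOption_replicate_none n u').symm, hu', hg⟩⟩, Subtype.ext ?_⟩
          have hlen : (atomWeight (keepAtom b) * s.weight k n).1.length - 1 = n := by
            simp [atomWeight, Insertion.length_weight hn]
          simp only [hlen]
    · rintro ⟨q₁, ⟨x, hx⟩, ⟨u, hul, huh, hug⟩⟩
      obtain ⟨ha, s, hs, hsn, hxs⟩ := length_of_mem_insOut hx
      change keepAtom a :: insertWord (List.replicate (x.1.length - 1) none ++ u) =
        x.1.toList ++ insertWord u
      rw [insertWord_replicate (.inr ⟨q, rfl⟩) hs hsn hug]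
      conv_rhs => rw [hxs]
      rfl

/-- The permutation word `l` with additional entries that make a larger permutation whose maximal
increasing suffix consists of the additional entries: there is an old entry, and an additional
entry lies below the rightmost of the old ones. -/
abbrev Inserted (l : List Atom) : Type :=
  {u : List (Option Atom) // u.reduceOption = l ∧ FirstBelow u ∧ ∃ a, some a ∈ u}

lemma exists_some_mem {u : List (Option Atom)} (hu : u.head? ≠ some none) (h : u ≠ []) :
    ∃ a, some a ∈ u := by
  cases u with
  | nil => exact absurd rfl h
  | cons x u =>
    cases x with
    | none => simp at hu
    | some a => exact ⟨a, by simp⟩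

lemma FirstBelow.ne_nil {u : List (Option Atom)} (h : FirstBelow u) : u ≠ [] := by
  rintro rfl
  exact h

lemma start_good {q : Fin 4} {s : Insertion} (hs : insStart q = some s) {n : ℕ}
    (hn : s.Allows n) {u : List (Option Atom)} (hu : u.head? ≠ some none) (h : Good q u) :
    FirstBelow (List.replicate n none ++ u) ∧ ∃ a, some a ∈ List.replicate n none ++ u := by
  have hne : u ≠ [] := by
    fin_cases q
    · exact FirstBelow.ne_nil h
    · exact List.ne_nil_of_mem h
    · exact h.2
    · cases hs
  obtain ⟨a, ha⟩ := exists_some_mem hu hne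
  refine ⟨?_, a, List.mem_append_right _ ha⟩
  fin_cases q <;> cases hs
  · obtain rfl : n = 0 := hn
    exact h
  · exact firstBelow_replicate hn u
  · exact firstBelow_replicate hn u

lemma exists_start {n : ℕ} {u : List (Option Atom)}
    (h : FirstBelow (List.replicate n none ++ u))
    (h' : ∃ a, some a ∈ List.replicate n none ++ u) :
    ∃ q s, insStart q = some s ∧ s.Allows n ∧ Good q u := by
  by_cases hn : n = 0
  · subst hn
    exact ⟨0, .empty, rfl, rfl, h⟩
  · by_cases hm : none ∈ u
    · exact ⟨1, .plus, rfl, hn, hm⟩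
    · refine ⟨2, .last, rfl, hn, hm, ?_⟩
      rintro rfl
      simp at h'

lemma start_unique {q₁ q₂ : Fin 4} {s₁ s₂ : Insertion} (h₁ : insStart q₁ = some s₁)
    (h₂ : insStart q₂ = some s₂) {n : ℕ} (hn₁ : s₁.Allows n) (hn₂ : s₂.Allows n)
    {u : List (Option Atom)} (hu₁ : Good q₁ u) (hu₂ : Good q₂ u) : q₁ = q₂ := by
  fin_cases q₁ <;> fin_cases q₂ <;> simp_all [insStart, Good] <;> subst h₁ <;>
    subst h₂ <;> simp_all [Insertion.Allows]

/-- A start word and an accepting run correspond to a word with inserted entries. -/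
lemma wiso_inserted (k : Kind) (l : List Atom) :
    WIso (fun p : Σ q, Insertion.words k (insStart q) × Run (insOut k) q l 3 =>
        (p.2.1.1 * p.2.2.weight).1.toList)
      (fun u : Inserted l => insertWord u.1) := by
  have h₁ : WIso (fun p : Σ q, Insertion.words k (insStart q) × Run (insOut k) q l 3 =>
        (p.2.1.1 * p.2.2.weight).1.toList)
      (fun p : Σ q, Insertion.words k (insStart q) × Remaining q l =>
        p.2.1.1.1.toList ++ insertWord p.2.2.1) :=
    WIso.sigma (f := fun q (p : Insertion.words k (insStart q) × Run (insOut k) q l 3) =>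
        p.1.1.1.toList ++ p.2.weight.1.toList)
      (g := fun q (p : Insertion.words k (insStart q) × Remaining q l) =>
        p.1.1.1.toList ++ insertWord p.2.1) fun q => by
      obtain ⟨e, he⟩ := wiso_run k l q
      exact ⟨(Equiv.refl _).prodCongr e, fun p => congrArg (p.1.1.1.toList ++ ·) (he p.2)⟩
  refine h₁.trans (WIso.of_bijective
    (fun p => ⟨List.replicate p.2.1.1.1.length none ++ p.2.2.1, ?_, ?_⟩) ⟨?_, ?_⟩ ?_)
  · rw [reduceOption_replicate_none, p.2.2.2.1]
  · obtain ⟨s, hs, hn, -⟩ := length_of_mem_words p.2.1.2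
    exact start_good hs hn p.2.2.2.2.1 p.2.2.2.2.2
  · rintro ⟨q₁, ⟨x, hx⟩, ⟨u, hul, huh, hug⟩⟩ ⟨q₂, ⟨y, hy⟩, ⟨v, hvl, hvh, hvg⟩⟩ h
    obtain ⟨hn, rfl⟩ := replicate_none_inj huh hvh (congrArg Subtype.val h)
    obtain ⟨s, hs, hsn, hxs⟩ := length_of_mem_words hx
    obtain ⟨s', hs', hsn', hys⟩ := length_of_mem_words hy
    simp only at hn
    rw [← hn] at hsn' hys
    obtain rfl := start_unique hs hs' hsn hsn' hug hvg
    obtain rfl : s = s' := Option.some.inj (hs.symm.trans hs')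
    have hxy : x = y := hxs.trans hys.symm
    subst hxy
    rfl
  · rintro ⟨u, hul, huf, hua⟩
    obtain ⟨n, u', rfl, hu'⟩ := exists_replicate_none u
    obtain ⟨q, s, hs, hn, hg⟩ := exists_start huf hua
    rw [reduceOption_replicate_none] at hul
    refine ⟨⟨q, ⟨_, s, hs, n, hn, rfl⟩, ⟨u', hul, hu', hg⟩⟩, Subtype.ext ?_⟩
    simp only [Insertion.length_weight hn]
  · rintro ⟨q₁, ⟨x, hx⟩, ⟨u, hul, huh, hug⟩⟩
    obtain ⟨s, hs, hsn, hxs⟩ := length_of_mem_words hx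
    change insertWord (List.replicate x.1.length none ++ u) = x.1.toList ++ insertWord u
    rw [insertWord_replicate (.inl rfl) hs hsn hug]
    conv_rhs => rw [hxs]
    rfl

/-! ### Presentations of the enlarged classes -/

lemma Presented.wiso_eqn {S : Spec} {X : Type} {f : X → List Atom}
    (h : WIso (Obj.word : Obj S (.cls S.start) → List Atom) f) :
    WIso (fun z => (Interp.weight (fun i => (Obj.weight : Obj S (.cls i) → Weight))
      (S.eqn S.start) z).1.toList) f := by
  refine WIso.trans ?_ h
  have h₁ := (Obj.solution S S.start).comp fun x => x.1.toList
  simp only [Obj.weight_fst, FreeMonoid.toList_ofList] at h₁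
  exact h₁

/-- Add an object of size zero. -/
theorem Presented.add_nil {k : Kind} {X : Type} {f : X → List Atom} (h : Presented k f) :
    Presented k (Sum.elim (fun _ : Unit => []) f) := by
  obtain ⟨S, hk, hS, hf⟩ := h
  refine (Presented.of_expr hk (Obj.solution S) hS.finite hS.admissible
    (e := .add .eps (S.eqn S.start)) ?_ ?_).congr ?_
  · simp [hk S.start]
  · exact ⟨trivial, hS.admissible _⟩
  · refine WIso.trans (WIso.of_eq ?_) ((WIso.refl fun _ : Unit => []).sum
      (Presented.wiso_eqn hf))
    rintro (z | z) <;> rfl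

/-- The word of the increasing permutation of length `n`. -/
def increasingWord : ℕ → List Atom
  | 0 => []
  | 1 => [.LR]
  | n + 2 => .L :: (List.replicate n .Z ++ [.R])

/-- The class of the increasing permutations and of the permutations that are obtained by
inserting entries into the permutations of a presented class is presented. -/
theorem Presented.insert {k : Kind} {X : Type} {f : X → List Atom} (h : Presented k f) :
    Presented k (Sum.elim increasingWord
      (fun p : Σ x, Inserted (f x) => insertWord p.2.1)) := by
  obtain ⟨S, hk, hS, hf⟩ := h
  let w : ∀ i, Obj S (.cls i) → Weight := fun _ => Obj.weight
  let κ := Fin 4 × S.Idx × Fin 4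
  let W : Fin 4 → Atom → Fin 4 → Expr (Option κ) := insExpr k
  let e : Expr (Option κ) := .add (.add .eps (.add (.atom .LR)
      (.mul (.atom .L) (Insertion.last.expr k))))
    (.sumFin 4 fun q => .mul (Insertion.wordsExpr k (insStart q))
      ((S.eqn S.start).transduce W q 3))
  have hX : WIso (TransducedClass.weight (insOut k) w (auxWeight k) none) (auxWeight k) :=
    WIso.refl _
  have hW := fun q a q' => wiso_insExpr k hX q a q'
  have hne : ∀ q a q', ∀ o ∈ insOut k q a q', o.1 ≠ 1 := fun _ _ _ _ => insOut_ne_one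
  have hmono : ∀ q a q', (insOut k q a q').Nonempty → q ≤ q' := fun _ _ _ => insOut_mono
  have hWa := fun q a q' => admissible_insExpr k
    (TransducedClass.weight (insOut k) w (auxWeight k)) q a q'
  have hek : e.OfKind k := by
    simp only [e, Expr.ofKind_add, Expr.ofKind_mul, Expr.ofKind_eps, Expr.ofKind_atom, true_and]
    refine ⟨Insertion.expr_ofKind k _, Expr.OfKind.sumFin fun q => ?_⟩
    rw [Expr.ofKind_mul]
    refine ⟨?_, (hk _).transduce (fun q a q' => insExpr_ofKind k q a q') q 3⟩
    cases insStart q <;> simp [Insertion.wordsExpr, Insertion.expr_ofKind]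
  refine (Presented.transduce hk hS hne hmono (insOut_finite k) (w := w) rfl
    (b := auxWeight k) ?_ hW hWa (insExpr_ofKind k) (wiso_auxEqn k hX) (admissible_auxEqn k _)
    (auxEqn_ofKind k) hek ?_).congr ?_
  · intro n
    refine (Set.finite_singleton n).subset fun x hx => ?_
    have hx' : (List.replicate x Atom.Z).length = n := hx
    simpa using hx'
  · refine ⟨⟨trivial, trivial, trivial, Insertion.admissible_expr k _ _⟩,
      Admissible.sumFin _ fun q => ⟨Insertion.admissible_wordsExpr k _ _, ?_⟩⟩
    exact Admissible.transduce hne hmono hW hWa (hS.admissible _) q 3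
  · have h₁ : WIso (fun z => (Interp.weight (TransducedClass.weight (insOut k) w (auxWeight k))
        (.add .eps (.add (.atom .LR) (.mul (.atom .L) (Insertion.last.expr k)))) z).1.toList)
        increasingWord := by
      have h₂ := (((WIso.refl fun _ : Unit => (1 : Weight)).sum
        ((WIso.refl fun _ : Unit => atomWeight .LR).sum
        ((WIso.refl fun _ : Unit => atomWeight .L).prod
          (Insertion.wiso_expr k hX .last))))).comp (fun x => x.1.toList)
      refine h₂.trans (WIso.of_bijective
        (Sum.elim (fun _ => 0) (Sum.elim (fun _ => 1) fun p => p.2.1 + 1)) ⟨?_, ?_⟩ ?_)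
      · rintro (_ | _ | ⟨_, n, hn⟩) (_ | _ | ⟨_, n', hn'⟩) h
        · rfl
        · cases h
        · cases h
        · cases h
        · rfl
        · exact absurd (Nat.succ_injective h).symm hn'
        · cases h
        · exact absurd (Nat.succ_injective h) hn
        · obtain rfl : n = n' := Nat.succ_injective h
          rfl
      · rintro (_ | _ | n)
        · exact ⟨.inl .unit, rfl⟩
        · exact ⟨.inr (.inl .unit), rfl⟩
        · exact ⟨.inr (.inr (.unit, ⟨n + 1, Nat.succ_ne_zero n⟩)), rfl⟩
      · rintro (_ | _ | ⟨_, n, hn⟩)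
        · rfl
        · rfl
        · obtain ⟨n, rfl⟩ := Nat.exists_eq_succ_of_ne_zero hn
          rfl
    have h₂ : WIso (fun z => (Interp.weight (TransducedClass.weight (insOut k) w (auxWeight k))
        (.sumFin 4 fun q => .mul (Insertion.wordsExpr k (insStart q))
          ((S.eqn S.start).transduce W q 3)) z).1.toList)
        (fun p : Σ x, Inserted (f x) => insertWord p.2.1) := by
      have h₃ := ((Interp.wiso_sumFin _ fun q => .mul (Insertion.wordsExpr k (insStart q))
        ((S.eqn S.start).transduce W q 3)).trans (WIso.sigma fun q =>
        (Insertion.wiso_wordsExpr k hX (insStart q)).prod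
          (Interp.wiso_transduce hmono hW (S.eqn S.start) q 3))).comp (fun x => x.1.toList)
      have h₄ : WIso (fun p : Σ q, Insertion.words k (insStart q) ×
            Transduced (insOut k) w (S.eqn S.start) q 3 =>
          (p.2.1.1 * Transduced.weight (insOut k) w (S.eqn S.start) p.1 3 p.2.2).1.toList)
          (fun p : Σ z, Σ q, Insertion.words k (insStart q) ×
            Run (insOut k) q (Interp.weight w (S.eqn S.start) z).1.toList 3 =>
            (p.2.2.1.1 * p.2.2.2.weight).1.toList) :=
        ⟨⟨fun p => ⟨p.2.2.1, p.1, p.2.1, p.2.2.2⟩, fun p => ⟨p.2.1, p.2.2.1, p.1, p.2.2.2⟩,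
          fun _ => rfl, fun _ => rfl⟩, fun _ => rfl⟩
      have h₅ := WIso.sigma fun z => wiso_inserted k (Interp.weight w (S.eqn S.start) z).1.toList
      have h₆ := (Presented.wiso_eqn hf).sigma_map (P := Inserted) fun _ u => insertWord u.1
      exact h₃.trans (h₄.trans (h₅.trans h₆))
    refine WIso.trans (WIso.of_eq ?_) (h₁.sum h₂)
    rintro (z | z) <;> rfl

/-! ### Generating functions of weighted sets -/

/-- The generating function of a set `X` with sizes `f`. -/
noncomputable def genSeries {X : Type} (f : X → ℕ) : PowerSeries ℂ :=
  PowerSeries.mk fun n => (Nat.card {x // f x = n} : ℂ)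

lemma genSeries_congr {X Y : Type} {f : X → ℕ} {g : Y → ℕ} (h : WIso f g) :
    genSeries f = genSeries g := by
  obtain ⟨e, he⟩ := h
  ext n
  simp only [genSeries, PowerSeries.coeff_mk]
  rw [Nat.card_congr (e.subtypeEquiv (q := fun y => g y = n) fun x => by rw [he])]

lemma genSeries_empty {X : Type} [IsEmpty X] (f : X → ℕ) : genSeries f = 0 := by
  ext n
  simp [genSeries]

lemma genSeries_unit (n : ℕ) : genSeries (fun _ : Unit => n) = PowerSeries.X ^ n := by
  ext i
  rw [genSeries, PowerSeries.coeff_mk, PowerSeries.coeff_X_pow]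
  split_ifs with h
  · subst h
    simp
  · have : IsEmpty {x : Unit // n = i} := ⟨fun x => h x.2.symm⟩
    simp

lemma genSeries_sum {X Y : Type} {f : X → ℕ} {g : Y → ℕ} (hf : ∀ n, {x | f x = n}.Finite)
    (hg : ∀ n, {x | g x = n}.Finite) : genSeries (Sum.elim f g) = genSeries f + genSeries g := by
  ext n
  simp only [genSeries, PowerSeries.coeff_mk, map_add]
  have := (hf n).to_subtype
  have := (hg n).to_subtype
  have h₁ : Finite {x // f x = n} := (hf n).to_subtype
  have h₂ : Finite {x // g x = n} := (hg n).to_subtype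
  rw [← Nat.cast_add, ← Nat.card_sum, Nat.card_congr Equiv.subtypeSum]
  rfl

lemma genSeries_prod {X Y : Type} {f : X → ℕ} {g : Y → ℕ} (hf : ∀ n, {x | f x = n}.Finite)
    (hg : ∀ n, {x | g x = n}.Finite) :
    genSeries (fun p : X × Y => f p.1 + g p.2) = genSeries f * genSeries g := by
  ext n
  rw [PowerSeries.coeff_mul]
  simp only [genSeries, PowerSeries.coeff_mk]
  have h₁ : ∀ n, Finite {x // f x = n} := fun n => (hf n).to_subtype
  have h₂ : ∀ n, Finite {x // g x = n} := fun n => (hg n).to_subtype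
  have e : {p : X × Y // f p.1 + g p.2 = n} ≃
      Σ a : Finset.HasAntidiagonal.antidiagonal n, {x // f x = a.1.1} × {y // g y = a.1.2} :=
    { toFun := fun p => ⟨⟨(f p.1.1, g p.1.2), Finset.HasAntidiagonal.mem_antidiagonal.2 p.2⟩,
        ⟨p.1.1, rfl⟩, ⟨p.1.2, rfl⟩⟩
      invFun := fun q => ⟨(q.2.1.1, q.2.2.1), by
        rw [q.2.1.2, q.2.2.2]; exact Finset.HasAntidiagonal.mem_antidiagonal.1 q.1.2⟩
      left_inv := fun _ => rfl
      right_inv := by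
        rintro ⟨⟨⟨a, b⟩, h⟩, ⟨x, hx⟩, ⟨y, hy⟩⟩
        dsimp only at hx hy
        subst hx hy
        rfl }
  rw [Nat.card_congr e, Nat.card_sigma, Nat.cast_sum]
  simp only [Nat.card_prod, Nat.cast_mul]
  exact Finset.sum_coe_sort (Finset.HasAntidiagonal.antidiagonal n)
    fun a => (Nat.card {x // f x = a.1} : ℂ) * (Nat.card {y // g y = a.2} : ℂ)

lemma genSeries_list {X : Type} {f : X → ℕ} (hf : ∀ n, {x | f x = n}.Finite)
    (hl : ∀ n, {l : List X | (l.map f).sum = n}.Finite) :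
    genSeries (fun l : List X => (l.map f).sum) * (1 - genSeries f) = 1 := by
  have h : WIso (fun l : List X => (l.map f).sum)
      (Sum.elim (fun _ : Unit => 0) (fun p : X × List X => f p.1 + (p.2.map f).sum)) := by
    refine WIso.symm ⟨⟨Sum.elim (fun _ => []) (fun p => p.1 :: p.2),
      fun l => match l with
        | [] => .inl .unit
        | x :: l => .inr (x, l), ?_, ?_⟩, ?_⟩
    · rintro (_ | p) <;> rfl
    · rintro (_ | ⟨x, l⟩) <;> rfl
    · rintro (_ | p) <;> simp
  have hp : ∀ n, {p : X × List X | f p.1 + (p.2.map f).sum = n}.Finite := fun n => by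
    refine (((Set.finite_Iic n).biUnion fun j _ => hf j).prod
      ((Set.finite_Iic n).biUnion fun j _ => hl j)).subset ?_
    rintro ⟨x, l⟩ h
    have h' : f x + (l.map f).sum = n := h
    exact ⟨Set.mem_biUnion (Set.mem_Iic.2 (by omega : f x ≤ n)) rfl,
      Set.mem_biUnion (Set.mem_Iic.2 (by omega : (l.map f).sum ≤ n)) rfl⟩
  have h₁ := genSeries_congr h
  rw [genSeries_sum (fun n => Set.toFinite _) hp, genSeries_unit, genSeries_prod hf hl,
    pow_zero] at h₁
  rw [mul_sub, mul_one, sub_eq_iff_eq_add]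
  rw [mul_comm (genSeries _) (genSeries f)]
  exact h₁

lemma genFun_eq (C : Set Permutation) : genFun C = genSeries fun π : C => (π : Permutation).1 := by
  ext n
  simp only [genFun, genSeries, PowerSeries.coeff_mk]
  rw [← Nat.card_coe_set_eq]
  refine congrArg _ (Nat.card_congr (Equiv.ofBijective
    (fun σ => ⟨⟨⟨n, σ.1⟩, σ.2⟩, rfl⟩) ⟨fun σ σ' h => ?_, ?_⟩))
  · have h' : (⟨n, σ.1⟩ : Permutation) = ⟨n, σ'.1⟩ := congrArg (fun π => π.1.1) h
    exact Subtype.ext (eq_of_heq (Sigma.mk.inj h').2)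
  · rintro ⟨⟨⟨m, σ⟩, h⟩, rfl⟩
    exact ⟨⟨σ, h⟩, rfl⟩

/-! ### Generating functions of expressions -/

section Expr

variable {ι : Type} {X : ι → Type} {w : ∀ i, X i → Weight}

/-- The generating function of the objects denoted by an expression. -/
noncomputable def exprSeries (w : ∀ i, X i → Weight) (e : Expr ι) : PowerSeries ℂ :=
  genSeries fun z : Interp X e => (Interp.weight w e z).1.length

lemma Interp.finite' (h : ∀ i n, {x : X i | (w i x).1.length = n}.Finite) {e : Expr ι}
    (he : Admissible w e) (n : ℕ) : {z | (Interp.weight w e z).1.length = n}.Finite :=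
  (Interp.finite h he n).subset fun _ => le_of_eq

lemma exprSeries_zero : exprSeries w .zero = 0 := by
  have : IsEmpty (Interp X .zero) := inferInstanceAs (IsEmpty Empty)
  exact genSeries_empty _

lemma exprSeries_eps : exprSeries w .eps = 1 := genSeries_unit 0

lemma exprSeries_atom (a : Atom) : exprSeries w (.atom a) = PowerSeries.X :=
  (genSeries_unit 1).trans (pow_one _)

variable (h : ∀ i n, {x : X i | (w i x).1.length = n}.Finite)

include h

lemma exprSeries_add {e f : Expr ι} (he : Admissible w e) (hf : Admissible w f) :
    exprSeries w (.add e f) = exprSeries w e + exprSeries w f := by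
  rw [exprSeries, exprSeries, exprSeries, ← genSeries_sum (Interp.finite' h he)
    (Interp.finite' h hf)]
  refine genSeries_congr (WIso.of_eq ?_)
  rintro (z | z) <;> rfl

lemma exprSeries_mul {e f : Expr ι} (he : Admissible w e) (hf : Admissible w f) :
    exprSeries w (.mul e f) = exprSeries w e * exprSeries w f := by
  rw [exprSeries, exprSeries, exprSeries, ← genSeries_prod (Interp.finite' h he)
    (Interp.finite' h hf)]
  exact genSeries_congr (WIso.of_eq fun p => FreeMonoid.length_mul _ _)

lemma exprSeries_seq {e : Expr ι} (he : Admissible w (.seq e)) :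
    exprSeries w (.seq e) * (1 - exprSeries w e) = 1 := by
  have hl : ∀ l : List (Interp X e), (Interp.weight w (.seq e) l).1.length =
      (l.map fun z => (Interp.weight w e z).1.length).sum := fun l => by
    induction l with
    | nil => rfl
    | cons z l ih =>
      rw [List.map_cons, List.sum_cons, ← ih]
      exact FreeMonoid.length_mul _ _
  have h₁ : exprSeries w (.seq e) =
      genSeries fun l : List (Interp X e) => (l.map fun z => (Interp.weight w e z).1.length).sum :=
    genSeries_congr (WIso.of_eq hl)
  rw [h₁]
  refine genSeries_list (Interp.finite' h he.2) fun n => ?_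
  simp only [← hl]
  exact Interp.finite' h he n

/-! ### Rationality -/

/-- The generating function of an expression without classes is rational. -/
lemma rationalSeries_of_classFree {e : Expr ι} (he : Admissible w e) (hc : e.ClassFree) :
    RationalSeries (exprSeries w e) := by
  induction e with
  | zero => exact ⟨0, 1, one_ne_zero, by simp [exprSeries_zero]⟩
  | eps => exact ⟨1, 1, one_ne_zero, by simp [exprSeries_eps]⟩
  | atom a => exact ⟨.X, 1, one_ne_zero, by simp [exprSeries_atom]⟩
  | cls i => exact hc.elim
  | add e f ihe ihf =>
    obtain ⟨p, q, hq, h₁⟩ := ihe he.1 hc.1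
    obtain ⟨p', q', hq', h₂⟩ := ihf he.2 hc.2
    refine ⟨p * q' + p' * q, q * q', mul_ne_zero hq hq', ?_⟩
    rw [exprSeries_add h he.1 he.2]
    push_cast
    linear_combination (q' : PowerSeries ℂ) * h₁ + (q : PowerSeries ℂ) * h₂
  | mul e f ihe ihf =>
    obtain ⟨p, q, hq, h₁⟩ := ihe he.1 hc.1
    obtain ⟨p', q', hq', h₂⟩ := ihf he.2 hc.2
    refine ⟨p * p', q * q', mul_ne_zero hq hq', ?_⟩
    rw [exprSeries_mul h he.1 he.2]
    push_cast
    linear_combination (q' : PowerSeries ℂ) * exprSeries w f * h₁ + (p : PowerSeries ℂ) * h₂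
  | seq e ih =>
    obtain ⟨p, q, hq, h₁⟩ := ih he.2 hc
    have h₂ := exprSeries_seq h he
    have h₃ : ((q - p : Polynomial ℂ) : PowerSeries ℂ) * exprSeries w (.seq e) = q := by
      push_cast
      linear_combination (q : PowerSeries ℂ) * h₂ + exprSeries w (.seq e) * h₁
    refine ⟨q, q - p, fun h₀ => hq ?_, h₃⟩
    rw [h₀, Polynomial.coe_zero, zero_mul] at h₃
    exact Polynomial.coe_injective ℂ (by rw [← h₃, Polynomial.coe_zero])

end Expr

lemma exprSeries_eqn {S : Spec} (i : S.Idx) :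
    exprSeries (fun i => (Obj.weight : Obj S (.cls i) → Weight)) (S.eqn i) =
      genSeries (Obj.size : Obj S (.cls i) → ℕ) := by
  have h := (Obj.solution S i).comp (fun x => x.1.length)
  simp only [← Obj.size_eq] at h
  refine (genSeries_congr (WIso.of_eq fun z => ?_)).trans (genSeries_congr h)
  simp [tick]

/-- A class whose equation refers to no class has a rational generating function. -/
theorem rationalSeries_of_regular {S : Spec} (hS : S.WellDefined) {i : S.Idx}
    (h : (S.eqn i).ClassFree) : RationalSeries (genSeries (Obj.size : Obj S (.cls i) → ℕ)) := by
  rw [← exprSeries_eqn]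
  exact rationalSeries_of_classFree hS.finite (hS.admissible i) h

/-! ### Algebraicity -/

/-- In characteristic zero, elements of a field extension whose differentials vanish in the field
that they generate are algebraic. -/
lemma isAlgebraic_of_D_eq_zero {K F ι : Type} [Field K] [Field F] [Algebra K F] [CharZero K]
    [Finite ι] (y : ι → F)
    (h : ∀ i, KaehlerDifferential.D K (IntermediateField.adjoin K (Set.range y))
      ⟨y i, IntermediateField.subset_adjoin K _ ⟨i, rfl⟩⟩ = 0) (i : ι) : IsAlgebraic K (y i) := by
  set L := IntermediateField.adjoin K (Set.range y)
  have hfg : Algebra.EssFiniteType K L :=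
    IntermediateField.essFiniteType_iff.2
      ((IntermediateField.fg_def).2 ⟨Set.range y, Set.finite_range y, rfl⟩)
  have hD : ∀ x (hx : x ∈ L), KaehlerDifferential.D K L ⟨x, hx⟩ = 0 := by
    intro x hx
    induction hx using IntermediateField.adjoin_induction with
    | mem x hx =>
      obtain ⟨i, rfl⟩ := hx
      exact h i
    | algebraMap x => exact (KaehlerDifferential.D K L).map_algebraMap x
    | add x y hx hy h₁ h₂ =>
      have : (⟨x + y, add_mem hx hy⟩ : L) = ⟨x, hx⟩ + ⟨y, hy⟩ := rfl
      rw [this, map_add, h₁, h₂, add_zero]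
    | inv x hx h₁ =>
      have : (⟨x⁻¹, inv_mem hx⟩ : L) = ⟨x, hx⟩⁻¹ := rfl
      rw [this, Derivation.leibniz_inv, h₁, smul_zero]
    | mul x y hx hy h₁ h₂ =>
      have : (⟨x * y, mul_mem hx hy⟩ : L) = ⟨x, hx⟩ * ⟨y, hy⟩ := rfl
      rw [this, Derivation.leibniz, h₁, h₂, smul_zero, smul_zero, add_zero]
  have hsub : Subsingleton (Ω[L⁄K]) := by
    rw [← Submodule.subsingleton_iff L, ← subsingleton_iff_bot_eq_top,
      ← KaehlerDifferential.span_range_derivation]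
    symm
    rw [Submodule.span_eq_bot]
    rintro _ ⟨x, rfl⟩
    exact hD x.1 x.2
  have : Algebra.FormallyUnramified K L :=
    (Algebra.formallyUnramified_iff K L).2 hsub
  have : Algebra.IsSeparable K L := Algebra.FormallyUnramified.isSeparable K L
  have h₁ := Algebra.IsAlgebraic.isAlgebraic (R := K)
    (⟨y i, IntermediateField.subset_adjoin K _ ⟨i, rfl⟩⟩ : L)
  exact h₁.algebraMap (A := F)

/-- If `1 - N` is invertible and `d = N d`, then `d = 0`. -/
lemma eq_zero_of_eq_sum {L M ι : Type} [Field L] [AddCommGroup M] [Module L M] [Fintype ι]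
    [DecidableEq ι] (N : Matrix ι ι L) (hN : (1 - N).det ≠ 0) (d : ι → M)
    (h : ∀ i, d i = ∑ j, N i j • d j) (k : ι) : d k = 0 := by
  have h₁ : ∀ i, ∑ j, (1 - N) i j • d j = 0 := fun i => by
    simp only [Matrix.sub_apply, sub_smul, Finset.sum_sub_distrib, ← h, Matrix.one_apply,
      ite_smul, one_smul, zero_smul, Finset.sum_ite_eq, Finset.mem_univ, if_true, sub_self]
  have h₂ : ∑ j, ((1 - N).adjugate * (1 - N)) k j • d j = 0 := by
    simp only [Matrix.mul_apply, Finset.sum_smul, mul_smul]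
    rw [Finset.sum_comm]
    simp only [← Finset.smul_sum, h₁, smul_zero, Finset.sum_const_zero]
  rw [Matrix.adjugate_mul] at h₂
  simp only [Matrix.smul_apply, Matrix.one_apply, smul_eq_mul, mul_ite, mul_one, mul_zero,
    ite_smul, zero_smul, Finset.sum_ite_eq, Finset.mem_univ, if_true] at h₂
  exact (smul_eq_zero.1 h₂).resolve_left hN

/-- A matrix whose nonzero entries strictly decrease a rank is nilpotent, so `1 - N` is
invertible. -/
lemma det_one_sub_ne_zero {ι : Type} [Fintype ι] [DecidableEq ι] (N : Matrix ι ι ℂ) (rank : ι → ℕ)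
    (h : ∀ i j, N i j ≠ 0 → rank j < rank i) : (1 - N).det ≠ 0 := by
  intro h₀
  obtain ⟨v, hv, hNv⟩ := Matrix.exists_mulVec_eq_zero_iff.2 h₀
  refine hv (funext fun i => ?_)
  induction hr : rank i using Nat.strong_induction_on generalizing i with
  | _ r ih =>
    have h₁ := congrFun hNv i
    rw [Matrix.sub_mulVec, Matrix.one_mulVec, Pi.sub_apply, Pi.zero_apply, sub_eq_zero] at h₁
    rw [h₁]
    refine Finset.sum_eq_zero fun j _ => ?_
    change N i j * v j = 0
    by_cases hij : N i j = 0
    · rw [hij, zero_mul]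
    · rw [show v j = 0 from ih _ (hr ▸ h i j hij) j rfl, mul_zero]

open Classical in
/-- The partial derivative of an expression with respect to the class `j`, evaluated at the
generating functions of the classes. -/
noncomputable def exprDeriv {ι : Type} {X : ι → Type} (w : ∀ i, X i → Weight) (j : ι) :
    Expr ι → PowerSeries ℂ
  | .zero => 0
  | .eps => 0
  | .atom _ => 0
  | .cls i => if i = j then 1 else 0
  | .add e f => exprDeriv w j e + exprDeriv w j f
  | .mul e f => exprSeries w e * exprDeriv w j f + exprSeries w f * exprDeriv w j e
  | .seq e => exprSeries w (.seq e) ^ 2 * exprDeriv w j e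

lemma exists_of_constantCoeff_ne_zero {X : Type} {f : X → ℕ}
    (h : PowerSeries.constantCoeff (genSeries f) ≠ 0) : ∃ x, f x = 0 := by
  rw [← PowerSeries.coeff_zero_eq_constantCoeff_apply, genSeries, PowerSeries.coeff_mk,
    Nat.cast_ne_zero] at h
  obtain ⟨⟨x, hx⟩⟩ := (Nat.card_ne_zero.1 h).1
  exact ⟨x, hx⟩

/-- If the partial derivative with respect to the class `j` has a nonzero constant term, then an
object of the class `j` can be completed by objects of size zero to an object that is denoted by
the expression. -/
lemma exists_of_exprDeriv_ne_zero {ι : Type} {X : ι → Type} {w : ∀ i, X i → Weight} {j : ι}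
    {e : Expr ι} (h : PowerSeries.constantCoeff (exprDeriv w j e) ≠ 0) (x : X j) :
    ∃ z, (Interp.weight w e z).1.length = (w j x).1.length ∧
      (w j x).2.toAdd ≤ (Interp.weight w e z).2.toAdd := by
  induction e with
  | zero => simp [exprDeriv] at h
  | eps => simp [exprDeriv] at h
  | atom a => simp [exprDeriv] at h
  | cls i =>
    by_cases hij : i = j
    · subst hij
      exact ⟨x, rfl, le_rfl⟩
    · simp [exprDeriv, hij] at h
  | add e f ihe ihf =>
    rw [exprDeriv, map_add] at h
    by_cases he : PowerSeries.constantCoeff (exprDeriv w j e) = 0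
    · rw [he, zero_add] at h
      obtain ⟨z, hz⟩ := ihf h
      exact ⟨Sum.inr z, hz⟩
    · obtain ⟨z, hz⟩ := ihe he
      exact ⟨Sum.inl z, hz⟩
  | mul e f ihe ihf =>
    rw [exprDeriv, map_add, map_mul, map_mul] at h
    by_cases he : PowerSeries.constantCoeff (exprSeries w e) *
        PowerSeries.constantCoeff (exprDeriv w j f) = 0
    · rw [he, zero_add] at h
      obtain ⟨z, hz⟩ := exists_of_constantCoeff_ne_zero (left_ne_zero_of_mul h)
      obtain ⟨z', hz', hz''⟩ := ihe (right_ne_zero_of_mul h)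
      refine ⟨Prod.mk z' z, ?_, ?_⟩
      · change (Interp.weight w e z' * Interp.weight w f z).1.length = _
        rw [Prod.fst_mul, FreeMonoid.length_mul, hz, hz', add_zero]
      · exact hz''.trans (Nat.le_add_right _ _)
    · obtain ⟨z, hz⟩ := exists_of_constantCoeff_ne_zero (left_ne_zero_of_mul he)
      obtain ⟨z', hz', hz''⟩ := ihf (right_ne_zero_of_mul he)
      refine ⟨Prod.mk z z', ?_, ?_⟩
      · change (Interp.weight w e z * Interp.weight w f z').1.length = _
        rw [Prod.fst_mul, FreeMonoid.length_mul, hz, hz', zero_add]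
      · exact hz''.trans (Nat.le_add_left _ _)
  | seq e ih =>
    rw [exprDeriv, map_mul] at h
    obtain ⟨z, hz, hz'⟩ := ih (right_ne_zero_of_mul h)
    have : Interp.weight w (.seq e) (List.cons z List.nil) = Interp.weight w e z := mul_one _
    refine ⟨List.cons z List.nil, ?_⟩
    rw [this]
    exact ⟨hz, hz'⟩

section Algebraic

variable {S : Spec} (hS : S.WellDefined)

/-- The weights of the objects of the classes of a specification. -/
abbrev Spec.weight (S : Spec) (i : S.Idx) : Obj S (.cls i) → Weight := Obj.weight

/-- The largest number of ticks of an object of size `n` of the class `i`. -/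
noncomputable def maxTicks (i : S.Idx) (n : ℕ) : ℕ :=
  (hS.finite i n).toFinset.sup fun x => x.weight.2.toAdd

lemma maxTicks_lt {i j : S.Idx} (h : PowerSeries.constantCoeff
    (exprDeriv S.weight j (S.eqn i)) ≠ 0) (x : Obj S (.cls j)) :
    ∃ y : Obj S (.cls i), y.weight.1.length = x.weight.1.length ∧
      x.weight.2.toAdd < y.weight.2.toAdd := by
  obtain ⟨z, hz, hz'⟩ := exists_of_exprDeriv_ne_zero h x
  obtain ⟨e, he⟩ := Obj.solution S i
  refine ⟨e z, ?_⟩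
  rw [he]
  refine ⟨by simpa [tick] using hz, ?_⟩
  simp only [tick, Prod.snd_mul, toAdd_mul, toAdd_ofAdd]
  exact Nat.lt_of_lt_of_le (Nat.lt_succ_self _) (by rw [add_comm]; exact Nat.succ_le_succ hz')

include hS in
/-- There is a rank of the classes that decreases along the nonzero constant terms of the Jacobian
matrix: otherwise there would be infinitely many objects of the same size. -/
lemma exists_rank : ∃ rank : S.Idx → ℕ, ∀ i j, Nonempty (Obj S (.cls j)) →
    PowerSeries.constantCoeff (exprDeriv S.weight j (S.eqn i)) ≠ 0 → rank j < rank i := by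
  classical
  have := S.finite_idx
  have := Fintype.ofFinite S.Idx
  let s : S.Idx → ℕ := fun i => if h : Nonempty (Obj S (.cls i)) then h.some.weight.1.length else 0
  refine ⟨fun i => ∑ l, maxTicks hS i (s l), fun i j hj h => ?_⟩
  have hlt : ∀ (n : ℕ) (x : Obj S (.cls j)), x.weight.1.length = n →
      x.weight.2.toAdd < maxTicks hS i n := fun n x hx => by
    obtain ⟨y, hy, hxy⟩ := maxTicks_lt h x
    exact hxy.trans_le (Finset.le_sup (f := fun x : Obj S (.cls i) => x.weight.2.toAdd)
      ((hS.finite i n).mem_toFinset.2 (hy.trans hx)))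
  refine Finset.sum_lt_sum (fun l _ => ?_) ⟨j, Finset.mem_univ j, ?_⟩
  · exact Finset.sup_le fun x hx => (hlt _ x ((hS.finite j _).mem_toFinset.1 hx)).le
  · have hs : hj.some.weight.1.length = s j := by simp only [s, dif_pos hj]
    rw [maxTicks, Finset.sup_lt_iff]
    · exact fun x hx => hlt _ x ((hS.finite j _).mem_toFinset.1 hx)
    · exact (Nat.zero_le _).trans_lt (hlt _ _ hs)

/-- The chain rule for the generating function of an expression. -/
lemma exists_deriv {K F : Type} [Field K] [Field F] [Algebra K F] (φ : PowerSeries ℂ →+* F)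
    (hφ : ∃ x : K, algebraMap K F x = φ PowerSeries.X) (L : IntermediateField K F) {ι : Type}
    [Fintype ι] {X : ι → Type} {w : ∀ i, X i → Weight}
    (hfin : ∀ i n, {x : X i | (w i x).1.length = n}.Finite) (y : ι → L)
    (hy : ∀ i, (y i : F) = φ (exprSeries w (.cls i))) {M : Type} [AddCommGroup M] [Module K M]
    [Module L M] [IsScalarTower K L M] (D : Derivation K L M) {e : Expr ι} (he : Admissible w e) :
    ∃ (G : L) (J : ι → L), (G : F) = φ (exprSeries w e) ∧
      (∀ j, (J j : F) = φ (exprDeriv w j e)) ∧ D G = ∑ j, J j • D (y j) := by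
  classical
  induction e with
  | zero => exact ⟨0, 0, by simp [exprSeries_zero], by simp [exprDeriv], by simp⟩
  | eps => exact ⟨1, 0, by simp [exprSeries_eps], by simp [exprDeriv], by simp⟩
  | atom a =>
    obtain ⟨x, hx⟩ := hφ
    refine ⟨algebraMap K L x, 0, ?_, by simp [exprDeriv], by simp⟩
    rw [exprSeries_atom, ← hx]
    rfl
  | cls i =>
    refine ⟨y i, fun j => if i = j then 1 else 0, hy i, fun j => ?_, by simp⟩
    simp only [exprDeriv]
    split_ifs <;> simp
  | add e f ihe ihf =>
    obtain ⟨G, J, hG, hJ, hD⟩ := ihe he.1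
    obtain ⟨G', J', hG', hJ', hD'⟩ := ihf he.2
    refine ⟨G + G', J + J', ?_, fun j => ?_, ?_⟩
    · simp [exprSeries_add hfin he.1 he.2, hG, hG']
    · simp [exprDeriv, hJ, hJ']
    · simp [hD, hD', add_smul, Finset.sum_add_distrib]
  | mul e f ihe ihf =>
    obtain ⟨G, J, hG, hJ, hD⟩ := ihe he.1
    obtain ⟨G', J', hG', hJ', hD'⟩ := ihf he.2
    refine ⟨G * G', fun j => G * J' j + G' * J j, ?_, fun j => ?_, ?_⟩
    · simp [exprSeries_mul hfin he.1 he.2, hG, hG']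
    · simp [exprDeriv, hJ, hJ', hG, hG']
    · simp [hD, hD', add_smul, Finset.sum_add_distrib, mul_smul, Finset.smul_sum]
  | seq e ih =>
    obtain ⟨G, J, hG, hJ, hD⟩ := ih he.2
    have h₁ : φ (exprSeries w (.seq e)) * (1 - φ (exprSeries w e)) = 1 := by
      rw [← map_one φ, ← map_sub, ← map_mul, exprSeries_seq hfin he]
    have h₂ : ((1 - G)⁻¹ : L) = φ (exprSeries w (.seq e)) := by
      push_cast
      rw [hG]
      exact (eq_inv_of_mul_eq_one_left h₁).symm
    refine ⟨(1 - G)⁻¹, fun j => (1 - G)⁻¹ ^ 2 * J j, h₂, fun j => ?_, ?_⟩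
    · rw [exprDeriv, map_mul, map_pow, ← h₂, ← hJ]
      push_cast
      rfl
    · rw [Derivation.leibniz_inv, map_sub, Derivation.map_one_eq_zero, zero_sub, smul_neg, neg_smul,
        neg_neg, hD, Finset.smul_sum]
      simp only [mul_smul]

include hS in
/-- The generating functions of the classes of a well-defined specification are algebraic. -/
theorem algebraicSeries_of_wellDefined (i : S.Idx) :
    AlgebraicSeries (genSeries (Obj.size : Obj S (.cls i) → ℕ)) := by
  classical
  have := S.finite_idx
  have := Fintype.ofFinite S.Idx
  let K := FractionRing (Polynomial ℂ)
  let F := FractionRing (PowerSeries ℂ)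
  have hinj : Function.Injective (algebraMap (Polynomial ℂ) F) := by
    rw [IsScalarTower.algebraMap_eq (Polynomial ℂ) (PowerSeries ℂ) F]
    exact (IsFractionRing.injective (PowerSeries ℂ) F).comp (Polynomial.coe_injective ℂ)
  have : FaithfulSMul (Polynomial ℂ) F := (faithfulSMul_iff_algebraMap_injective _ _).2 hinj
  let : Algebra K F := FractionRing.liftAlgebra (Polynomial ℂ) F
  have : IsScalarTower (Polynomial ℂ) K F := FractionRing.isScalarTower_liftAlgebra _ _
  have : CharZero K := charZero_of_injective_algebraMap (IsFractionRing.injective (Polynomial ℂ) K)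
  let φ : PowerSeries ℂ →+* F := algebraMap (PowerSeries ℂ) F
  let g : S.Idx → PowerSeries ℂ := fun i => exprSeries S.weight (.cls i)
  have hg : ∀ i, g i = exprSeries S.weight (S.eqn i) := fun i => by
    rw [exprSeries_eqn]
    exact genSeries_congr (WIso.of_eq fun x => x.size_eq.symm)
  have hgi : genSeries (Obj.size : Obj S (.cls i) → ℕ) = g i := by rw [hg, exprSeries_eqn]
  let y : S.Idx → F := fun i => φ (g i)
  let L := IntermediateField.adjoin K (Set.range y)
  let yL : S.Idx → L := fun i => ⟨y i, IntermediateField.subset_adjoin K _ ⟨i, rfl⟩⟩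
  have hφ : ∃ x : K, algebraMap K F x = φ PowerSeries.X := by
    refine ⟨algebraMap (Polynomial ℂ) K .X, ?_⟩
    rw [← IsScalarTower.algebraMap_apply, IsScalarTower.algebraMap_apply _ (PowerSeries ℂ) F]
    exact congrArg φ Polynomial.coe_X
  choose G J hG hJ hD using fun i => exists_deriv φ hφ L hS.finite yL (fun _ => rfl)
    (KaehlerDifferential.D K L) (hS.admissible i)
  have hGy : ∀ i, G i = yL i := fun i => Subtype.ext ((hG i).trans (congrArg φ (hg i).symm))
  simp only [hGy] at hD
  -- classes without objects are removed from the Jacobian matrix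
  let N : Matrix S.Idx S.Idx L := fun i j => if Nonempty (Obj S (.cls j)) then J i j else 0
  let N' : Matrix S.Idx S.Idx (PowerSeries ℂ) := fun i j =>
    if Nonempty (Obj S (.cls j)) then exprDeriv S.weight j (S.eqn i) else 0
  obtain ⟨rank, hrank⟩ := exists_rank hS
  have hN' : (1 - N').det ≠ 0 := fun h₀ => by
    refine det_one_sub_ne_zero (N'.map PowerSeries.constantCoeff) rank (fun i j hij => ?_) ?_
    · by_cases hj : Nonempty (Obj S (.cls j))
      · have h₁ : N' i j = exprDeriv S.weight j (S.eqn i) := if_pos hj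
        rw [Matrix.map_apply, h₁] at hij
        exact hrank i j hj hij
      · have h₁ : N' i j = 0 := if_neg hj
        rw [Matrix.map_apply, h₁, map_zero] at hij
        exact absurd rfl hij
    · have h₁ := RingHom.map_det (PowerSeries.constantCoeff (R := ℂ)) (1 - N')
      rw [h₀, map_zero, map_sub, map_one] at h₁
      exact h₁.symm
  have hN : (1 - N).det ≠ 0 := fun h₀ => by
    refine hN' (IsFractionRing.injective (PowerSeries ℂ) F ?_)
    have h₁ := RingHom.map_det (algebraMap L F) (1 - N)
    have h₂ := RingHom.map_det φ (1 - N')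
    have h₃ : (algebraMap L F).mapMatrix (1 - N) = φ.mapMatrix (1 - N') := by
      rw [map_sub, map_sub, map_one, map_one]
      congr 1
      ext i j
      change algebraMap L F (if _ then _ else _) = φ (if _ then _ else _)
      split_ifs
      · exact hJ i j
      · simp
    rw [map_zero]
    refine h₂.trans ?_
    rw [← h₃, ← h₁, h₀, map_zero]
  have hd : ∀ i, KaehlerDifferential.D K L (yL i) = 0 := by
    refine eq_zero_of_eq_sum N hN _ fun i => (hD i).trans (Finset.sum_congr rfl fun j _ => ?_)
    simp only [N]
    split_ifs with hj
    · rfl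
    · have : IsEmpty (Interp (fun i => Obj S (.cls i)) (.cls j)) :=
        not_nonempty_iff.1 hj
      have h₀ : yL j = 0 := Subtype.ext (by
        change φ (genSeries _) = 0
        rw [genSeries_empty, map_zero])
      rw [h₀, map_zero, smul_zero, smul_zero]
  have h₁ : IsAlgebraic K (y i) := isAlgebraic_of_D_eq_zero y hd i
  have h₂ : IsAlgebraic (Polynomial ℂ) (y i) :=
    (IsFractionRing.isAlgebraic_iff (Polynomial ℂ) K F).2 h₁
  rw [hgi]
  exact (isAlgebraic_algebraMap_iff (IsFractionRing.injective (PowerSeries ℂ) F)).1 h₂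

end Algebraic

/-! ### Patterns -/

/-- The entries of `π` in the positions in `P` are order-isomorphic to `σ`. -/
def IsPattern (π : Permutation) (P : Set (Fin π.1)) (σ : Permutation) : Prop :=
  ∃ f : Fin σ.1 ↪o Fin π.1, Set.range f = P ∧ IsOccurrence σ π f

lemma exists_isPattern (π : Permutation) (P : Set (Fin π.1)) : ∃ σ, IsPattern π P σ := by
  classical
  set s : Finset (Fin π.1) := P.toFinite.toFinset
  set f := s.orderEmbOfFin rfl
  have hinj : Function.Injective fun a => π.2 (f a) := π.2.injective.comp f.injective
  have hc : (s.image π.2).card = s.card := Finset.card_image_of_injective _ π.2.injective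
  -- the rank of an entry among the chosen entries
  set e := (s.image π.2).orderIsoOfFin hc
  have hm : ∀ a, π.2 (f a) ∈ s.image π.2 := fun a =>
    Finset.mem_image_of_mem _ (s.orderEmbOfFin_mem rfl a)
  have hg : Function.Injective fun a => e.symm ⟨π.2 (f a), hm a⟩ := fun a b h =>
    hinj (congrArg Subtype.val (e.symm.injective h))
  refine ⟨⟨s.card, Equiv.ofBijective _ ((Finite.injective_iff_bijective).1 hg)⟩, f, ?_, ?_⟩
  · exact (Finset.range_orderEmbOfFin s rfl).trans P.toFinite.coe_toFinset
  · intro a b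
    exact e.symm.lt_iff_lt (x := ⟨π.2 (f a), hm a⟩) (y := ⟨π.2 (f b), hm b⟩)

lemma perm_eq_of_lt_iff {n : ℕ} {σ τ : Equiv.Perm (Fin n)}
    (h : ∀ a b, σ a < σ b ↔ τ a < τ b) : σ = τ := by
  have hm : StrictMono (σ.symm.trans τ) := fun a b hab => by
    simpa [← h] using hab
  have : σ.symm.trans τ = Equiv.refl _ := by
    have h' := hm.range_inj (strictMono_id (α := Fin n))
    simp only [Equiv.range_eq_univ, Set.range_id, true_iff] at h'
    exact Equiv.coe_fn_injective h'
  ext a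
  have := congrArg (fun e : Equiv.Perm (Fin n) => e (σ a)) this
  simpa using congrArg Fin.val this.symm

lemma IsPattern.unique {π : Permutation} {P : Set (Fin π.1)} {σ τ : Permutation}
    (hσ : IsPattern π P σ) (hτ : IsPattern π P τ) : σ = τ := by
  obtain ⟨f, hf, hfo⟩ := hσ
  obtain ⟨g, hg, hgo⟩ := hτ
  obtain ⟨m, σ⟩ := σ
  obtain ⟨n, τ⟩ := τ
  have hmn : m = n := by
    have h₁ := Set.ncard_range_of_injective f.injective
    have h₂ := Set.ncard_range_of_injective g.injective
    rw [hf] at h₁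
    rw [hg] at h₂
    simpa using h₁.symm.trans h₂
  subst hmn
  have hfg : f = g := DFunLike.coe_injective ((f.strictMono.range_inj g.strictMono).1 (hf.trans hg.symm))
  subst hfg
  congr 1
  exact perm_eq_of_lt_iff fun a b => (hfo a b).trans (hgo a b).symm

/-- Patterns of a pattern. -/
lemma isPattern_image {π σ : Permutation} {f : Fin σ.1 ↪o Fin π.1} (hf : IsOccurrence σ π f)
    (Q : Set (Fin σ.1)) (τ : Permutation) : IsPattern π (f '' Q) τ ↔ IsPattern σ Q τ := by
  have h : ∀ τ, IsPattern σ Q τ → IsPattern π (f '' Q) τ := by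
    rintro τ ⟨g, hg, hgo⟩
    refine ⟨g.trans f, ?_, fun a b => (hgo a b).trans (hf _ _)⟩
    rw [← hg, ← Set.range_comp]
    rfl
  refine ⟨fun hτ => ?_, h τ⟩
  obtain ⟨τ', hτ'⟩ := exists_isPattern σ Q
  rwa [hτ.unique (h τ' hτ')]

lemma IsPattern.contains_of_subset {π : Permutation} {P Q : Set (Fin π.1)} {σ τ : Permutation}
    (hσ : IsPattern π P σ) (hτ : IsPattern π Q τ) (h : Q ⊆ P) : Contains σ τ := by
  obtain ⟨f, hf, hfo⟩ := hσ
  have hQ : f '' (f ⁻¹' Q) = Q := Set.image_preimage_eq_of_subset (hf ▸ h)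
  rw [← hQ, isPattern_image hfo] at hτ
  obtain ⟨g, -, hg⟩ := hτ
  exact ⟨g, hg⟩

lemma eq_emptyPerm {π : Permutation} (h : π.1 = 0) : π = emptyPerm := by
  obtain ⟨n, π⟩ := π
  obtain rfl : n = 0 := h
  exact Sigma.ext rfl (heq_of_eq (Subsingleton.elim π 1))

lemma isPattern_univ (π : Permutation) : IsPattern π Set.univ π :=
  ⟨RelEmbedding.refl _, Set.range_id, fun _ _ => Iff.rfl⟩

/-! ### Closure under containment -/

/-- A set of permutations that contains the empty permutation and is closed under containment. -/
structure IsClosed (A : Set Permutation) : Prop where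
  empty_mem : emptyPerm ∈ A
  mem_of_contains {π σ : Permutation} : π ∈ A → Contains π σ → σ ∈ A

lemma Contains.trans {π σ τ : Permutation} (h : Contains π σ) (h' : Contains σ τ) :
    Contains π τ := by
  obtain ⟨f, hf⟩ := h
  obtain ⟨g, hg⟩ := h'
  exact ⟨g.trans f, fun a b => (hg a b).trans (hf _ _)⟩

lemma IsPermClass.isClosed {C : Set Permutation} (hC : IsPermClass C) :
    IsClosed (C ∪ {emptyPerm}) where
  empty_mem := .inr rfl
  mem_of_contains {π σ} hπ h := by
    by_cases hσ : σ = emptyPerm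
    · exact .inr hσ
    · rcases hπ with hπ | rfl
      · exact .inl (hC π hπ σ h hσ)
      · obtain ⟨n, σ⟩ := σ
        obtain ⟨f, -⟩ := h
        cases n with
        | zero => exact absurd (eq_emptyPerm rfl) hσ
        | succ n => exact (f 0).elim0

lemma isPermClass_av (β : Permutation) : IsPermClass (Av β) :=
  fun _ hπ _ h _ h' => hπ (h.trans h')

lemma isClosed_gridClass {k : ℕ} {cell : Fin k → Set Permutation} (hk : 0 < k)
    (h : ∀ i, IsPermClass (cell i)) : IsClosed (gridClass cell) where
  empty_mem := by
    refine ⟨fun _ => ⟨0, hk⟩, fun _ _ _ => le_rfl, fun i => ⟨emptyPerm, .inr rfl, ?_⟩⟩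
    exact ⟨RelEmbedding.refl _, Set.ext fun a => a.elim0, fun a => a.elim0⟩
  mem_of_contains := by
    rintro π τ ⟨col, hcol, hp⟩ ⟨f, hf⟩
    refine ⟨fun a => col (f a), hcol.comp f.monotone, fun i => ?_⟩
    obtain ⟨σ, hσ, hp⟩ := hp i
    obtain ⟨ρ, hρ⟩ := exists_isPattern τ {a | col (f a) = i}
    have hρ' := (isPattern_image hf _ _).2 hρ
    refine ⟨ρ, (h i).isClosed.mem_of_contains hσ (IsPattern.contains_of_subset hp hρ' ?_), hρ⟩
    rintro _ ⟨a, ha, rfl⟩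
    exact ha

/-! ### Splitting off the last cell -/

/-- The permutations that consist of the pattern of a permutation in `A`, followed by the pattern
of a permutation in `D ∪ {ε}`. -/
def append (A D : Set Permutation) : Set Permutation :=
  {π | ∃ P : Set (Fin π.1), IsLowerSet P ∧ (∃ σ ∈ A, IsPattern π P σ) ∧
    ∃ τ ∈ D ∪ {emptyPerm}, IsPattern π Pᶜ τ}

lemma gridClass_succ {k : ℕ} (cell : Fin (k + 1) → Set Permutation) :
    gridClass cell = append (gridClass fun i : Fin k => cell i.castSucc) (cell (Fin.last k)) := by
  ext π
  constructor
  · rintro ⟨col, hcol, hp⟩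
    obtain ⟨σ, f, hf, hfo⟩ := exists_isPattern π {p | col p ≠ Fin.last k}
    have hcf : ∀ a, col (f a) ≠ Fin.last k := fun a => by
      have : f a ∈ Set.range f := ⟨a, rfl⟩
      rwa [hf] at this
    refine ⟨{p | col p ≠ Fin.last k}, ?_, ⟨σ, ?_, f, hf, hfo⟩, ?_⟩
    · intro p q hqp hp hq
      exact hp (Fin.last_le_iff.1 (hq ▸ hcol hqp))
    · refine ⟨fun a => (col (f a)).castPred (hcf a), fun a b hab => ?_, fun i => ?_⟩
      · exact Fin.castPred_le_castPred_iff.2 (hcol (f.monotone hab))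
      · obtain ⟨τ, hτ, hp⟩ := hp i.castSucc
        refine ⟨τ, hτ, (isPattern_image hfo _ _).1 ?_⟩
        convert (show IsPattern π _ τ from hp)
        ext p
        constructor
        · rintro ⟨a, ha, rfl⟩
          rw [Set.mem_ofPred_eq] at ha ⊢
          rw [← ha, Fin.castSucc_castPred]
        · intro h
          have hp : p ∈ Set.range f := by
            rw [hf]
            exact fun h' => Fin.castSucc_ne_last i (h.symm.trans h')
          obtain ⟨a, rfl⟩ := hp
          refine ⟨a, ?_, rfl⟩
          rw [Set.mem_ofPred_eq] at h ⊢
          simp only [h, Fin.castPred_castSucc]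
    · obtain ⟨τ, hτ, hp⟩ := hp (Fin.last k)
      refine ⟨τ, hτ, ?_⟩
      convert (show IsPattern π _ τ from hp)
      ext p
      simp
  · classical
    rintro ⟨P, hP, ⟨σ, ⟨col, hcol, hp⟩, f, hf, hfo⟩, τ, hτ, hτp⟩
    have hmem : ∀ {p}, p ∈ P → ∃ a, f a = p := fun h => by rwa [← hf] at h
    have hfP : ∀ a, f a ∈ P := fun a => hf ▸ ⟨a, rfl⟩
    set col' : Fin π.1 → Fin (k + 1) := fun p =>
      if h : p ∈ P then (col (hmem h).choose).castSucc else Fin.last k with hcol'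
    have h₁ : ∀ a, col' (f a) = (col a).castSucc := fun a => by
      have h := (hmem (hfP a)).choose_spec
      simp only [hcol', dif_pos (hfP a), f.injective h]
    have h₂ : ∀ {p}, p ∉ P → col' p = Fin.last k := fun h => dif_neg h
    refine ⟨col', fun p q hpq => ?_, fun i => ?_⟩
    · by_cases hq : q ∈ P
      · obtain ⟨b, rfl⟩ := hmem hq
        obtain ⟨a, rfl⟩ := hmem (hP hpq hq)
        rw [h₁, h₁]
        exact Fin.castSucc_le_castSucc_iff.2 (hcol (f.le_iff_le.1 hpq))
      · rw [h₂ hq]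
        exact Fin.le_last _
    · induction i using Fin.lastCases with
      | last =>
        refine ⟨τ, hτ, ?_⟩
        change IsPattern π _ τ
        convert hτp
        ext p
        refine ⟨fun h hp => ?_, h₂⟩
        obtain ⟨a, rfl⟩ := hmem hp
        exact Fin.castSucc_ne_last _ ((h₁ a).symm.trans h)
      | cast i =>
        obtain ⟨ρ, hρ, hp⟩ := hp i
        refine ⟨ρ, hρ, ?_⟩
        change IsPattern π _ ρ
        convert (isPattern_image hfo _ _).2 (show IsPattern σ _ ρ from hp)
        ext p
        constructor
        · intro h
          have hp : p ∈ P := by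
            by_contra hp
            exact Fin.castSucc_ne_last i (h.symm.trans (h₂ hp))
          obtain ⟨a, rfl⟩ := hmem hp
          exact ⟨a, Fin.castSucc_injective _ ((h₁ a).symm.trans h), rfl⟩
        · rintro ⟨a, ha, rfl⟩
          exact (h₁ a).trans (congrArg _ ha)

/-! ### Symmetries -/

/-- The reversal of a permutation. -/
def rev (π : Permutation) : Permutation := ⟨π.1, Fin.revPerm.trans π.2⟩

/-- The complement of a permutation. -/
def comp (π : Permutation) : Permutation := ⟨π.1, π.2.trans Fin.revPerm⟩

lemma rev_rev (π : Permutation) : rev (rev π) = π := by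
  refine Sigma.ext rfl (heq_of_eq (Equiv.ext fun a => ?_))
  exact congrArg π.2 (Fin.rev_rev a)

lemma comp_comp (π : Permutation) : comp (comp π) = π := by
  exact Sigma.ext rfl (heq_of_eq (Equiv.ext fun a => Fin.rev_rev (π.2 a)))

lemma IsPattern.rev {π σ : Permutation} {P : Set (Fin π.1)} (h : IsPattern π P σ) :
    IsPattern (rev π) (Fin.rev '' P) (rev σ) := by
  obtain ⟨f, hf, hfo⟩ := h
  let g : Fin σ.1 ↪o Fin π.1 :=
    OrderEmbedding.ofStrictMono (fun a => (f a.rev).rev)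
      fun a b hab => Fin.rev_lt_rev.2 (f.strictMono (Fin.rev_lt_rev.2 hab))
  refine ⟨g, ?_, fun a b => ?_⟩
  · change Set.range (Fin.rev ∘ f ∘ Fin.rev) = _
    rw [Set.range_comp, Set.range_comp, Fin.rev_surjective.range_eq, Set.image_univ, hf]
    rfl
  · change _ ↔ π.2 (Fin.rev (Fin.rev (f a.rev))) < π.2 (Fin.rev (Fin.rev (f b.rev)))
    rw [Fin.rev_rev, Fin.rev_rev]
    exact hfo a.rev b.rev

lemma IsPattern.comp {π σ : Permutation} {P : Set (Fin π.1)} (h : IsPattern π P σ) :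
    IsPattern (comp π) P (comp σ) := by
  obtain ⟨f, hf, hfo⟩ := h
  refine ⟨f, hf, fun a b => ?_⟩
  exact Fin.rev_lt_rev.trans ((hfo b a).trans Fin.rev_lt_rev.symm)

lemma Contains.rev {π σ : Permutation} (h : Contains π σ) : Contains (rev π) (rev σ) := by
  obtain ⟨f, hf⟩ := h
  obtain ⟨g, -, hg⟩ := IsPattern.rev ⟨f, rfl, hf⟩
  exact ⟨g, hg⟩

lemma Contains.comp {π σ : Permutation} (h : Contains π σ) : Contains (comp π) (comp σ) := by
  obtain ⟨f, hf⟩ := h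
  obtain ⟨g, -, hg⟩ := IsPattern.comp ⟨f, rfl, hf⟩
  exact ⟨g, hg⟩

lemma rev_emptyPerm : rev emptyPerm = emptyPerm :=
  Sigma.ext rfl (heq_of_eq (Subsingleton.elim (α := Equiv.Perm (Fin 0)) _ _))

lemma comp_emptyPerm : comp emptyPerm = emptyPerm :=
  Sigma.ext rfl (heq_of_eq (Subsingleton.elim (α := Equiv.Perm (Fin 0)) _ _))

lemma rev_perm12 : rev perm12 = perm21 :=
  Sigma.ext rfl (heq_of_eq (by decide :
    (Fin.revPerm.trans 1 : Equiv.Perm (Fin 2)) = Equiv.swap 0 1))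

lemma comp_perm12 : comp perm12 = perm21 :=
  Sigma.ext rfl (heq_of_eq (by decide :
    (Equiv.trans (1 : Equiv.Perm (Fin 2)) Fin.revPerm) = Equiv.swap 0 1))

lemma rev_preimage_av (β : Permutation) : rev ⁻¹' Av β = Av (rev β) := by
  ext π
  refine not_congr ⟨fun h => ?_, fun h => ?_⟩
  · simpa [rev_rev] using h.rev
  · simpa [rev_rev] using h.rev

lemma comp_preimage_av (β : Permutation) : comp ⁻¹' Av β = Av (comp β) := by
  ext π
  refine not_congr ⟨fun h => ?_, fun h => ?_⟩
  · simpa [comp_comp] using h.comp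
  · simpa [comp_comp] using h.comp

lemma IsPermClass.rev {C : Set Permutation} (h : IsPermClass C) :
    IsPermClass (rev ⁻¹' C) := fun π hπ σ hσ hne =>
  h (SkinnyGrid.rev π) hπ (SkinnyGrid.rev σ) hσ.rev fun h' =>
    hne (by rw [← rev_rev σ, h', rev_emptyPerm])

lemma IsPermClass.comp {C : Set Permutation} (h : IsPermClass C) :
    IsPermClass (comp ⁻¹' C) := fun π hπ σ hσ hne =>
  h (SkinnyGrid.comp π) hπ (SkinnyGrid.comp σ) hσ.comp fun h' =>
    hne (by rw [← comp_comp σ, h', comp_emptyPerm])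

lemma rev_mem_gridClass {k : ℕ} {cell : Fin k → Set Permutation} {π : Permutation}
    (h : π ∈ gridClass cell) : rev π ∈ gridClass fun i => rev ⁻¹' cell i.rev := by
  obtain ⟨col, hcol, hp⟩ := h
  refine ⟨fun p => (col p.rev).rev, fun p q hpq =>
    Fin.rev_le_rev.2 (hcol (Fin.rev_le_rev.2 hpq)), fun i => ?_⟩
  obtain ⟨σ, hσ, hp⟩ := hp i.rev
  refine ⟨rev σ, ?_, ?_⟩
  · rcases hσ with hσ | rfl
    · exact .inl (by rwa [Set.mem_preimage, rev_rev])
    · exact .inr rev_emptyPerm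
  · have := IsPattern.rev hp
    change IsPattern (rev π) _ (rev σ)
    convert this
    ext p
    constructor
    · intro h
      exact ⟨p.rev, Fin.rev_eq_iff.1 h, Fin.rev_rev p⟩
    · rintro ⟨q, hq, rfl⟩
      exact Fin.rev_eq_iff.2 ((congrArg col (Fin.rev_rev q)).trans hq)

lemma rev_preimage_gridClass {k : ℕ} (cell : Fin k → Set Permutation) :
    rev ⁻¹' gridClass cell = gridClass fun i => rev ⁻¹' cell i.rev := by
  ext π
  refine ⟨fun h => ?_, fun h => ?_⟩
  · simpa [rev_rev] using rev_mem_gridClass h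
  · have := rev_mem_gridClass h
    simpa [rev_rev, ← Set.preimage_comp, Function.comp_def] using this

lemma comp_mem_gridClass {k : ℕ} {cell : Fin k → Set Permutation} {π : Permutation}
    (h : π ∈ gridClass cell) : comp π ∈ gridClass fun i => comp ⁻¹' cell i := by
  obtain ⟨col, hcol, hp⟩ := h
  refine ⟨col, hcol, fun i => ?_⟩
  obtain ⟨σ, hσ, hp⟩ := hp i
  refine ⟨comp σ, ?_, IsPattern.comp hp⟩
  rcases hσ with hσ | rfl
  · exact .inl (by rwa [Set.mem_preimage, comp_comp])
  · exact .inr comp_emptyPerm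

lemma comp_preimage_gridClass {k : ℕ} (cell : Fin k → Set Permutation) :
    comp ⁻¹' gridClass cell = gridClass fun i => comp ⁻¹' cell i := by
  ext π
  refine ⟨fun h => ?_, fun h => ?_⟩
  · simpa [comp_comp] using comp_mem_gridClass h
  · have := comp_mem_gridClass h
    simpa [comp_comp, ← Set.preimage_comp, Function.comp_def] using this

/-- Exchange the markers of the leftmost and of the rightmost entry. -/
def swapLR : Atom → Atom
  | .L => .R
  | .R => .L
  | a => a

lemma trackedWord_rev (π : Permutation) : trackedWord (rev π) = (trackedWord π).map swapLR := by
  obtain ⟨n, π⟩ := π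
  simp only [trackedWord, List.map_ofFn]
  congr 1
  funext v
  change entryAtom n (Fin.rev (π.symm v)) = swapLR (entryAtom n (π.symm v))
  generalize π.symm v = p
  have := p.2
  simp only [entryAtom, Fin.val_rev]
  split_ifs <;> first | rfl | omega

lemma reverse_ofFn {α : Type*} {n : ℕ} (f : Fin n → α) :
    (List.ofFn f).reverse = List.ofFn fun i => f i.rev := by
  refine List.ext_getElem (by simp) fun i h h' => ?_
  simp only [List.getElem_reverse, List.getElem_ofFn, List.length_ofFn]
  congr 1
  ext
  simp [Fin.val_rev]
  omega

lemma trackedWord_comp (π : Permutation) : trackedWord (comp π) = (trackedWord π).reverse := by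
  obtain ⟨n, π⟩ := π
  rw [trackedWord, trackedWord, reverse_ofFn]
  rfl

lemma Presented.rev {k : Kind} {C : Set Permutation}
    (h : Presented k fun π : C => trackedWord π) :
    Presented k fun π : rev ⁻¹' C => trackedWord π := by
  refine (h.transform swapLR false).congr (WIso.of_bijective
    (fun π => ⟨SkinnyGrid.rev π.1, by simp [rev_rev]⟩) ⟨fun π σ h => ?_, fun π => ?_⟩ fun π => ?_)
  · have := congrArg (fun x => SkinnyGrid.rev x.1) h
    exact Subtype.ext (by simpa [rev_rev] using this)
  · exact ⟨⟨SkinnyGrid.rev π.1, π.2⟩, Subtype.ext (rev_rev _)⟩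
  · simp [transformWord, trackedWord_rev]

lemma Presented.comp {k : Kind} {C : Set Permutation}
    (h : Presented k fun π : C => trackedWord π) :
    Presented k fun π : comp ⁻¹' C => trackedWord π := by
  refine (h.transform id true).congr (WIso.of_bijective
    (fun π => ⟨SkinnyGrid.comp π.1, by simp [comp_comp]⟩) ⟨fun π σ h => ?_, fun π => ?_⟩
    fun π => ?_)
  · have := congrArg (fun x => SkinnyGrid.comp x.1) h
    exact Subtype.ext (by simpa [comp_comp] using this)
  · exact ⟨⟨SkinnyGrid.comp π.1, π.2⟩, Subtype.ext (comp_comp _)⟩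
  · simp [transformWord, trackedWord_comp]

/-! ### Words given by their letters -/

lemma filter_finRange {m n : ℕ} {h : Fin m → Fin n} (hh : StrictMono h) (p : Fin n → Bool)
    (hp : ∀ v, p v ↔ v ∈ Set.range h) :
    (List.finRange n).filter p = (List.finRange m).map h := by
  refine List.Pairwise.eq_of_mem_iff (r := (· < ·)) ((List.pairwise_lt_finRange n).filter _) ?_
    fun v => ?_
  · exact (List.pairwise_lt_finRange m).map _ fun a b hab => hh hab
  · simp [hp]

/-- The letters of a word of options, in the positions given by an increasing function. -/
lemma reduceOption_ofFn {α : Type*} {m n : ℕ} {h : Fin m → Fin n} (hh : StrictMono h)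
    {F : Fin n → Option α} {c : Fin m → α} (h₁ : ∀ a, F (h a) = some (c a))
    (h₂ : ∀ v, v ∉ Set.range h → F v = none) :
    (List.ofFn F).reduceOption = List.ofFn c := by
  classical
  have hp : ∀ v, (F v).isSome ↔ v ∈ Set.range h := fun v => by
    refine ⟨fun hv => ?_, ?_⟩
    · by_contra hn
      simp [h₂ v hn] at hv
    · rintro ⟨a, rfl⟩
      simp [h₁]
  rw [List.reduceOption, List.ofFn_eq_map, List.filterMap_map]
  have h₃ : (List.finRange n).filterMap (id ∘ F) =
      ((List.finRange n).filter fun v => (F v).isSome).filterMap (id ∘ F) := by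
    rw [List.filterMap_filter]
    congr 1
    funext v
    cases hv : F v <;> simp [hv]
  rw [h₃, filter_finRange hh _ hp, List.filterMap_map, List.ofFn_eq_map,
    ← List.filterMap_eq_map]
  congr 1
  funext a
  simp [h₁]

open Classical in
lemma insertWord_ofFn {n : ℕ} (F : Fin n → Option Atom) :
    insertWord (List.ofFn F) = List.ofFn fun v =>
      (F v).elim (if ∃ w, v < w ∧ F w = none then .Z else .R) keepAtom := by
  induction n with
  | zero => simp [insertWord]
  | succ n ih =>
    have h₁ : ∀ v : Fin n, (∃ w, v.succ < w ∧ F w = none) ↔ ∃ w, v < w ∧ F w.succ = none := by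
      simp [Fin.exists_fin_succ]
    have h₂ : (∃ w, 0 < w ∧ F w = none) ↔ none ∈ List.ofFn fun v : Fin n => F v.succ := by
      simp [Fin.exists_fin_succ, List.mem_ofFn]
    rw [List.ofFn_succ, List.ofFn_succ]
    simp only [h₁, h₂]
    cases hF : F 0 <;> simp only [insertWord, ih, Option.elim]

lemma firstBelow_ofFn {n : ℕ} (F : Fin n → Option Atom) :
    FirstBelow (List.ofFn F) ↔ ∃ v, F v = none ∧ ∀ w < v, ∀ a, F w = some a → ¬ IsRight a := by
  induction n with
  | zero => simp [FirstBelow]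
  | succ n ih =>
    rw [List.ofFn_succ, Fin.exists_fin_succ]
    simp only [Fin.forall_fin_succ]
    cases F 0 <;> simp [FirstBelow, ih]
    exact ⟨fun ⟨h, v, hv, h'⟩ => ⟨v, hv, h, h'⟩, fun ⟨v, hv, h, h'⟩ => ⟨h, v, hv, h'⟩⟩

/-! ### Extending a permutation by an increasing sequence -/

/-- The permutation `π` consists of the pattern `σ` followed by an increasing sequence. -/
structure IsExtension (σ π : Permutation) : Prop where
  le : σ.1 ≤ π.1
  occurrence : IsOccurrence σ π (Fin.castLEOrderEmb le)
  increasing : ∀ p q : Fin π.1, σ.1 ≤ p.1 → p < q → π.2 p < π.2 q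

/-- The word of the pattern of the first `m` entries of `π`, with the other entries inserted as
`none`. -/
def decoration (π : Permutation) (m : ℕ) : List (Option Atom) :=
  List.ofFn fun v : Fin π.1 =>
    if h : (π.2.symm v).1 < m then some (entryAtom m ⟨π.2.symm v, h⟩) else none

/-- The values of the entries of the pattern `σ`, listed by increasing value. -/
def IsExtension.value {σ π : Permutation} (h : IsExtension σ π) (a : Fin σ.1) : Fin π.1 :=
  π.2 (Fin.castLE h.le (σ.2.symm a))

lemma IsExtension.strictMono_value {σ π : Permutation} (h : IsExtension σ π) :
    StrictMono h.value := fun a b hab => by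
  refine (h.occurrence _ _).1 ?_
  simpa using hab

lemma IsExtension.range_value {σ π : Permutation} (h : IsExtension σ π) (v : Fin π.1) :
    v ∈ Set.range h.value ↔ (π.2.symm v).1 < σ.1 := by
  constructor
  · rintro ⟨a, rfl⟩
    simp [value]
  · intro hv
    refine ⟨σ.2 ⟨_, hv⟩, ?_⟩
    simp [value]

lemma IsExtension.reduceOption_decoration {σ π : Permutation} (h : IsExtension σ π) :
    (decoration π σ.1).reduceOption = trackedWord σ := by
  refine reduceOption_ofFn h.strictMono_value (fun a => ?_) fun v hv => ?_
  · simp [IsExtension.value]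
  · rw [h.range_value] at hv
    exact dif_neg hv

lemma IsExtension.unique_left {σ τ π : Permutation} (h : IsExtension σ π) (h' : IsExtension τ π)
    (hm : σ.1 = τ.1) : σ = τ := by
  obtain ⟨m, σ⟩ := σ
  obtain ⟨n, τ⟩ := τ
  obtain rfl : m = n := hm
  exact IsPattern.unique ⟨_, rfl, h.occurrence⟩ ⟨_, rfl, h'.occurrence⟩

/-- An extension is determined by the positions of the values of the additional entries. -/
lemma IsExtension.unique_right {σ π ρ : Permutation} (h : IsExtension σ π)
    (h' : IsExtension σ ρ) (hd : decoration π σ.1 = decoration ρ σ.1) : π = ρ := by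
  obtain ⟨n, π⟩ := π
  obtain ⟨n', ρ⟩ := ρ
  obtain rfl : n = n' := by simpa [decoration] using congrArg List.length hd
  have hF := List.ofFn_injective hd
  have hlt : ∀ v, (π.symm v).1 < σ.1 ↔ (ρ.symm v).1 < σ.1 := fun v => by
    have := congrArg Option.isSome (congrFun hF v)
    by_cases h₁ : (π.symm v).1 < σ.1 <;> by_cases h₂ : (ρ.symm v).1 < σ.1
    · exact iff_of_true h₁ h₂
    · simp [h₁, h₂] at this
    · simp [h₁, h₂] at this
    · exact iff_of_false h₁ h₂
  have h₁ : h.value = h'.value := (h.strictMono_value.range_inj h'.strictMono_value).1 <| by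
    ext v
    rw [h.range_value, h'.range_value, hlt]
  have hle : σ.1 ≤ n := h.le
  have hadd : ∀ q : Fin (n - σ.1), σ.1 + q.1 < n := fun q => by omega
  have hmono : ∀ {τ : Equiv.Perm (Fin n)}, IsExtension σ ⟨n, τ⟩ →
      StrictMono fun q : Fin (n - σ.1) => τ ⟨σ.1 + q.1, hadd q⟩ := fun hτ p q hpq =>
    hτ.increasing ⟨σ.1 + p.1, hadd p⟩ ⟨σ.1 + q.1, hadd q⟩
      (Nat.le_add_right _ _) (Fin.lt_def.2 (Nat.add_lt_add_left hpq _))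
  have hrange : ∀ (τ : Equiv.Perm (Fin n)) (v : Fin n),
      v ∈ Set.range (fun q : Fin (n - σ.1) => τ ⟨σ.1 + q.1, hadd q⟩) ↔
        ¬ (τ.symm v).1 < σ.1 := fun τ v => by
    constructor
    · rintro ⟨q, rfl⟩
      simp
    · intro hv
      refine ⟨⟨(τ.symm v).1 - σ.1, by omega⟩, ?_⟩
      rw [← Equiv.eq_symm_apply]
      ext
      simp only
      omega
  have h₂ := ((hmono h).range_inj (hmono h')).1 <| by
    ext v
    rw [hrange, hrange, hlt]
  refine Sigma.ext rfl (heq_of_eq (Equiv.ext fun (p : Fin n) => ?_))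
  by_cases hp : p.1 < σ.1
  · have := congrFun h₁ (σ.2 ⟨p.1, hp⟩)
    simpa [IsExtension.value] using this
  · have := congrFun h₂ ⟨p.1 - σ.1, by omega⟩
    have hp' : (⟨σ.1 + (p.1 - σ.1), by omega⟩ : Fin n) = p := Fin.ext (by simp only; omega)
    simpa only [hp'] using this

/-- The additional entries may be inserted at arbitrary values. -/
lemma exists_isExtension (σ : Permutation) {u : List (Option Atom)}
    (hu : u.reduceOption = trackedWord σ) :
    ∃ π, IsExtension σ π ∧ decoration π σ.1 = u := by
  obtain ⟨m, σ⟩ := σ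
  obtain ⟨n, F, rfl⟩ : ∃ n, ∃ F : Fin n → Option Atom, u = List.ofFn F :=
    ⟨u.length, u.get, (List.ofFn_get u).symm⟩
  set s : Finset (Fin n) := Finset.univ.filter fun v => F v ≠ none with hs
  have hsF : ∀ v, v ∈ s ↔ F v ≠ none := by simp [hs]
  -- the letters of the word
  have hc : ∀ v : s, ∃ a, F v = some a := fun v =>
    Option.ne_none_iff_exists'.1 ((hsF v).1 v.2)
  have hr : ∀ {k : ℕ} (e : s.card = k), (List.ofFn F).reduceOption =
      List.ofFn fun a : Fin k => (hc (s.orderIsoOfFin e a)).choose := fun e => by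
    refine reduceOption_ofFn (h := s.orderEmbOfFin e) (s.orderEmbOfFin e).strictMono
      (fun a => (hc (s.orderIsoOfFin e a)).choose_spec) fun v hv => ?_
    rw [Finset.range_orderEmbOfFin] at hv
    by_contra hF
    exact hv ((hsF v).2 hF)
  have hm : s.card = m := by
    have := congrArg List.length ((hr rfl).symm.trans hu)
    simpa [trackedWord] using this
  have hcompl : sᶜ.card = n - m := by rw [Finset.card_compl, hm, Fintype.card_fin]
  have hmn : m ≤ n := hm ▸ (s.card_le_univ.trans (by simp))
  set h := s.orderEmbOfFin hm with hh
  set h' := sᶜ.orderEmbOfFin hcompl with hh'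
  have hhs : ∀ a, h a ∈ s := s.orderEmbOfFin_mem hm
  have hhs' : ∀ a, h' a ∉ s := fun a => Finset.mem_compl.1 (sᶜ.orderEmbOfFin_mem hcompl a)
  have hlet : ∀ a, F (h a) = some (entryAtom m (σ.symm a)) := fun a => by
    have := congrFun (List.ofFn_injective ((hr hm).symm.trans hu)) a
    exact (hc (s.orderIsoOfFin hm a)).choose_spec.trans (congrArg some this)
  set g : Fin n → Fin n := fun p =>
    if hp : p.1 < m then h (σ ⟨p.1, hp⟩) else h' ⟨p.1 - m, by omega⟩ with hg
  have hg₁ : ∀ {p : Fin n} (hp : p.1 < m), g p = h (σ ⟨p.1, hp⟩) := fun hp => dif_pos hp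
  have hg₂ : ∀ {p : Fin n} (hp : ¬ p.1 < m), g p = h' ⟨p.1 - m, by omega⟩ := fun hp => dif_neg hp
  have hgs : ∀ p, g p ∈ s ↔ p.1 < m := fun p => by
    by_cases hp : p.1 < m
    · simp [hg₁ hp, hp, hhs]
    · simp [hg₂ hp, hp, hhs']
  have hinj : Function.Injective g := fun p q hpq => by
    have hiff := hgs p
    rw [hpq, hgs q] at hiff
    by_cases hp : p.1 < m
    · have hq := hiff.2 hp
      rw [hg₁ hp, hg₁ hq] at hpq
      have := σ.injective (h.injective hpq)
      exact Fin.ext (Fin.mk.inj this)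
    · have hq := fun hq => hp (hiff.1 hq)
      rw [hg₂ hp, hg₂ hq] at hpq
      have := congrArg Fin.val (h'.injective hpq)
      simp only at this
      exact Fin.ext (by omega)
  have hbij := (Finite.injective_iff_bijective).1 hinj
  have hsymm : ∀ v, g ((Equiv.ofBijective g hbij).symm v) = v := Equiv.ofBijective_apply_symm_apply g hbij
  refine ⟨⟨n, Equiv.ofBijective g hbij⟩, ⟨hmn, fun a b => ?_, fun p q hp hpq => ?_⟩, ?_⟩
  · change σ a < σ b ↔ g (Fin.castLE hmn a) < g (Fin.castLE hmn b)
    rw [hg₁ (p := Fin.castLE hmn a) a.2, hg₁ (p := Fin.castLE hmn b) b.2]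
    exact h.lt_iff_lt.symm
  · change g p < g q
    have hp' : ¬ p.1 < m := not_lt.2 hp
    have hpq' : p.1 < q.1 := hpq
    have hq' : ¬ q.1 < m := by omega
    rw [hg₂ hp', hg₂ hq']
    refine h'.strictMono (Fin.lt_def.2 ?_)
    simp only
    omega
  · refine congrArg List.ofFn (funext fun v => ?_)
    simp only
    have hv := hsymm v
    set p := (Equiv.ofBijective g hbij).symm v
    split_ifs with hp
    · rw [← hv, hg₁ hp, hlet, Equiv.symm_apply_apply]
    · have : v ∉ s := by rwa [← hv, hgs]
      rw [hsF, not_not] at this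
      exact this.symm

lemma isRight_entryAtom {n : ℕ} (p : Fin n) : IsRight (entryAtom n p) ↔ p.1 + 1 = n := by
  unfold entryAtom IsRight
  split_ifs <;> simp_all

/-- The descent at the end of `σ` is visible in the decorated word. -/
lemma IsExtension.firstBelow_decoration {σ π : Permutation} (h : IsExtension σ π)
    (h₀ : σ.1 ≠ 0) : FirstBelow (decoration π σ.1) ↔
      ∃ p q : Fin π.1, p.1 + 1 = σ.1 ∧ q.1 = σ.1 ∧ π.2 q < π.2 p := by
  have hle := h.le
  obtain ⟨n, π⟩ := π
  simp only at hle ⊢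
  rw [decoration, firstBelow_ofFn]
  simp only [dite_eq_right_iff, reduceCtorEq, imp_false, not_lt]
  constructor
  · rintro ⟨v, hv, hb⟩
    have hlt : σ.1 < n := hv.trans_lt (π.symm v).2
    refine ⟨⟨σ.1 - 1, by omega⟩, ⟨σ.1, hlt⟩, by simp only; omega, rfl, ?_⟩
    have hqv : π ⟨σ.1, hlt⟩ ≤ v := by
      rcases hv.eq_or_lt with hv | hv
      · have : (⟨σ.1, hlt⟩ : Fin n) = π.symm v := Fin.ext hv
        rw [this, Equiv.apply_symm_apply]
      · have := h.increasing ⟨σ.1, hlt⟩ (π.symm v) le_rfl hv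
        simp only [Equiv.apply_symm_apply] at this
        exact this.le
    refine hqv.trans_lt (lt_of_le_of_ne ?_ fun hvp => ?_)
    · by_contra hc
      have hp : σ.1 - 1 < σ.1 := by omega
      refine hb (π ⟨σ.1 - 1, by omega⟩) (not_le.1 hc) (entryAtom σ.1 ⟨σ.1 - 1, hp⟩) ?_ ?_
      · simp [hp]
      · rw [isRight_entryAtom]
        exact Nat.succ_pred_eq_of_ne_zero h₀
    · rw [hvp, Equiv.symm_apply_apply] at hv
      simp only at hv
      omega
  · rintro ⟨p, q, hp, hq, hqp⟩
    refine ⟨π q, by simp [hq], fun w hw a ha hr => ?_⟩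
    split_ifs at ha with hwm
    cases ha
    rw [isRight_entryAtom] at hr
    have : π.symm w = p := Fin.ext (by simp only at hr; omega)
    rw [Equiv.symm_apply_eq] at this
    exact (hw.trans hqp).ne this

lemma IsExtension.insertWord_decoration {σ π : Permutation} (h : IsExtension σ π)
    (h₀ : σ.1 ≠ 0) (hlt : σ.1 < π.1) : insertWord (decoration π σ.1) = trackedWord π := by
  classical
  obtain ⟨n, π⟩ := π
  simp only at hlt ⊢
  rw [decoration, insertWord_ofFn]
  refine congrArg List.ofFn (funext fun v => ?_)
  simp only [dite_eq_right_iff, reduceCtorEq, imp_false, not_lt]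
  by_cases hv : (π.symm v).1 < σ.1
  · rw [dif_pos hv]
    change keepAtom (entryAtom σ.1 _) = entryAtom n _
    generalize π.symm v = p at hv
    simp only [entryAtom]
    split_ifs <;> first | rfl | omega
  · rw [dif_neg hv]
    have hiff : (∃ w, v < w ∧ σ.1 ≤ (π.symm w).1) ↔ (π.symm v).1 + 1 ≠ n := by
      constructor
      · rintro ⟨w, hvw, hw⟩ hn
        have hne : π.symm w ≠ π.symm v := fun h' => hvw.ne' (π.symm.injective h')
        have hlt' : π.symm w < π.symm v :=
          lt_of_le_of_ne (Fin.le_def.2 (by have := (π.symm w).2; omega)) hne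
        have := h.increasing _ _ hw hlt'
        simp only [Equiv.apply_symm_apply] at this
        exact hvw.not_gt this
      · intro hn
        have hlt' : (π.symm v).1 + 1 < n := by have := (π.symm v).2; omega
        refine ⟨π ⟨(π.symm v).1 + 1, hlt'⟩, ?_, ?_⟩
        · have := h.increasing (π.symm v) ⟨(π.symm v).1 + 1, hlt'⟩ (not_lt.1 hv)
            (Fin.lt_def.2 (Nat.lt_succ_self _))
          simpa only [Equiv.apply_symm_apply] using this
        · simp only [Equiv.symm_apply_apply]
          omega
    simp only [Option.elim, hiff]
    generalize π.symm v = p at hv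
    simp only [entryAtom]
    split_ifs <;> first | rfl | omega

/-! ### Appending an increasing cell -/

lemma emptyPerm_mem_av_perm21 : emptyPerm ∈ Av perm21 := fun ⟨f, _⟩ => (f (0 : Fin 2)).elim0

/-- The entries in the positions in `Q` are increasing if they avoid `21`. -/
lemma exists_mem_av_perm21_iff (π : Permutation) (Q : Set (Fin π.1)) :
    (∃ τ ∈ Av perm21 ∪ {emptyPerm}, IsPattern π Q τ) ↔
      ∀ p ∈ Q, ∀ q ∈ Q, p < q → π.2 p < π.2 q := by
  constructor
  · rintro ⟨τ, hτ, f, rfl, hf⟩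
    have hτ' : τ ∈ Av perm21 := by
      rcases hτ with hτ | rfl
      · exact hτ
      · exact emptyPerm_mem_av_perm21
    rintro _ ⟨a, rfl⟩ _ ⟨b, rfl⟩ hab
    rw [f.lt_iff_lt] at hab
    refine (hf a b).1 (lt_of_not_ge fun hba => hτ' ?_)
    have hba' : τ.2 b < τ.2 a := lt_of_le_of_ne hba fun h => hab.ne' (τ.2.injective h)
    have hg : StrictMono (![a, b] : Fin 2 → Fin τ.1) := by
      rw [Fin.strictMono_iff_lt_succ]
      intro i
      obtain rfl : i = 0 := Subsingleton.elim _ _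
      exact hab
    refine ⟨OrderEmbedding.ofStrictMono _ hg, fun i j => ?_⟩
    change Fin 2 at i j
    change Equiv.swap (0 : Fin 2) 1 i < Equiv.swap (0 : Fin 2) 1 j ↔
      τ.2 ((![a, b] : Fin 2 → Fin τ.1) i) < τ.2 ((![a, b] : Fin 2 → Fin τ.1) j)
    fin_cases i <;> fin_cases j <;> simp [hba', hba'.le]
  · intro h
    obtain ⟨τ, f, rfl, hf⟩ := exists_isPattern π Q
    refine ⟨τ, .inl ?_, f, rfl, hf⟩
    rintro ⟨g, hg⟩
    have h₁ : τ.2 (g (1 : Fin 2)) < τ.2 (g (0 : Fin 2)) :=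
      (hg (1 : Fin 2) (0 : Fin 2)).1 (by decide)
    have h₂ : g (0 : Fin 2) < g (1 : Fin 2) := g.strictMono (by decide : (0 : Fin 2) < 1)
    exact ((hf _ _).1 h₁).not_gt (h _ ⟨_, rfl⟩ _ ⟨_, rfl⟩ (f.strictMono h₂))

/-- The pattern of the first `m` entries has length `m`, and occurs in the positions below `m`. -/
lemma isPattern_initial {σ π : Permutation} {m : ℕ} (hm : m ≤ π.1)
    (h : IsPattern π {p | p.1 < m} σ) :
    ∃ hσ : σ.1 = m, IsOccurrence σ π (Fin.castLEOrderEmb (hσ.trans_le hm)) := by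
  obtain ⟨f, hf, hfo⟩ := h
  have hr : Set.range (Fin.castLEOrderEmb hm) = {p : Fin π.1 | p.1 < m} := by
    ext p
    exact ⟨fun ⟨a, ha⟩ => ha ▸ a.2, fun hp => ⟨⟨p.1, hp⟩, rfl⟩⟩
  have hσ : σ.1 = m := by
    have h₁ := Set.ncard_range_of_injective f.injective
    have h₂ := Set.ncard_range_of_injective (Fin.castLEOrderEmb hm).injective
    rw [hf] at h₁
    rw [hr] at h₂
    simpa using h₁.symm.trans h₂
  subst hσ
  have : f = Fin.castLEOrderEmb hm := DFunLike.coe_injective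
    ((f.strictMono.range_inj (Fin.castLEOrderEmb hm).strictMono).1 (hf.trans hr.symm))
  exact ⟨rfl, this ▸ hfo⟩

lemma exists_isExtension_of_increasing {π : Permutation} {m : ℕ} (hm : m ≤ π.1)
    (h : ∀ p q : Fin π.1, m ≤ p.1 → p < q → π.2 p < π.2 q) :
    ∃ σ, σ.1 = m ∧ IsExtension σ π := by
  obtain ⟨σ, hσ⟩ := exists_isPattern π {p | p.1 < m}
  obtain ⟨rfl, ho⟩ := isPattern_initial hm hσ
  exact ⟨σ, rfl, hm, ho, h⟩

lemma exists_eq_initial {n : ℕ} {P : Set (Fin n)} (hP : IsLowerSet P) :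
    ∃ m ≤ n, P = {p | p.1 < m} := by
  classical
  by_cases h : ∃ m, ∃ hm : m < n, (⟨m, hm⟩ : Fin n) ∉ P
  · obtain ⟨hm, hmP⟩ := Nat.find_spec h
    refine ⟨Nat.find h, hm.le, Set.ext fun p => ⟨fun hp => ?_, fun hp => ?_⟩⟩
    · by_contra hlt
      exact hmP (hP (Fin.le_def.2 (not_lt.1 hlt)) hp)
    · by_contra hpP
      exact Nat.find_min h hp ⟨p.2, hpP⟩
  · push Not at h
    exact ⟨n, le_rfl, Set.ext fun p => iff_of_true (h p.1 p.2) p.2⟩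

lemma mem_append_iff {A : Set Permutation} {π : Permutation} :
    π ∈ append A (Av perm21) ↔ ∃ σ ∈ A, IsExtension σ π := by
  simp only [append, Set.mem_ofPred_eq, exists_mem_av_perm21_iff]
  constructor
  · rintro ⟨P, hP, ⟨σ, hσ, hp⟩, h⟩
    obtain ⟨m, hm, rfl⟩ := exists_eq_initial hP
    obtain ⟨rfl, ho⟩ := isPattern_initial hm hp
    refine ⟨σ, hσ, hm, ho, fun p q hp hpq => h p (not_lt.2 hp) q ?_ hpq⟩
    exact not_lt.2 (hp.trans (Fin.lt_def.1 hpq).le)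
  · rintro ⟨σ, hσ, h⟩
    refine ⟨{p | p.1 < σ.1}, fun p q hqp hp => lt_of_le_of_lt (Fin.le_def.1 hqp) hp,
      ⟨σ, hσ, _, ?_, h.occurrence⟩, fun p hp q _ => h.increasing p q (not_lt.1 hp)⟩
    ext p
    exact ⟨fun ⟨a, ha⟩ => ha ▸ a.2, fun hp => ⟨⟨p.1, hp⟩, rfl⟩⟩

/-- The entry of `π` that follows its first `m` entries is below its predecessor. -/
def HasDescent (π : Permutation) (m : ℕ) : Prop :=
  ∃ p q : Fin π.1, p.1 + 1 = m ∧ q.1 = m ∧ π.2 q < π.2 p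

lemma HasDescent.lt {π : Permutation} {m : ℕ} (h : HasDescent π m) : m < π.1 := by
  obtain ⟨p, q, -, hq, -⟩ := h
  exact hq ▸ q.2

lemma HasDescent.ne_zero {π : Permutation} {m : ℕ} (h : HasDescent π m) : m ≠ 0 := by
  obtain ⟨p, q, hp, -, -⟩ := h
  omega

/-- The increasing sequence at the end of `π` starts after its last descent. -/
lemma IsExtension.le_of_hasDescent {σ π : Permutation} (h : IsExtension σ π) {m : ℕ}
    (hm : HasDescent π m) : m ≤ σ.1 := by
  obtain ⟨p, q, hp, hq, hqp⟩ := hm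
  by_contra hlt
  exact (h.increasing p q (by omega) (Fin.lt_def.2 (by omega))).not_gt hqp

/-- If the entries before the increasing sequence do not end in a descent, then the sequence can
be enlarged. -/
lemma IsExtension.exists_shorter {σ π : Permutation} (h : IsExtension σ π) (h₀ : σ.1 ≠ 0)
    (hd : ¬ HasDescent π σ.1) : ∃ τ, τ.1 + 1 = σ.1 ∧ IsExtension τ π ∧ Contains σ τ := by
  have hle := h.le
  obtain ⟨τ, hτ, hτπ⟩ := exists_isExtension_of_increasing (π := π) (m := σ.1 - 1) (by omega)
    fun p q hp hpq => by
      have hpq' := Fin.lt_def.1 hpq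
      by_cases hpσ : σ.1 ≤ p.1
      · exact h.increasing p q hpσ hpq
      · have hlt : σ.1 < π.1 ∨ σ.1 = q.1 := by have := q.2; omega
        have hq : σ.1 ≤ q.1 := by omega
        have hlt : σ.1 < π.1 := by have := q.2; omega
        have h₁ : π.2 p < π.2 ⟨σ.1, hlt⟩ := by
          refine lt_of_le_of_ne (not_lt.1 fun hlt' => hd ⟨p, ⟨σ.1, hlt⟩, by omega, rfl, hlt'⟩) ?_
          intro heq
          have := congrArg Fin.val (π.2.injective heq)
          simp only at this
          omega
        rcases hq.eq_or_lt with hq | hq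
        · have : q = ⟨σ.1, hlt⟩ := Fin.ext hq.symm
          rwa [this]
        · exact h₁.trans (h.increasing _ _ le_rfl (Fin.lt_def.2 hq))
  refine ⟨τ, by omega, hτπ, IsPattern.contains_of_subset (π := π) ⟨_, rfl, h.occurrence⟩
    ⟨_, rfl, hτπ.occurrence⟩ ?_⟩
  rintro _ ⟨a, rfl⟩
  exact ⟨⟨a.1, by omega⟩, rfl⟩

lemma IsExtension.eq_one {σ π : Permutation} (h : IsExtension σ π) (h₀ : σ.1 = 0) :
    π = ⟨π.1, 1⟩ := by
  obtain ⟨n, π⟩ := π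
  refine Sigma.ext rfl (heq_of_eq ?_)
  have hm : StrictMono π := fun p q hpq => h.increasing p q (by omega) hpq
  exact perm_eq_of_lt_iff fun a b => hm.lt_iff_lt

lemma isExtension_one (n : ℕ) : IsExtension emptyPerm ⟨n, 1⟩ :=
  ⟨Nat.zero_le n, fun a => a.elim0, fun _ _ _ h => h⟩

lemma not_hasDescent_one (n m : ℕ) : ¬ HasDescent ⟨n, 1⟩ m := fun h =>
  h.ne_zero (Nat.le_zero.1 ((isExtension_one n).le_of_hasDescent h))

lemma trackedWord_one (n : ℕ) : trackedWord ⟨n, 1⟩ = increasingWord n := by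
  change List.ofFn (fun v : Fin n => entryAtom n v) = _
  match n with
  | 0 => rfl
  | 1 => rfl
  | n + 2 =>
    rw [List.ofFn_succ, List.ofFn_succ', increasingWord, List.concat_eq_append]
    refine congrArg₂ _ rfl (congrArg₂ _ ?_ ?_)
    · refine List.eq_replicate_iff.2 ⟨by simp, fun a ha => ?_⟩
      obtain ⟨i, rfl⟩ := List.mem_ofFn.1 ha
      have := i.2
      simp [entryAtom, this.ne]
    · simp [entryAtom]

/-- The permutations that arise by appending an increasing cell to a permutation in `A`: the
increasing ones, and the ones with a last descent. For the latter, the cut is made at the last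
descent. -/
theorem wiso_append {A : Set Permutation} (hA : IsClosed A) :
    WIso (Sum.elim increasingWord
        (fun p : Σ σ : A, Inserted (trackedWord σ) => insertWord p.2.1))
      (fun π : append A (Av perm21) => trackedWord π) := by
  choose ext hext hdec using fun p : Σ σ : A, Inserted (trackedWord σ) =>
    exists_isExtension p.1.1 p.2.2.1
  have h₀ : ∀ p : Σ σ : A, Inserted (trackedWord σ), p.1.1.1 ≠ 0 := by
    rintro ⟨⟨σ, hσ⟩, u, hu, _, a, ha⟩ h
    obtain rfl := eq_emptyPerm h
    have : a ∈ u.reduceOption := List.reduceOption_mem_iff.2 ha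
    rw [hu] at this
    exact List.not_mem_nil this
  have hdesc : ∀ p, HasDescent (ext p) p.1.1.1 := fun p =>
    ((hext p).firstBelow_decoration (h₀ p)).1 ((hdec p).symm ▸ p.2.2.2.1)
  refine WIso.of_bijective (Sum.elim
    (fun n => ⟨⟨n, 1⟩, mem_append_iff.2 ⟨_, hA.empty_mem, isExtension_one n⟩⟩)
    (fun p => ⟨ext p, mem_append_iff.2 ⟨_, p.1.2, hext p⟩⟩)) ⟨?_, ?_⟩ ?_
  · rintro (n | p) (n' | p') h <;> have h := congrArg Subtype.val h <;>
      simp only [Sum.elim_inl, Sum.elim_inr] at h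
    · exact congrArg Sum.inl (congrArg Sigma.fst h)
    · exact (not_hasDescent_one _ _ (h ▸ hdesc p')).elim
    · exact (not_hasDescent_one _ _ (h ▸ hdesc p)).elim
    · have h₁ : p.1 = p'.1 := by
        have hle := (hext p).le_of_hasDescent (h ▸ hdesc p')
        have hle' := (hext p').le_of_hasDescent (h ▸ hdesc p)
        exact Subtype.ext (IsExtension.unique_left (hext p) (h ▸ hext p') (le_antisymm hle' hle))
      have h₂ : p.2.1 = p'.2.1 := by rw [← hdec p, ← hdec p', h, h₁]
      obtain ⟨σ, u⟩ := p
      obtain ⟨σ', u'⟩ := p'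
      obtain rfl : σ = σ' := h₁
      obtain rfl : u = u' := Subtype.ext h₂
      rfl
  · classical
    rintro ⟨π, hπ⟩
    -- the shortest initial segment that is followed by an increasing sequence
    have hex : ∃ m, ∃ σ ∈ A, IsExtension σ π ∧ σ.1 = m := by
      obtain ⟨σ, hσ, h⟩ := mem_append_iff.1 hπ
      exact ⟨_, σ, hσ, h, rfl⟩
    obtain ⟨σ, hσ, h, hm⟩ := Nat.find_spec hex
    by_cases hz : σ.1 = 0
    · exact ⟨.inl π.1, Subtype.ext (h.eq_one hz).symm⟩
    · have hd : HasDescent π σ.1 := by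
        by_contra hd
        obtain ⟨τ, hτ, hτπ, hστ⟩ := h.exists_shorter hz hd
        exact Nat.find_min hex (m := τ.1) (by omega)
          ⟨τ, hA.mem_of_contains hσ hστ, hτπ, rfl⟩
      have hne : ∃ a, a ∈ trackedWord σ :=
        List.exists_mem_of_length_pos (by simpa [trackedWord] using Nat.pos_of_ne_zero hz)
      refine ⟨.inr ⟨⟨σ, hσ⟩, decoration π σ.1, h.reduceOption_decoration,
        (h.firstBelow_decoration hz).2 hd, ?_⟩, Subtype.ext ?_⟩
      · obtain ⟨a, ha⟩ := hne
        rw [← h.reduceOption_decoration] at ha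
        exact ⟨a, List.reduceOption_mem_iff.1 ha⟩
      · exact IsExtension.unique_right (hext _) h (hdec _)
  · rintro (n | p)
    · exact trackedWord_one n
    · change trackedWord (ext p) = insertWord p.2.1
      rw [← hdec p]
      exact ((hext p).insertWord_decoration (h₀ p) (hdesc p).lt).symm

/-! ### Skinny grid classes -/

/-- The class `C` has a specification of the given kind that tracks the leftmost and rightmost
entries. -/
abbrev Trackable (k : Kind) (C : Set Permutation) : Prop :=
  Presented k fun π : C => trackedWord π

lemma Trackable.append {k : Kind} {A : Set Permutation} (hA : IsClosed A) (h : Trackable k A) :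
    Trackable k (append A (Av perm21)) :=
  Presented.congr h.insert (wiso_append hA)

lemma trackable_union_emptyPerm {k : Kind} {C : Set Permutation} (h : Trackable k C) :
    Trackable k (C ∪ {emptyPerm}) := by
  by_cases hC : emptyPerm ∈ C
  · rwa [Set.union_eq_self_of_subset_right (Set.singleton_subset_iff.2 hC)]
  · refine h.add_nil.congr (WIso.of_bijective
      (Sum.elim (fun _ => ⟨emptyPerm, .inr rfl⟩) fun π => ⟨π.1, .inl π.2⟩) ⟨?_, ?_⟩ ?_)
    · rintro (_ | π) (_ | σ) h <;> have h := congrArg Subtype.val h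
      · rfl
      · exact (hC ((show emptyPerm = σ.1 from h) ▸ σ.2)).elim
      · exact (hC ((show π.1 = emptyPerm from h) ▸ π.2)).elim
      · exact congrArg Sum.inr (Subtype.ext h)
    · rintro ⟨π, hπ | rfl⟩
      · exact ⟨.inr ⟨π, hπ⟩, rfl⟩
      · exact ⟨.inl .unit, rfl⟩
    · rintro (_ | π) <;> rfl

/-- A grid class with one cell is this cell, together with the empty permutation. -/
lemma gridClass_one (cell : Fin 1 → Set Permutation) :
    gridClass cell = cell 0 ∪ {emptyPerm} := by
  ext π
  constructor
  · rintro ⟨col, -, hp⟩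
    obtain ⟨σ, hσ, hp⟩ := hp 0
    have : {p | col p = 0} = Set.univ := Set.eq_univ_of_forall fun _ => Subsingleton.elim _ _
    rw [this] at hp
    rwa [(isPattern_univ π).unique hp]
  · intro h
    refine ⟨fun _ => 0, fun _ _ _ => le_rfl, fun i => ⟨π, ?_, ?_⟩⟩
    · rwa [Subsingleton.elim i 0]
    · have : {p : Fin π.1 | (0 : Fin 1) = i} = Set.univ :=
        Set.eq_univ_of_forall fun _ => Subsingleton.elim _ _
      rw [this]
      exact isPattern_univ π

lemma preimage_preimage {α : Type*} {f : α → α} (h : ∀ x, f (f x) = x) (s : Set α) :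
    f ⁻¹' (f ⁻¹' s) = s := by
  ext x
  rw [Set.mem_preimage, Set.mem_preimage, h]

lemma trackable_gridClass_succ {k : Kind} {n : ℕ} (cell : Fin (n + 2) → Set Permutation)
    (hcell : ∀ i, IsPermClass (cell i))
    (h : Trackable k (gridClass fun i : Fin (n + 1) => cell i.castSucc))
    (hlast : cell (Fin.last _) = Av perm21 ∨ cell (Fin.last _) = Av perm12) :
    Trackable k (gridClass cell) := by
  rcases hlast with hlast | hlast
  · rw [gridClass_succ, hlast]
    exact Trackable.append (isClosed_gridClass (Nat.succ_pos _) fun i => hcell _) h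
  -- complementation turns a decreasing last cell into an increasing one
  · have h' := h.comp
    rw [comp_preimage_gridClass] at h'
    have h'' := (Trackable.append
      (isClosed_gridClass (Nat.succ_pos _) fun i => (hcell i.castSucc).comp) h').comp
    have : comp ⁻¹' cell (Fin.last _) = Av perm21 := by
      rw [hlast, comp_preimage_av, comp_perm12]
    rw [← this, ← gridClass_succ fun i => comp ⁻¹' cell i, comp_preimage_gridClass] at h''
    have : (fun i : Fin (n + 2) => comp ⁻¹' (comp ⁻¹' cell i)) = cell := by
      funext i
      exact preimage_preimage comp_comp _
    rwa [this] at h''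

lemma rev_preimage_monotone {D : Set Permutation} (h : D = Av perm21 ∨ D = Av perm12) :
    rev ⁻¹' D = Av perm21 ∨ rev ⁻¹' D = Av perm12 := by
  rcases h with rfl | rfl
  · right
    rw [rev_preimage_av, ← rev_perm12, rev_rev]
  · left
    rw [rev_preimage_av, rev_perm12]

/-- The monotone cells are removed one by one at the right end. If the exceptional cell is the last
one, all permutations are reversed first. -/
theorem trackable_gridClass {k : Kind} {n : ℕ} (cell : Fin n → Set Permutation) (j : Fin n)
    (hcell : ∀ i, IsPermClass (cell i)) (h : Trackable k (cell j))
    (hmono : ∀ i, i ≠ j → cell i = Av perm21 ∨ cell i = Av perm12) :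
    Trackable k (gridClass cell) := by
  induction n with
  | zero => exact j.elim0
  | succ n ih =>
    cases n with
    | zero =>
      rw [gridClass_one]
      rw [Fin.fin_one_eq_zero j] at h
      exact trackable_union_emptyPerm h
    | succ n =>
      have key : ∀ (cell : Fin (n + 2) → Set Permutation) (j : Fin (n + 1)),
          (∀ i, IsPermClass (cell i)) → Trackable k (cell j.castSucc) →
          (∀ i, i ≠ j.castSucc → cell i = Av perm21 ∨ cell i = Av perm12) →
          Trackable k (gridClass cell) := fun cell j hcell h hmono =>
        trackable_gridClass_succ cell hcell
          (ih _ j (fun i => hcell _) h fun i hi => hmono _ fun h' =>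
            hi (Fin.castSucc_injective _ h'))
          (hmono _ (Fin.castSucc_ne_last j).symm)
      induction j using Fin.lastCases with
      | cast j => exact key cell j hcell h hmono
      | last =>
        have h' := key (fun i => rev ⁻¹' cell i.rev) 0 (fun i => (hcell _).rev)
          (by simpa using h.rev)
          fun i hi => rev_preimage_monotone (hmono _ fun h' => hi (by
            rw [Fin.rev_eq_iff, Fin.rev_last] at h'
            simpa using h'))
        have h'' := h'.rev
        rw [rev_preimage_gridClass] at h''
        have : (fun i : Fin (n + 2) => rev ⁻¹' (rev ⁻¹' cell i.rev.rev)) = cell := by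
          funext i
          rw [Fin.rev_rev]
          exact preimage_preimage rev_rev _
        rwa [this] at h''

lemma trackable_iff {k : Kind} {C : Set Permutation} :
    Trackable k C ↔ ∃ S : Spec, (∀ i, (S.eqn i).OfKind k) ∧ S.TracksLR C := by
  constructor
  · rintro ⟨S, hk, hS, φ, hφ⟩
    exact ⟨S, hk, hS, φ, fun x => (hφ x).symm⟩
  · rintro ⟨S, hk, hS, φ, hφ⟩
    exact ⟨S, hk, hS, φ, fun x => (hφ x).symm⟩

lemma Spec.TracksLR.genFun_eq {S : Spec} {C : Set Permutation} (h : S.TracksLR C) :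
    genFun C = genSeries (Obj.size : Obj S (.cls S.start) → ℕ) := by
  obtain ⟨hS, φ, hφ⟩ := h
  rw [SkinnyGrid.genFun_eq]
  refine (genSeries_congr ⟨φ, fun x => ?_⟩).symm
  rw [Obj.size, hφ]
  simp [trackedWord]

lemma isPermClass_of_monotone {D : Set Permutation} (h : D = Av perm21 ∨ D = Av perm12) :
    IsPermClass D := by
  rcases h with rfl | rfl <;> exact isPermClass_av _

end SkinnyGrid

theorem corollary2 (C : Set SkinnyGrid.Permutation) (hC : SkinnyGrid.IsPermClass C)
    (k : ℕ) (cell : Fin k → Set SkinnyGrid.Permutation) (j : Fin k) (hj : cell j = C)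
    (hM : ∀ i, i ≠ j →
      cell i = SkinnyGrid.Av SkinnyGrid.perm21 ∨ cell i = SkinnyGrid.Av SkinnyGrid.perm12) :
    ((∃ S : SkinnyGrid.Spec, S.TracksLR C) →
      (∃ T : SkinnyGrid.Spec, T.TracksLR (SkinnyGrid.gridClass cell)) ∧
      (SkinnyGrid.AlgebraicSeries (SkinnyGrid.genFun C) →
        SkinnyGrid.AlgebraicSeries (SkinnyGrid.genFun (SkinnyGrid.gridClass cell)))) ∧
    ((∃ S : SkinnyGrid.Spec, S.ContextFree ∧ S.TracksLR C) →
      (∃ T : SkinnyGrid.Spec, T.ContextFree ∧ T.TracksLR (SkinnyGrid.gridClass cell)) ∧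
      SkinnyGrid.AlgebraicSeries (SkinnyGrid.genFun (SkinnyGrid.gridClass cell))) ∧
    ((∃ S : SkinnyGrid.Spec, S.Regular ∧ S.TracksLR C) →
      (∃ T : SkinnyGrid.Spec, T.Regular ∧ T.TracksLR (SkinnyGrid.gridClass cell)) ∧
      SkinnyGrid.RationalSeries (SkinnyGrid.genFun (SkinnyGrid.gridClass cell))) := by
  open SkinnyGrid in
  have hcell : ∀ i, IsPermClass (cell i) := fun i => by
    by_cases hi : i = j
    · rw [hi, hj]
      exact hC
    · exact isPermClass_of_monotone (hM i hi)
  open SkinnyGrid in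
  have key : ∀ κ : Kind, (∃ S : Spec, (∀ i, (S.eqn i).OfKind κ) ∧ S.TracksLR C) →
      ∃ T : Spec, (∀ i, (T.eqn i).OfKind κ) ∧ T.TracksLR (gridClass cell) := fun κ h =>
    trackable_iff.1 (trackable_gridClass cell j hcell (hj ▸ trackable_iff.2 h) hM)
  refine ⟨fun ⟨S, hS⟩ => ?_, fun h => ?_, fun h => ?_⟩
  · obtain ⟨T, -, hT⟩ := key .general ⟨S, fun _ => trivial, hS⟩
    refine ⟨⟨T, hT⟩, fun _ => ?_⟩
    rw [hT.genFun_eq]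
    exact SkinnyGrid.algebraicSeries_of_wellDefined hT.1 _
  · obtain ⟨T, hk, hT⟩ := key .contextFree h
    refine ⟨⟨T, hk, hT⟩, ?_⟩
    rw [hT.genFun_eq]
    exact SkinnyGrid.algebraicSeries_of_wellDefined hT.1 _
  · obtain ⟨T, hk, hT⟩ := key .regular h
    refine ⟨⟨T, hk, hT⟩, ?_⟩
    rw [hT.genFun_eq]
    exact SkinnyGrid.rationalSeries_of_regular hT.1 (hk _)
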